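/- Let $S$ be the four-holed sphere, $\pi_1(S)=\langle\alpha,\beta,\gamma,\delta\mid\alpha\beta\gamma\delta=1\rangle$ with $\alpha,\beta,\gamma,\delta$ the boundary loops, and let $\mathcal{MCG}$ be its mapping class group (orientation-preserving homeomorphisms preserving each boundary component, up to isotopy), regarded as the subgroup of $\mathrm{Out}(\pi_1(S))$ generated by the Dehn twists along the simple closed curves $\alpha\beta,\beta\gamma,\alpha\gamma$. Let $\Sigma$ be the trivalent tree dual to the Farey triangulation, and let $\Omega=\mathbb{Q}\cup\{\infty\}$ be its set of complementary regions, identified with the slopes of the essential simple closed curves on $S$ (so that $\alpha\beta,\beta\gamma,\alpha\gamma$ have slopes $0,\infty,-1$). Colour $\Omega$ with three colours so that the three regions meeting at a vertex have different colours and $0,\infty,-1$ have colours $1,2,3$. For $\mu=(p,q,r,s)\in\mathbb{C}^4$, a $\mu$-Markoff map is a function $\phi:\Omega\to\mathbb{C}$ such that (i) if regions $X,Y,Z$ of colours $1,2,3$ meet at a vertex, then $x=\phi(X)$, $y=\phi(Y)$, $z=\phi(Z)$ satisfy $x^2+y^2+z^2+xyz=px+qy+rz+s$; (ii) if the edge $X\cap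 Y$ has its endpoints on the regions $Z$ and $W$, then $\phi(Z)+\phi(W)=c-\phi(X)\phi(Y)$, where $c$ is $p$, $q$ or $r$ according as $Z$ has colour $1$, $2$ or $3$. The set $\Phi_\mu$ of these maps is topologised as a subset of $\mathbb{C}^3$ by $\phi\mapsto(\phi(0),\phi(\infty),\phi(-1))$, and $\mathcal{MCG}$ acts on it through its action on slopes, $(g\phi)(X)=\phi(g^{-1}X)$. Let $\alpha(\mu)=\max\{|p|,|q|,|r|\}/2$. Let $\mathcal{S}_\mu$ be the finite set of those $x\in\mathbb{C}$ such that fixing one of the three coordinates equal to $x$ in the equation in (i) gives a conic in the other two coordinates whose $3\times3$ determinant vanishes; if $p=ab+cd$, $q=ad+bc$, $r=ac+bd$ and $s=4-a^2-b^2-c^2-d^2-abcd$, it consists of the roots of the polynomials $x^2-uvx+u^2+v^2-4$ for the six pairs $\{u,v\}$ from $a,b,c,d$. Put $p_1=p$, $p_2=q$, $p_3=r$ and let $M(\mu)$ be the maximum of $\left|\frac{2p_i-xp_j}{4-x^2}\right|$ over $x\in\mathcal{S}_\mu\setminus\{\pm2\}$ and $i\neq j$ (and $0$ if there is no such $x$).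 Three regions $X,Y,Z$ meeting at a vertex form a sink of $\phi$ if, on each of the three edges at the vertex, the value of $\phi$ at the region containing the other endpoint but not the edge has modulus at least that of $\phi$ at the third region at the vertex. There is a real number $m>2$ with $\min\{|\phi(X)|,|\phi(Y)|,|\phi(Z)|\}\le m$ for every $\phi\in\Phi_\mu$ and every sink $X,Y,Z$ of $\phi$. For any such $m=m(\mu)$ put $L(\mu)=\max\{2+\alpha(\mu),m,M(\mu)+1\}$, and let $(\Phi_\mu)_Q$ be the set of BQ $\mu$-Markoff maps, that is, of $\phi\in\Phi_\mu$ such that $\phi^{-1}([-2,2])=\emptyset$ and $\{X\in\Omega: |\phi(X)|\le L(\mu)\}$ is finite. Theorem. For every $\mu\in\mathbb{C}^4$, the set $(\Phi_\mu)_Q$ is $\mathcal{MCG}$-invariant and open in $\Phi_\mu$, and $\mathcal{MCG}$ acts properly discontinuously on it: for every compact $K\subseteq(\Phi_\mu)_Q$, the set $\{g\in\mathcal{MCG}: gK\cap K\ne\emptyset\}$ is finite. Consequently, let $(a,b,c,d)\in\mathbb{C}^4$ satisfy $(ab+cd,\,ad+bc,\,ac+bd,\,4-a^2-b^2-c^2-d^2-abcd)=\mu$,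 and let $\mathcal{X}_{(a,b,c,d)}$ be the relative character variety of characters of representations $\rho:\pi_1(S)\to\mathrm{SL}(2,\mathbb{C})$ with boundary traces $\operatorname{tr}\rho(\alpha)=a$, $\operatorname{tr}\rho(\beta)=b$, $\operatorname{tr}\rho(\gamma)=c$, $\operatorname{tr}\rho(\delta)=d$, with the topology given by the coordinates $(\operatorname{tr}\rho(\alpha\beta),\operatorname{tr}\rho(\beta\gamma),\operatorname{tr}\rho(\alpha\gamma))\in\mathbb{C}^3$ and the action $\theta[\rho]=[\rho\circ\theta_*^{-1}]$. Then the set of $[\rho]\in\mathcal{X}_{(a,b,c,d)}$ such that $\operatorname{tr}\rho(g)\notin[-2,2]$ for every essential non-peripheral simple closed curve $g$ on $S$, and $|\operatorname{tr}\rho(g)|\le L(\mu)$ for only finitely many free homotopy classes of such unoriented curves, is an $\mathcal{MCG}$-invariant open subset on which $\mathcal{MCG}$ acts properly discontinuously. -/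

import Mathlib

open scoped MatrixGroups

noncomputable section

namespace FourHoledSphere

/-! ## The fundamental group of the four-holed sphere and its mapping class group -/

/-- The fundamental group `⟨α, β, γ, δ ∣ αβγδ⟩` of the four-holed sphere, free on `α, β, γ`. -/
abbrev SurfaceGroup : Type := FreeGroup (Fin 3)

/-- The boundary loop `α`. -/
def gA : SurfaceGroup := FreeGroup.of 0
/-- The boundary loop `β`. -/
def gB : SurfaceGroup := FreeGroup.of 1
/-- The boundary loop `γ`. -/
def gC : SurfaceGroup := FreeGroup.of 2
/-- The boundary loop `δ`, determined by `αβγδ = 1`. -/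
def gD : SurfaceGroup := (gA * gB * gC)⁻¹

/-- An automorphism of `SurfaceGroup` given by the images of `α, β, γ` under it and its inverse. -/
def mkAut (u v : Fin 3 → SurfaceGroup)
    (h₁ : ∀ i, FreeGroup.lift v (u i) = FreeGroup.of i)
    (h₂ : ∀ i, FreeGroup.lift u (v i) = FreeGroup.of i) : MulAut SurfaceGroup :=
  MonoidHom.toMulEquiv (FreeGroup.lift u) (FreeGroup.lift v)
    (by ext i; simp [h₁]) (by ext i; simp [h₂])

theorem mkAut_of (u v : Fin 3 → SurfaceGroup) (h₁ h₂) (i : Fin 3) :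
    mkAut u v h₁ h₂ (FreeGroup.of i) = u i := by
  simp [mkAut]

/-- The Dehn twist along the simple closed curve `αβ` (as an outer automorphism): it is the
identity on the side of the curve carrying `α, β`, and conjugates `γ` by the curve. -/
def twistAB : MulAut SurfaceGroup :=
  mkAut ![gA, gB, (gA * gB)⁻¹ * gC * (gA * gB)] ![gA, gB, (gA * gB) * gC * (gA * gB)⁻¹]
    (by intro i; fin_cases i <;> (simp [gA, gB, gC]; try group))
    (by intro i; fin_cases i <;> (simp [gA, gB, gC]; try group))

/-- The Dehn twist along the simple closed curve `βγ` (as an outer automorphism): it is the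
identity on the side of the curve carrying `β, γ`, and conjugates `α` by the curve. -/
def twistBC : MulAut SurfaceGroup :=
  mkAut ![(gB * gC)⁻¹ * gA * (gB * gC), gB, gC] ![(gB * gC) * gA * (gB * gC)⁻¹, gB, gC]
    (by intro i; fin_cases i <;> (simp [gA, gB, gC]; try group))
    (by intro i; fin_cases i <;> (simp [gA, gB, gC]; try group))

/-- The Dehn twist along the simple closed curve `γα ∼ αγ` (as an outer automorphism): it is the
identity on the side of the curve carrying `γ, α`, and conjugates `β` by the curve. -/
def twistCA : MulAut SurfaceGroup :=
  mkAut ![gA, (gC * gA)⁻¹ * gB * (gC * gA), gC] ![gA, (gC * gA) * gB * (gC * gA)⁻¹, gC]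
    (by intro i; fin_cases i <;> (simp [gA, gB, gC]; try group))
    (by intro i; fin_cases i <;> (simp [gA, gB, gC]; try group))

/-- Inner automorphisms of the fundamental group. -/
def innerAut : Subgroup (MulAut SurfaceGroup) := (MulAut.conj : SurfaceGroup →* _).range

instance innerAut_normal : innerAut.Normal := by
  constructor
  rintro _ ⟨x, rfl⟩ g
  refine ⟨g x, ?_⟩
  ext y
  simp

/-- The automorphisms of the fundamental group induced by orientation-preserving homeomorphisms
that preserve each boundary component: they are generated by the Dehn twists along
`αβ`, `βγ`, `αγ` and the inner automorphisms (change of base point path). -/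
def modAut : Subgroup (MulAut SurfaceGroup) :=
  Subgroup.closure ({twistAB, twistBC, twistCA} ∪ (innerAut : Set (MulAut SurfaceGroup)))

/-- The mapping class group of the four-holed sphere (orientation-preserving homeomorphisms
preserving each boundary component, up to isotopy), as the group of outer automorphisms of
the fundamental group generated by the Dehn twists. -/
abbrev MCG : Type := modAut ⧸ innerAut.subgroupOf modAut

/-! ## The binary tree dual to the Farey triangulation -/

/-- The complementary regions of the binary tree `Σ` dual to the Farey triangulation:
they correspond to the vertices `ℚ ∪ {∞}` of that triangulation, that is, to the slopes. -/
abbrev Region : Type := OnePoint ℚ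

/-- Numerator of a slope, with `∞ = 1/0`. -/
def num : Region → ℤ
  | none => 1
  | some q => q.num

/-- Denominator of a slope, with `∞ = 1/0`. -/
def den : Region → ℤ
  | none => 0
  | some q => q.den

/-- Two regions share an edge of `Σ`: the slopes are Farey neighbours. -/
def Adj (X Y : Region) : Prop := |num X * den Y - num Y * den X| = 1

/-- The tri-colouring, normalised so that `0`, `∞`, `-1` have colours `0`, `1`, `2`. -/
def color (X : Region) : Fin 3 :=
  if Even (num X) then 0 else if Even (den X) then 1 else 2

/-- The regions `X, Y, Z`, of colours `0, 1, 2`, meet at a vertex of `Σ` (a Farey triangle). -/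
def IsVertex (X Y Z : Region) : Prop :=
  color X = 0 ∧ color Y = 1 ∧ color Z = 2 ∧ Adj X Y ∧ Adj Y Z ∧ Adj X Z

/-- `e ↔ (X, Y; Z, W)`: the edge `e = X ∩ Y` of `Σ` has its endpoints on the regions
`Z` and `W`. -/
def IsEdge (X Y Z W : Region) : Prop :=
  Adj X Y ∧ Z ≠ W ∧ Adj X Z ∧ Adj Y Z ∧ Adj X W ∧ Adj Y W

/-! ## Action of the mapping class group on slopes -/

/-- The lattice vector of each boundary generator. -/
def latticeCenter : Fin 3 → Fin 2 → ℤ := ![![0, 1], ![0, 0], ![1, 0]]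

/-- The orbifold covering of the pillowcase by the plane: each boundary loop acts on the plane as
the rotation of angle `π` about a half-lattice point. A loop lying in an even number of
generators acts as a translation; the translation vectors of the curves `αβ`, `βγ`, `αγ`
are `±(0,1)`, `±(1,0)`, `±(-1,1)`, of slopes `0`, `∞`, `-1`. -/
def pillow : SurfaceGroup →* Equiv.Perm (Fin 2 → ℤ) :=
  FreeGroup.lift fun i => Equiv.subLeft (latticeCenter i)

/-- The automorphism `f` of the fundamental group acts on the plane through an affine map
of linear part `A` (congruent to the identity mod 2). -/
def HasLinearPart (f : MulAut SurfaceGroup) (A : SL(2, ℤ)) : Prop :=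
  Even (A.1 0 1) ∧ Even (A.1 1 0) ∧
    ∃ t : Fin 2 → ℤ, ∀ w v,
      pillow (f w) (A.1.mulVec v + t) = A.1.mulVec (pillow w v) + t

theorem HasLinearPart.one : HasLinearPart 1 1 :=
  ⟨by simp, by simp, 0, by simp⟩

theorem HasLinearPart.mul {f g : MulAut SurfaceGroup} {A B : SL(2, ℤ)}
    (hf : HasLinearPart f A) (hg : HasLinearPart g B) : HasLinearPart (f * g) (A * B) := by
  obtain ⟨ha, ha', t, ht⟩ := hf
  obtain ⟨hb, hb', s, hs⟩ := hg
  refine ⟨?_, ?_, A.1.mulVec s + t, fun w v => ?_⟩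
  · simp only [Matrix.SpecialLinearGroup.coe_mul, Matrix.mul_apply, Fin.sum_univ_two]
    exact (hb.mul_left _).add (ha.mul_right _)
  · simp only [Matrix.SpecialLinearGroup.coe_mul, Matrix.mul_apply, Fin.sum_univ_two]
    exact (ha'.mul_right _).add (hb'.mul_left _)
  · have h := ht (g w) (B.1.mulVec v + s)
    rw [hs] at h
    simp only [Matrix.SpecialLinearGroup.coe_mul, ← Matrix.mulVec_mulVec, ← add_assoc,
      Matrix.mulVec_add] at h ⊢
    exact h

theorem HasLinearPart.inv {f : MulAut SurfaceGroup} {A : SL(2, ℤ)}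
    (hf : HasLinearPart f A) : HasLinearPart f⁻¹ A⁻¹ := by
  obtain ⟨ha, ha', t, ht⟩ := hf
  have e₁ : ∀ v, A.1.mulVec ((A⁻¹).1.mulVec v) = v := fun v => by
    rw [Matrix.mulVec_mulVec, ← Matrix.SpecialLinearGroup.coe_mul, mul_inv_cancel]; simp
  have e₂ : ∀ v, (A⁻¹).1.mulVec (A.1.mulVec v) = v := fun v => by
    rw [Matrix.mulVec_mulVec, ← Matrix.SpecialLinearGroup.coe_mul, inv_mul_cancel]; simp
  refine ⟨?_, ?_, -(A⁻¹).1.mulVec t, fun w v => ?_⟩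
  · simpa [Matrix.SpecialLinearGroup.coe_inv, Matrix.adjugate_fin_two] using ha
  · simpa [Matrix.SpecialLinearGroup.coe_inv, Matrix.adjugate_fin_two] using ha'
  · have h := ht (f⁻¹ w) ((A⁻¹).1.mulVec v + -(A⁻¹).1.mulVec t)
    simp only [Matrix.mulVec_add, Matrix.mulVec_neg, e₁, MulAut.apply_inv_self] at h
    have h' := congrArg (fun u => (A⁻¹).1.mulVec (u - t)) h
    simp only [neg_add_cancel_right, add_sub_cancel_right, e₂, Matrix.mulVec_sub] at h'
    rw [← h', sub_eq_add_neg]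

theorem HasLinearPart.unique {f : MulAut SurfaceGroup} {A B : SL(2, ℤ)}
    (hA : HasLinearPart f A) (hB : HasLinearPart f B) : A = B := by
  obtain ⟨-, -, t, ht⟩ := hA
  obtain ⟨-, -, s, hs⟩ := hB
  have key : ∀ w u, (∀ v, pillow w v = v + u) → A.1.mulVec u = B.1.mulVec u := by
    intro w u hu
    have hA : ∀ x, pillow (f w) x = x + A.1.mulVec u := fun x => by
      have := ht w ((A⁻¹).1.mulVec (x - t))
      rw [hu, Matrix.mulVec_add, Matrix.mulVec_mulVec, ← Matrix.SpecialLinearGroup.coe_mul,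
        mul_inv_cancel] at this
      simp only [Matrix.SpecialLinearGroup.coe_one, Matrix.one_mulVec, sub_add_cancel] at this
      rw [this]; abel
    have hB : ∀ x, pillow (f w) x = x + B.1.mulVec u := fun x => by
      have := hs w ((B⁻¹).1.mulVec (x - s))
      rw [hu, Matrix.mulVec_add, Matrix.mulVec_mulVec, ← Matrix.SpecialLinearGroup.coe_mul,
        mul_inv_cancel] at this
      simp only [Matrix.SpecialLinearGroup.coe_one, Matrix.one_mulVec, sub_add_cancel] at this
      rw [this]; abel
    have := (hA 0).symm.trans (hB 0)
    simpa using this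
  have h1 := key (gA * gB) ![0, 1] (fun v => by
    funext i; fin_cases i <;> simp [gA, gB, pillow, latticeCenter, Matrix.vecHead, Matrix.vecTail]
    all_goals ring)
  have h2 := key (gC * gB) ![1, 0] (fun v => by
    funext i; fin_cases i <;> simp [gC, gB, pillow, latticeCenter, Matrix.vecHead, Matrix.vecTail]
    all_goals ring)
  refine Matrix.SpecialLinearGroup.ext _ _ fun i j => ?_
  have h1 := congrFun h1 i
  have h2 := congrFun h2 i
  fin_cases j
  · simpa [Matrix.mulVec, dotProduct] using h2
  · simpa [Matrix.mulVec, dotProduct] using h1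

/-- It is enough to check the affine relation on the generators. -/
theorem HasLinearPart.of_generators {f : MulAut SurfaceGroup} (A : SL(2, ℤ))
    (h₁ : Even (A.1 0 1)) (h₂ : Even (A.1 1 0)) (t : Fin 2 → ℤ)
    (h : ∀ i v, pillow (f (FreeGroup.of i)) (A.1.mulVec v + t)
      = A.1.mulVec (pillow (FreeGroup.of i) v) + t) : HasLinearPart f A := by
  refine ⟨h₁, h₂, t, fun w => ?_⟩
  induction w using FreeGroup.induction_on with
  | C1 => simp
  | of i => exact h i
  | inv_of i hi =>
    intro v
    have h' := hi ((pillow (FreeGroup.of i))⁻¹ v)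
    rw [map_inv, map_inv, map_inv, Equiv.Perm.inv_eq_iff_eq, h']
    simp
  | mul x y hx hy =>
    intro v
    rw [map_mul, map_mul, Equiv.Perm.mul_apply, hy, hx, map_mul, Equiv.Perm.mul_apply]

theorem hasLinearPart_twistAB :
    HasLinearPart twistAB ⟨!![1, 0; -2, 1], by simp [Matrix.det_fin_two_of]⟩ := by
  refine .of_generators _ (by simp) (by decide) 0 fun i v => ?_
  rw [twistAB, mkAut_of]
  funext j
  fin_cases i <;> fin_cases j <;>
    simp [gA, gB, gC, pillow, latticeCenter, dotProduct, Matrix.vecHead, Matrix.vecTail] <;>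
    try ring

theorem hasLinearPart_twistBC :
    HasLinearPart twistBC ⟨!![1, 2; 0, 1], by simp [Matrix.det_fin_two_of]⟩ := by
  refine .of_generators _ (by decide) (by simp) 0 fun i v => ?_
  rw [twistBC, mkAut_of]
  funext j
  fin_cases i <;> fin_cases j <;>
    simp [gA, gB, gC, pillow, latticeCenter, dotProduct, Matrix.vecHead, Matrix.vecTail] <;>
    try ring

theorem hasLinearPart_twistCA :
    HasLinearPart twistCA ⟨!![3, 2; -2, -1], by simp [Matrix.det_fin_two_of]⟩ := by
  refine .of_generators _ (by decide) (by decide) ![-1, 1] fun i v => ?_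
  rw [twistCA, mkAut_of]
  funext j
  fin_cases i <;> fin_cases j <;>
    simp [gA, gB, gC, pillow, latticeCenter, dotProduct, Matrix.vecHead, Matrix.vecTail] <;>
    try ring

/-- Inner automorphisms act with linear part `1` or `-1`. -/
theorem hasLinearPart_conj (g : SurfaceGroup) :
    HasLinearPart (MulAut.conj g) 1 ∨ HasLinearPart (MulAut.conj g) (-1) := by
  induction g using FreeGroup.induction_on with
  | C1 => left; rw [map_one]; exact .one
  | of i =>
    right
    refine ⟨by simp, by simp, latticeCenter i, fun w v => ?_⟩
    simp [pillow, Equiv.Perm.mul_apply, Matrix.neg_mulVec, sub_eq_add_neg]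
    abel
  | inv_of i hi =>
    rw [map_inv]
    rcases hi with h | h
    · left; simpa using h.inv
    · right; simpa using h.inv
  | mul x y hx hy =>
    rw [map_mul]
    rcases hx with hx | hx <;> rcases hy with hy | hy
    · left; simpa using hx.mul hy
    · right; simpa using hx.mul hy
    · right; simpa using hx.mul hy
    · left; simpa using hx.mul hy

theorem exists_hasLinearPart (f : modAut) : ∃ A, HasLinearPart f.1 A := by
  obtain ⟨f, hf⟩ := f
  induction hf using Subgroup.closure_induction with
  | mem x hx =>
    rcases hx with (rfl | rfl | rfl) | ⟨g, rfl⟩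
    · exact ⟨_, hasLinearPart_twistAB⟩
    · exact ⟨_, hasLinearPart_twistBC⟩
    · exact ⟨_, hasLinearPart_twistCA⟩
    · rcases hasLinearPart_conj g with h | h
      · exact ⟨_, h⟩
      · exact ⟨_, h⟩
  | one => exact ⟨1, .one⟩
  | mul x y _ _ hx hy =>
    obtain ⟨A, hA⟩ := hx
    obtain ⟨B, hB⟩ := hy
    exact ⟨_, hA.mul hB⟩
  | inv x _ hx =>
    obtain ⟨A, hA⟩ := hx
    exact ⟨_, hA.inv⟩

/-- The linear part of the affine action on the plane. -/
def linearPart : modAut →* SL(2, ℤ) where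
  toFun f := (exists_hasLinearPart f).choose
  map_one' := (exists_hasLinearPart 1).choose_spec.unique .one
  map_mul' f g := (exists_hasLinearPart (f * g)).choose_spec.unique
    ((exists_hasLinearPart f).choose_spec.mul (exists_hasLinearPart g).choose_spec)

theorem linearPart_spec (f : modAut) : HasLinearPart f.1 (linearPart f) :=
  (exists_hasLinearPart f).choose_spec

/-- `SL(2, ℤ)` acts on slopes `ℚ ∪ {∞}` by Möbius transformations. -/
def moebius : SL(2, ℤ) →* Equiv.Perm Region :=
  (MulAction.toPermHom (GL (Fin 2) ℚ) Region).comp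
    (Matrix.SpecialLinearGroup.toGL.comp (Matrix.SpecialLinearGroup.map (Int.castRingHom ℚ)))

theorem moebius_neg_one : moebius (-1) = 1 := by
  ext1 s
  induction s using OnePoint.rec with
  | infty => simp [moebius, OnePoint.smul_infty_eq_ite]
  | coe q => simp [moebius, OnePoint.smul_some_eq_ite]

/-- The action of the mapping class group on slopes. -/
def slopeHom : MCG →* Equiv.Perm Region :=
  QuotientGroup.lift _ (moebius.comp linearPart) (by
    rintro f ⟨g, hg⟩
    have hf := linearPart_spec f
    simp only [Subgroup.coe_subtype] at hg
    rw [← hg] at hf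
    rw [MonoidHom.mem_ker, MonoidHom.comp_apply]
    rcases hasLinearPart_conj g with h | h
    · rw [hf.unique h, map_one]
    · rw [hf.unique h, moebius_neg_one])

instance : MulAction MCG Region := MulAction.compHom Region slopeHom

theorem mk_smul_region (f : modAut) (X : Region) :
    (QuotientGroup.mk f : MCG) • X = moebius (linearPart f) X := rfl

theorem num_den_of_coprime (a c : ℤ) (h : IsCoprime a c) : ∃ e : ℤ, (e = 1 ∨ e = -1) ∧
    num (if (c : ℚ) = 0 then (OnePoint.infty : Region) else ((a / c : ℚ) : Region)) = e * a ∧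
    den (if (c : ℚ) = 0 then (OnePoint.infty : Region) else ((a / c : ℚ) : Region)) = e * c := by
  have hsome : ∀ q : ℚ, num (q : Region) = q.num ∧ den (q : Region) = q.den :=
    fun q => ⟨rfl, rfl⟩
  have hinf : num (OnePoint.infty : Region) = 1 ∧ den (OnePoint.infty : Region) = 0 := ⟨rfl, rfl⟩
  rcases lt_trichotomy c 0 with hc | rfl | hc
  · refine ⟨-1, .inr rfl, ?_⟩
    have hc' : (c : ℚ) ≠ 0 := by exact_mod_cast hc.ne
    have hcop : (-a).natAbs.Coprime (-c).natAbs := by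
      simpa [Int.gcd, Nat.Coprime] using Int.isCoprime_iff_gcd_eq_one.1 h
    have e : (a / c : ℚ) = ((-a : ℤ) : ℚ) / ((-c : ℤ) : ℚ) := by push_cast; rw [neg_div_neg_eq]
    rw [if_neg hc', (hsome _).1, (hsome _).2, e, Rat.num_div_eq_of_coprime (by omega) hcop,
      Rat.den_div_eq_of_coprime (by omega) hcop]
    constructor <;> ring
  · rw [Int.cast_zero, if_pos rfl, hinf.1, hinf.2]
    rcases Int.isUnit_iff.1 (isCoprime_zero_right.1 h) with rfl | rfl
    · exact ⟨1, .inl rfl, by simp, by simp⟩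
    · exact ⟨-1, .inr rfl, by simp, by simp⟩
  · refine ⟨1, .inl rfl, ?_⟩
    have hc' : (c : ℚ) ≠ 0 := by exact_mod_cast hc.ne'
    have hcop : a.natAbs.Coprime c.natAbs := Int.isCoprime_iff_gcd_eq_one.1 h
    rw [if_neg hc', (hsome _).1, (hsome _).2, Rat.num_div_eq_of_coprime hc hcop,
      Rat.den_div_eq_of_coprime hc hcop]
    constructor <;> ring

theorem isCoprime_num_den (X : Region) : IsCoprime (num X) (den X) := by
  induction X using OnePoint.rec with
  | infty => exact isCoprime_one_left
  | coe q => exact Int.isCoprime_iff_gcd_eq_one.2 q.reduced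

/-- In homogeneous coordinates a Möbius transformation is given by its matrix. -/
theorem num_den_moebius (A : SL(2, ℤ)) (X : Region) : ∃ e : ℤ, (e = 1 ∨ e = -1) ∧
    num (moebius A X) = e * (A.1 0 0 * num X + A.1 0 1 * den X) ∧
    den (moebius A X) = e * (A.1 1 0 * num X + A.1 1 1 * den X) := by
  have hdet : A.1 0 0 * A.1 1 1 - A.1 0 1 * A.1 1 0 = 1 := by
    rw [← Matrix.det_fin_two]; exact A.2
  have hcop : IsCoprime (A.1 0 0 * num X + A.1 0 1 * den X)
      (A.1 1 0 * num X + A.1 1 1 * den X) := by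
    obtain ⟨u, v, huv⟩ := isCoprime_num_den X
    refine ⟨u * A.1 1 1 - v * A.1 1 0, v * A.1 0 0 - u * A.1 0 1, ?_⟩
    linear_combination (u * num X + v * den X) * hdet + huv
  have hX : moebius A X = if ((A.1 1 0 * num X + A.1 1 1 * den X : ℤ) : ℚ) = 0 then
      (OnePoint.infty : Region) else
      (((A.1 0 0 * num X + A.1 0 1 * den X : ℤ) / (A.1 1 0 * num X + A.1 1 1 * den X : ℤ) : ℚ) :
        Region) := by
    induction X using OnePoint.rec with
    | infty =>
      have h : num (OnePoint.infty : Region) = 1 ∧ den (OnePoint.infty : Region) = 0 := ⟨rfl, rfl⟩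
      simp [moebius, OnePoint.smul_infty_eq_ite, h.1, h.2]
    | coe q =>
      have h : num (q : Region) = q.num ∧ den (q : Region) = q.den := ⟨rfl, rfl⟩
      have hq : (q.den : ℚ) ≠ 0 := by exact_mod_cast q.den_nz
      have e1 : ((A.1 1 0 * q.num + A.1 1 1 * q.den : ℤ) : ℚ)
          = (A.1 1 0 * q + A.1 1 1) * q.den := by
        push_cast; rw [add_mul, mul_assoc, Rat.mul_den_eq_num]
      have e2 : ((A.1 0 0 * q.num + A.1 0 1 * q.den : ℤ) : ℚ)
          = (A.1 0 0 * q + A.1 0 1) * q.den := by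
        push_cast; rw [add_mul, mul_assoc, Rat.mul_den_eq_num]
      rw [h.1, h.2, e1, e2, mul_div_mul_right _ _ hq]
      simp [moebius, OnePoint.smul_some_eq_ite, hq]
  rw [hX]
  exact num_den_of_coprime _ _ hcop

theorem adj_smul (g : MCG) {X Y : Region} : Adj (g • X) (g • Y) ↔ Adj X Y := by
  induction g using QuotientGroup.induction_on with | H f
  rw [mk_smul_region, mk_smul_region]
  generalize linearPart f = A
  have hdet : A.1 0 0 * A.1 1 1 - A.1 0 1 * A.1 1 0 = 1 := by
    rw [← Matrix.det_fin_two]; exact A.2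
  obtain ⟨e, he, h1, h2⟩ := num_den_moebius A X
  obtain ⟨e', he', h1', h2'⟩ := num_den_moebius A Y
  have key : num (moebius A X) * den (moebius A Y) - num (moebius A Y) * den (moebius A X)
      = e * e' * (num X * den Y - num Y * den X) := by
    rw [h1, h2, h1', h2']
    linear_combination e * e' * (num X * den Y - num Y * den X) * hdet
  have habs : |e * e'| = 1 := by rcases he with rfl | rfl <;> rcases he' with rfl | rfl <;> simp
  rw [Adj, Adj, key, abs_mul, habs, one_mul]

theorem color_smul (g : MCG) (X : Region) : color (g • X) = color X := by
  induction g using QuotientGroup.induction_on with | H f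
  rw [mk_smul_region]
  obtain ⟨hb, hc, -⟩ := linearPart_spec f
  revert hb hc
  generalize linearPart f = A
  intro hb hc
  have hdet : A.1 0 0 * A.1 1 1 - A.1 0 1 * A.1 1 0 = 1 := by
    rw [← Matrix.det_fin_two]; exact A.2
  have hodd : Odd (A.1 0 0 * A.1 1 1) := by
    rw [show A.1 0 0 * A.1 1 1 = A.1 0 1 * A.1 1 0 + 1 by linarith]
    exact (hb.mul_right _).add_one
  obtain ⟨ha, hd⟩ := Int.odd_mul.1 hodd
  obtain ⟨e, he, h1, h2⟩ := num_den_moebius A X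
  have e1 : Even (num (moebius A X)) ↔ Even (num X) := by
    rw [h1]
    rcases he with rfl | rfl <;>
      simp [Int.even_add, Int.even_mul, hb, Int.not_even_iff_odd.2 ha, -Int.not_even_iff_odd]
  have e2 : Even (den (moebius A X)) ↔ Even (den X) := by
    rw [h2]
    rcases he with rfl | rfl <;>
      simp [Int.even_add, Int.even_mul, hc, Int.not_even_iff_odd.2 hd, -Int.not_even_iff_odd]
  simp only [color, e1, e2]

theorem isVertex_smul (g : MCG) {X Y Z : Region} (h : IsVertex X Y Z) :
    IsVertex (g • X) (g • Y) (g • Z) := by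
  simpa only [IsVertex, color_smul, adj_smul] using h

theorem isEdge_smul (g : MCG) {X Y Z W : Region} (h : IsEdge X Y Z W) :
    IsEdge (g • X) (g • Y) (g • Z) (g • W) := by
  simpa only [IsEdge, adj_smul, ne_eq, smul_left_cancel_iff] using h

/-! ## Markoff maps -/

/-- The coefficients `(p, q, r, s)` of the Markoff equation. -/
@[ext] structure Param where
  p : ℂ
  q : ℂ
  r : ℂ
  s : ℂ

/-- The linear coefficients `p, q, r`, indexed by colour. -/
def Param.coef (μ : Param) : Fin 3 → ℂ := ![μ.p, μ.q, μ.r]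

/-- `(x, y, z)` satisfies `x² + y² + z² + xyz = px + qy + rz + s`. -/
def IsMarkoffTriple (μ : Param) (x y z : ℂ) : Prop :=
  x ^ 2 + y ^ 2 + z ^ 2 + x * y * z = μ.p * x + μ.q * y + μ.r * z + μ.s

/-- A `μ`-Markoff map. -/
@[ext] structure MarkoffMap (μ : Param) where
  toFun : Region → ℂ
  vertex : ∀ X Y Z, IsVertex X Y Z → IsMarkoffTriple μ (toFun X) (toFun Y) (toFun Z)
  edge : ∀ X Y Z W, IsEdge X Y Z W →
    toFun Z + toFun W = μ.coef (color Z) - toFun X * toFun Y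

instance (μ : Param) : CoeFun (MarkoffMap μ) fun _ => Region → ℂ := ⟨MarkoffMap.toFun⟩

/-- The topology on Markoff maps as a subset of `ℂ³`, through the values on the regions
`0`, `∞`, `-1`, which meet at a vertex. -/
instance (μ : Param) : TopologicalSpace (MarkoffMap μ) :=
  .induced (fun φ => (φ ((0 : ℚ) : Region), φ OnePoint.infty, φ ((-1 : ℚ) : Region)))
    (inferInstance : TopologicalSpace (ℂ × ℂ × ℂ))

/-- The action of the mapping class group on Markoff maps: `(g • φ)(X) = φ(g⁻¹ X)`. -/
instance (μ : Param) : MulAction MCG (MarkoffMap μ) where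
  smul g φ :=
    { toFun := fun X => φ (g⁻¹ • X)
      vertex := fun _ _ _ h => φ.vertex _ _ _ (isVertex_smul g⁻¹ h)
      edge := fun X Y Z W h => by
        rw [φ.edge _ _ _ _ (isEdge_smul g⁻¹ h), color_smul] }
  one_smul φ := by
    ext X
    change φ ((1 : MCG)⁻¹ • X) = φ X
    simp
  mul_smul g h φ := by
    ext X
    change φ ((g * h)⁻¹ • X) = φ (h⁻¹ • g⁻¹ • X)
    rw [mul_inv_rev, mul_smul]

/-- The constant `α(μ) = max{|p|, |q|, |r|} / 2`. -/
def alpha (μ : Param) : ℝ := max ‖μ.p‖ (max ‖μ.q‖ ‖μ.r‖) / 2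

/-- The vertex `X ∩ Y ∩ Z` is a sink for `φ`: the arrow on each of the three edges, which points
towards the end of smaller modulus, (with either choice allowed in case of equality) can be
chosen to point towards the vertex. -/
def IsSink {μ : Param} (φ : MarkoffMap μ) (X Y Z : Region) : Prop :=
  IsVertex X Y Z ∧ (∀ X', IsEdge Y Z X X' → ‖φ X‖ ≤ ‖φ X'‖) ∧
    (∀ Y', IsEdge X Z Y Y' → ‖φ Y‖ ≤ ‖φ Y'‖) ∧ (∀ Z', IsEdge X Y Z Z' → ‖φ Z‖ ≤ ‖φ Z'‖)

/-- `m > 2` bounds the smallest modulus around every sink of every `μ`-Markoff map. -/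
def IsSinkBound (μ : Param) (m : ℝ) : Prop :=
  2 < m ∧ ∀ (φ : MarkoffMap μ) (X Y Z : Region), IsSink φ X Y Z →
    min ‖φ X‖ (min ‖φ Y‖ ‖φ Z‖) ≤ m

/-- Four times the determinant of the conic in `(y, z)` cut out by the Markoff equation with
linear coefficients `p, q, r`, for fixed `x`. -/
def conicDet (p q r s x : ℂ) : ℂ :=
  (x ^ 2 - p * x - s) * (4 - x ^ 2) + x * q * r - q ^ 2 - r ^ 2

/-- The finite set `S_μ` of the values `x` of a coordinate for which the conic in the other
two coordinates degenerates. -/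
def singularValues (μ : Param) : Set ℂ :=
  {x | conicDet μ.p μ.q μ.r μ.s x = 0 ∨ conicDet μ.q μ.r μ.p μ.s x = 0 ∨
    conicDet μ.r μ.p μ.q μ.s x = 0}

/-- `M(μ)`: the largest modulus of the coordinates of the centers of the degenerate conics. -/
def centerBound (μ : Param) : ℝ :=
  sSup {t | ∃ x ∈ singularValues μ, x ≠ 2 ∧ x ≠ -2 ∧ ∃ i j : Fin 3, i ≠ j ∧
    t = ‖(2 * μ.coef i - x * μ.coef j) / (4 - x ^ 2)‖}

/-- `L(μ) = max{2 + α(μ), m, M(μ) + 1}`. -/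
def bqConst (μ : Param) (m : ℝ) : ℝ := max (2 + alpha μ) (max m (centerBound μ + 1))

/-- The segment `[-2, 2]` in `ℂ`. -/
def realSegment : Set ℂ := (fun t : ℝ => (t : ℂ)) '' Set.Icc (-2) 2

/-- The `μ`-Markoff maps satisfying the BQ-conditions with constant `L`. -/
def bowditchMaps (μ : Param) (L : ℝ) : Set (MarkoffMap μ) :=
  {φ | (∀ X, φ X ∉ realSegment) ∧ {X | ‖φ X‖ ≤ L}.Finite}

/-! ## Relative character varieties -/

/-- The traces `(a, b, c, d)` of the boundary loops. -/
structure BoundaryTraces where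
  a : ℂ
  b : ℂ
  c : ℂ
  d : ℂ

/-- The map `GT`, from boundary traces to coefficients of the Markoff equation. -/
def GT (τ : BoundaryTraces) : Param where
  p := τ.a * τ.b + τ.c * τ.d
  q := τ.a * τ.d + τ.b * τ.c
  r := τ.a * τ.c + τ.b * τ.d
  s := 4 - τ.a ^ 2 - τ.b ^ 2 - τ.c ^ 2 - τ.d ^ 2 - τ.a * τ.b * τ.c * τ.d

/-- The polynomial `κ_{u,v}(x) = x² - uvx + u² + v² - 4`. -/
def kappa (u v x : ℂ) : ℂ := x ^ 2 - u * v * x + u ^ 2 + v ^ 2 - 4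

/-- The singular values of `GT(a, b, c, d)` are the roots of the `κ_{u,v}` for the pairs
`{u, v}` of boundary traces. -/
theorem mem_singularValues_GT (τ : BoundaryTraces) (x : ℂ) :
    x ∈ singularValues (GT τ) ↔
      (kappa τ.a τ.b x = 0 ∨ kappa τ.c τ.d x = 0) ∨
      (kappa τ.a τ.d x = 0 ∨ kappa τ.b τ.c x = 0) ∨
      (kappa τ.a τ.c x = 0 ∨ kappa τ.b τ.d x = 0) := by
  have h1 : conicDet (GT τ).p (GT τ).q (GT τ).r (GT τ).s x
      = -(kappa τ.a τ.b x * kappa τ.c τ.d x) := by simp only [conicDet, GT, kappa]; ring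
  have h2 : conicDet (GT τ).q (GT τ).r (GT τ).p (GT τ).s x
      = -(kappa τ.a τ.d x * kappa τ.b τ.c x) := by simp only [conicDet, GT, kappa]; ring
  have h3 : conicDet (GT τ).r (GT τ).p (GT τ).q (GT τ).s x
      = -(kappa τ.a τ.c x * kappa τ.b τ.d x) := by simp only [conicDet, GT, kappa]; ring
  simp only [singularValues, Set.mem_ofPred_eq, h1, h2, h3, neg_eq_zero, mul_eq_zero]

/-- A point of the relative character variety: the character of a representation into
`SL(2, ℂ)` with prescribed boundary traces. -/
@[ext] structure RelCharacter (τ : BoundaryTraces) where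
  toFun : SurfaceGroup → ℂ
  exists_rep : ∃ ρ : SurfaceGroup →* SL(2, ℂ), ∀ g, toFun g = (ρ g).1.trace
  trace_a : toFun gA = τ.a
  trace_b : toFun gB = τ.b
  trace_c : toFun gC = τ.c
  trace_d : toFun gD = τ.d

instance (τ : BoundaryTraces) : CoeFun (RelCharacter τ) fun _ => SurfaceGroup → ℂ :=
  ⟨RelCharacter.toFun⟩

/-- The topology of the relative character variety as a subset of `ℂ³`, through the coordinates
`x = tr ρ(αβ)`, `y = tr ρ(βγ)`, `z = tr ρ(αγ)`. -/
instance (τ : BoundaryTraces) : TopologicalSpace (RelCharacter τ) :=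
  .induced (fun χ => (χ (gA * gB), χ (gB * gC), χ (gA * gC)))
    (inferInstance : TopologicalSpace (ℂ × ℂ × ℂ))

theorem RelCharacter.apply_conj {τ : BoundaryTraces} (χ : RelCharacter τ) {g h : SurfaceGroup}
    (hgh : IsConj g h) : χ g = χ h := by
  obtain ⟨ρ, hρ⟩ := χ.exists_rep
  obtain ⟨c, rfl⟩ := isConj_iff.1 hgh
  rw [hρ, hρ, map_mul, map_mul, map_inv, Matrix.SpecialLinearGroup.coe_mul, Matrix.trace_mul_comm,
    ← Matrix.SpecialLinearGroup.coe_mul, inv_mul_cancel_left]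

/-- The automorphisms that preserve the conjugacy class of each boundary loop. -/
def peripheral : Subgroup (MulAut SurfaceGroup) where
  carrier := {f | ∀ g, g = gA ∨ g = gB ∨ g = gC ∨ g = gD → IsConj (f g) g}
  one_mem' := fun g _ => IsConj.refl g
  mul_mem' := fun {f₁ f₂} h₁ h₂ g hg => by
    have := (f₁ : SurfaceGroup →* SurfaceGroup).map_isConj (h₂ g hg)
    exact this.trans (h₁ g hg)
  inv_mem' := fun {f} h g hg => by
    have := ((f⁻¹ : MulAut SurfaceGroup) : SurfaceGroup →* SurfaceGroup).map_isConj (h g hg)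
    simpa using this.symm

theorem modAut_le_peripheral : modAut ≤ peripheral := by
  have hof : ∀ u v h₁ h₂, mkAut u v h₁ h₂ gA = u 0 ∧ mkAut u v h₁ h₂ gB = u 1 ∧
      mkAut u v h₁ h₂ gC = u 2 := fun u v h₁ h₂ =>
    ⟨mkAut_of u v h₁ h₂ 0, mkAut_of u v h₁ h₂ 1, mkAut_of u v h₁ h₂ 2⟩
  refine (Subgroup.closure_le _).2 ?_
  rintro _ ((rfl | rfl | rfl) | ⟨x, rfl⟩) g hg
  · obtain ⟨h1, h2, h3⟩ : twistAB gA = gA ∧ twistAB gB = gB ∧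
      twistAB gC = (gA * gB)⁻¹ * gC * (gA * gB) := hof _ _ _ _
    rcases hg with rfl | rfl | rfl | rfl
    · rw [h1]
    · rw [h2]
    · rw [h3]; exact isConj_iff.2 ⟨gA * gB, by group⟩
    · rw [gD, map_inv, map_mul, map_mul, h1, h2, h3]
      exact isConj_iff.2 ⟨gA * gB, by group⟩
  · obtain ⟨h1, h2, h3⟩ : twistBC gA = (gB * gC)⁻¹ * gA * (gB * gC) ∧ twistBC gB = gB ∧
      twistBC gC = gC := hof _ _ _ _
    rcases hg with rfl | rfl | rfl | rfl
    · rw [h1]; exact isConj_iff.2 ⟨gB * gC, by group⟩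
    · rw [h2]
    · rw [h3]
    · rw [gD, map_inv, map_mul, map_mul, h1, h2, h3]
      exact isConj_iff.2 ⟨gB * gC, by group⟩
  · obtain ⟨h1, h2, h3⟩ : twistCA gA = gA ∧ twistCA gB = (gC * gA)⁻¹ * gB * (gC * gA) ∧
      twistCA gC = gC := hof _ _ _ _
    rcases hg with rfl | rfl | rfl | rfl
    · rw [h1]
    · rw [h2]; exact isConj_iff.2 ⟨gC * gA, by group⟩
    · rw [h3]
    · rw [gD, map_inv, map_mul, map_mul, h1, h2, h3]
      exact isConj_iff.2 ⟨gA * gC, by group⟩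
  · exact (isConj_iff.2 ⟨x, by simp⟩ : IsConj g _).symm

/-- The action of automorphisms on characters: `f • [ρ] = [ρ ∘ f⁻¹]`. -/
def autActChar (τ : BoundaryTraces) (f : modAut) (χ : RelCharacter τ) : RelCharacter τ where
  toFun g := χ (f.1⁻¹ g)
  exists_rep := by
    obtain ⟨ρ, hρ⟩ := χ.exists_rep
    exact ⟨ρ.comp (f.1⁻¹ : MulAut SurfaceGroup).toMonoidHom, fun g => hρ _⟩
  trace_a := by
    rw [χ.apply_conj (modAut_le_peripheral (inv_mem f.2) gA (by simp)), χ.trace_a]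
  trace_b := by
    rw [χ.apply_conj (modAut_le_peripheral (inv_mem f.2) gB (by simp)), χ.trace_b]
  trace_c := by
    rw [χ.apply_conj (modAut_le_peripheral (inv_mem f.2) gC (by simp)), χ.trace_c]
  trace_d := by
    rw [χ.apply_conj (modAut_le_peripheral (inv_mem f.2) gD (by simp)), χ.trace_d]

/-- The same, as a group action. -/
@[reducible] def autCharAction (τ : BoundaryTraces) : MulAction modAut (RelCharacter τ) where
  smul f χ := autActChar τ f χ
  one_smul χ := by
    ext g
    change χ ((1 : MulAut SurfaceGroup)⁻¹ g) = χ g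
    simp
  mul_smul f h χ := by
    ext g
    change χ ((f.1 * h.1)⁻¹ g) = χ (h.1⁻¹ (f.1⁻¹ g))
    simp

/-- The action on characters descends to the mapping class group. -/
def charHom (τ : BoundaryTraces) : MCG →* Equiv.Perm (RelCharacter τ) :=
  QuotientGroup.lift _ (@MulAction.toPermHom modAut (RelCharacter τ) _ (autCharAction τ)) (by
    rintro f ⟨x, hx⟩
    rw [MonoidHom.mem_ker]
    ext χ g
    change χ (f.1⁻¹ g) = χ g
    simp only [Subgroup.coe_subtype] at hx
    rw [← hx, ← map_inv]
    exact (χ.apply_conj (isConj_iff.2 ⟨x⁻¹, by simp⟩)).symm)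

instance (τ : BoundaryTraces) : MulAction MCG (RelCharacter τ) :=
  MulAction.compHom _ (charHom τ)

/-- Free homotopy of unoriented closed curves: `g ∼ h` if `g` is conjugate to `h` or `h⁻¹`. -/
def curveSetoid : Setoid SurfaceGroup where
  r g h := IsConj g h ∨ IsConj g h⁻¹
  iseqv :=
    { refl := fun g => .inl (IsConj.refl g)
      symm := by
        have hinv : ∀ {g h : SurfaceGroup}, IsConj g h → IsConj g⁻¹ h⁻¹ := fun {g h} H => by
          obtain ⟨c, rfl⟩ := isConj_iff.1 H
          exact isConj_iff.2 ⟨c, by group⟩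
        rintro g h (H | H)
        · exact .inl H.symm
        · exact .inr (by simpa using (hinv H).symm)
      trans := by
        have hinv : ∀ {g h : SurfaceGroup}, IsConj g h → IsConj g⁻¹ h⁻¹ := fun {g h} H => by
          obtain ⟨c, rfl⟩ := isConj_iff.1 H
          exact isConj_iff.2 ⟨c, by group⟩
        rintro g h k (H | H) (K | K)
        · exact .inl (H.trans K)
        · exact .inr (H.trans K)
        · exact .inr (H.trans (hinv K))
        · exact .inl (by simpa using H.trans (hinv K)) }

/-- Free homotopy classes of unoriented closed curves. -/
abbrev CurveClass : Type := Quotient curveSetoid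

/-- The elements of the fundamental group that represent essential, non-peripheral simple closed
curves: the images under the mapping class group of `αβ`, `βγ`, `αγ` (one curve for each of
the ways of separating the boundary components into pairs). -/
def IsSimple (g : SurfaceGroup) : Prop :=
  ∃ f ∈ modAut, ∃ g₀, (g₀ = gA * gB ∨ g₀ = gB * gC ∨ g₀ = gA * gC) ∧
    curveSetoid.r g (f g₀)

/-- The characters in the relative character variety satisfying the BQ-conditions with
constant `K`. -/
def bowditchChars (τ : BoundaryTraces) (K : ℝ) : Set (RelCharacter τ) :=
  {χ | (∀ g, IsSimple g → χ g ∉ realSegment) ∧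
    {c : CurveClass | ∃ g, IsSimple g ∧ c = Quotient.mk curveSetoid g ∧ ‖χ g‖ ≤ K}.Finite}

/-! ## Properly discontinuous actions -/

/-- `D` is invariant under `G` and `G` acts properly discontinuously on `D`: for every compact
`K ⊆ D` only finitely many elements `g` of `G` satisfy `gK ∩ K ≠ ∅`. -/
def ActsProperlyDiscontinuouslyOn (G : Type*) {X : Type*} [Group G] [TopologicalSpace X]
    [MulAction G X] (D : Set X) : Prop :=
  (∀ (g : G), ∀ x ∈ D, g • x ∈ D) ∧
    ∀ K ⊆ D, IsCompact K → {g : G | ((fun x => g • x) '' K ∩ K).Nonempty}.Finite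

end FourHoledSphere

end

noncomputable section

namespace FourHoledSphere

section

/-! ## Slopes as lattice vectors up to sign -/

/-! Regions are primitive vectors of ℤ² up to sign, edges of the tree are bases (u, v), and the two
ends of such an edge lie on u + v and u − v. The edge relation gives |φ(u)||φ(v)| ≤ 2α + |φ(u+v)| +
|φ(u−v)|. Hence, once |φ(u)|, |φ(v)| > L ≥ 2 + α and φ(u+v) is larger than both in modulus, the
values beyond the edge grow by at least a fixed `gap` per step. This escape condition consists of
finitely many strict inequalities, so it holds uniformly near a given map.

The core is `exists_nhds_finite`: a BQ map φ₀ has a neighbourhood U such that, for each N, only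
finitely many regions X satisfy |φ(X)| ≤ N for some φ in U. Since |φ₀| > L off a finite set, deep
enough edges have no small value strictly beyond them (`good_of_mem_bowditchMaps`). If the two sides
of such an edge are large too, the values drop by a fixed amount until the edges escape
(`good_of_norm_gt`). If a side u is small, one follows its boundary regions v + nu. Their values
satisfy a second-order recurrence with characteristic roots l and 1/l, where |l| > 1 because φ₀(u)
is not in [-2, 2]. They are unbounded (`exists_lt_norm_val_ray`): otherwise they would converge
alternately to the coordinates of the centre of a conic, the centre would lie on the conic, the
conic would be degenerate, and infinitely many values would lie below M + 1 ≤ L. Far along the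
boundary the solution is aligned with the unstable direction, and an invariant cone argument
(`growth_of_cone`) gives growth that is uniform for nearby maps, including on all branches leaving
the boundary.

Openness follows because near φ₀ only finitely many regions can take values in [-2, 2] or of modulus
at most L. For proper discontinuity, φ and gφ in a compact K force g⁻¹·0 and g⁻¹·∞ into a finite
set, and these two slopes determine g: the group acts faithfully on slopes, since the lantern
relation leaves two generating twists and these play ping-pong.

Traces of a character along simple curves form a Markoff map, by Fricke's identities at one vertex
and transport by the group. The resulting map is continuous and equivariant, and the set of BQ
characters is the preimage of the set of BQ maps. This uses that slopes correspond bijectively to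
simple curves: the stabiliser of a slope is generated by a twist fixing the curve, and the slope can
be read off the translation of the plane induced by the curve. -/

/-- The slope of a lattice vector. -/
def reg (w : ℤ × ℤ) : Region :=
  if (w.2 : ℚ) = 0 then OnePoint.infty else ((w.1 / w.2 : ℚ) : Region)

/-- Two lattice vectors form a basis of the lattice. -/
def IsBasis (u v : ℤ × ℤ) : Prop := |u.1 * v.2 - v.1 * u.2| = 1

/-- The regions beyond the head of the edge `u ∩ v` directed towards `u + v`. -/
inductive Cone : ℤ × ℤ → ℤ × ℤ → ℤ × ℤ → Prop
  | head (u v) : Cone u v (u + v)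
  | left {u v w} : Cone u (u + v) w → Cone u v w
  | right {u v w} : Cone (u + v) v w → Cone u v w

theorem IsBasis.det {u v : ℤ × ℤ} (h : IsBasis u v) :
    u.1 * v.2 - v.1 * u.2 = 1 ∨ u.1 * v.2 - v.1 * u.2 = -1 := (abs_eq one_pos.le).1 h

theorem IsBasis.of_det {u v : ℤ × ℤ}
    (h : u.1 * v.2 - v.1 * u.2 = 1 ∨ u.1 * v.2 - v.1 * u.2 = -1) : IsBasis u v :=
  (abs_eq one_pos.le).2 h

theorem IsBasis.symm {u v : ℤ × ℤ} (h : IsBasis u v) : IsBasis v u := by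
  rcases h.det with h | h
  · exact .of_det (.inr (by linarith))
  · exact .of_det (.inl (by linarith))

theorem IsBasis.left {u v : ℤ × ℤ} (h : IsBasis u v) : IsBasis u (u + v) := by
  rw [IsBasis] at *
  rw [← h]; congr 1; simp only [Prod.fst_add, Prod.snd_add]; ring

theorem IsBasis.right {u v : ℤ × ℤ} (h : IsBasis u v) : IsBasis (u + v) v := by
  rw [IsBasis] at *
  rw [← h]; congr 1; simp only [Prod.fst_add, Prod.snd_add]; ring

theorem IsBasis.neg_right {u v : ℤ × ℤ} (h : IsBasis u v) : IsBasis u (-v) := by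
  rw [IsBasis] at *
  rw [← h, ← abs_neg]; congr 1; simp only [Prod.fst_neg, Prod.snd_neg]; ring

theorem IsBasis.sub {u v : ℤ × ℤ} (h : IsBasis u v) : IsBasis u (u - v) := by
  rw [sub_eq_add_neg]; exact h.neg_right.left

theorem IsBasis.add_nsmul {u v : ℤ × ℤ} (h : IsBasis u v) (n : ℕ) : IsBasis u (v + n • u) := by
  rw [IsBasis] at *
  rw [← h]; congr 1
  simp only [Prod.fst_add, Prod.snd_add, Prod.smul_fst, Prod.smul_snd, smul_eq_mul, ← natCast_zsmul]; ring

theorem IsBasis.coprime {u v : ℤ × ℤ} (h : IsBasis u v) : IsCoprime u.1 u.2 := by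
  rcases h.det with h | h
  · exact ⟨v.2, -v.1, by linarith⟩
  · exact ⟨-v.2, v.1, by linarith⟩

theorem Cone.swap {u v w : ℤ × ℤ} (h : Cone u v w) : Cone v u w := by
  induction h with
  | head u v => rw [add_comm]; exact .head v u
  | left _ ih => rw [add_comm] at ih; exact .right ih
  | right _ ih => rw [add_comm] at ih; exact .left ih

theorem Cone.coprime {u v w : ℤ × ℤ} (h : Cone u v w) : IsBasis u v → IsCoprime w.1 w.2 := by
  induction h with
  | head u v => exact fun h => h.right.coprime
  | left _ ih => exact fun h => ih h.left
  | right _ ih => exact fun h => ih h.right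

/-- Subtractive Euclidean algorithm: if a < b then au + bv = a(u + v) + (b − a)v lies beyond the
edge (u + v, v), and symmetrically; if a = b, coprimality leaves only the head. -/
theorem Cone.of_coprime (u v : ℤ × ℤ) (a b : ℕ) (ha : 0 < a) (hb : 0 < b) (hab : a.Coprime b) :
    Cone u v (a • u + b • v) := by
  induction hn : a + b using Nat.strong_induction_on generalizing u v a b with
  | _ n ih =>
    subst hn
    rcases lt_trichotomy a b with h | rfl | h
    · obtain ⟨k, rfl⟩ := Nat.exists_eq_add_of_lt h
      have := ih (a + (k + 1)) (by omega) (u + v) v a (k + 1) ha (by omega)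
        (by rwa [add_assoc, Nat.coprime_self_add_right] at hab) rfl
      convert Cone.right this using 1
      module
    · obtain rfl : a = 1 := by simpa using hab
      simpa using Cone.head u v
    · obtain ⟨k, rfl⟩ := Nat.exists_eq_add_of_lt h
      have := ih ((k + 1) + b) (by omega) u (u + v) (k + 1) b (by omega) hb
        (by rwa [add_assoc, Nat.coprime_self_add_left] at hab) rfl
      convert Cone.left this using 1
      module

theorem num_den_reg {w : ℤ × ℤ} (h : IsCoprime w.1 w.2) :
    ∃ e : ℤ, (e = 1 ∨ e = -1) ∧ num (reg w) = e * w.1 ∧ den (reg w) = e * w.2 :=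
  num_den_of_coprime w.1 w.2 h

theorem reg_num_den (X : Region) : reg (num X, den X) = X := by
  induction X using OnePoint.rec with
  | infty => exact if_pos (by exact_mod_cast (rfl : den OnePoint.infty = 0))
  | coe q =>
    have h : num (q : Region) = q.num ∧ den (q : Region) = q.den := ⟨rfl, rfl⟩
    simp only [reg, h.1, h.2]
    rw [if_neg (by exact_mod_cast q.den_nz)]
    simp [Rat.num_div_den]

theorem reg_neg (w : ℤ × ℤ) : reg (-w) = reg w := by
  simp [reg, neg_div_neg_eq]

theorem eq_or_eq_neg_of_reg_eq {u w : ℤ × ℤ} (hu : IsCoprime u.1 u.2) (hw : IsCoprime w.1 w.2)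
    (h : reg u = reg w) : u = w ∨ u = -w := by
  obtain ⟨e, he, h1, h2⟩ := num_den_reg hu
  obtain ⟨e', he', h1', h2'⟩ := num_den_reg hw
  rw [h] at h1 h2
  have e1 := h1.symm.trans h1'
  have e2 := h2.symm.trans h2'
  rcases he with rfl | rfl <;> rcases he' with rfl | rfl
  · left; ext <;> linarith
  · right; ext <;> simp <;> linarith
  · right; ext <;> simp <;> linarith
  · left; ext <;> linarith

theorem adj_symm {X Y : Region} (h : Adj X Y) : Adj Y X := by
  rw [Adj] at *; rw [← h, ← abs_neg]; congr 1; ring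

theorem IsBasis.adj {u v : ℤ × ℤ} (h : IsBasis u v) : Adj (reg u) (reg v) := by
  obtain ⟨e, he, h1, h2⟩ := num_den_reg h.coprime
  obtain ⟨e', he', h1', h2'⟩ := num_den_reg h.symm.coprime
  rw [Adj, h1, h2, h1', h2', show e * u.1 * (e' * v.2) - e' * v.1 * (e * u.2)
    = e * e' * (u.1 * v.2 - v.1 * u.2) by ring, abs_mul, show |u.1 * v.2 - v.1 * u.2| = 1 from h]
  rcases he with rfl | rfl <;> rcases he' with rfl | rfl <;> simp

theorem isBasis_of_adj {X Y : Region} (h : Adj X Y) :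
    IsBasis (num X, den X) (num Y, den Y) := h

theorem color_reg {w : ℤ × ℤ} (h : IsCoprime w.1 w.2) :
    color (reg w) = if Even w.1 then 0 else if Even w.2 then 1 else 2 := by
  obtain ⟨e, he, h1, h2⟩ := num_den_reg h
  rw [color, h1, h2]
  rcases he with rfl | rfl <;> simp

/-- The colour depends only on the vector mod 2. This is why the linear coefficients alternate with
period two along the boundary of a region. -/
theorem color_reg_add_two {u v : ℤ × ℤ} (h : IsBasis u v) :
    color (reg (v + u + u)) = color (reg v) := by
  have h2 := (h.add_nsmul 2).symm.coprime
  rw [show v + 2 • u = v + u + u by module] at h2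
  rw [color_reg h2, color_reg h.symm.coprime]
  have e : ∀ a b : ℤ, Even (a + b + b) ↔ Even a := fun a b => by
    have : Even (b + b) := ⟨b, rfl⟩
    rw [add_assoc, Int.even_add]
    tauto
  simp only [Prod.fst_add, Prod.snd_add, e]

theorem color_ne_of_adj {X Y : Region} (h : Adj X Y) : color X ≠ color Y := by
  have hd := (isBasis_of_adj h).det
  simp only at hd
  have hodd : ¬ Even (num X * den Y - num Y * den X) := by
    rcases hd with h | h <;> rw [h] <;> decide
  rw [Int.even_sub, Int.even_mul, Int.even_mul] at hodd
  rw [color, color]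
  split_ifs <;> simp <;> tauto

/-- The regions adjacent to two adjacent regions. -/
theorem eq_add_or_eq_sub_of_isBasis {u v w : ℤ × ℤ} (h : IsBasis u v) (hu : IsBasis u w)
    (hv : IsBasis v w) : (w = u + v ∨ w = -(u + v)) ∨ (w = u - v ∨ w = -(u - v)) := by
  -- Cramer's rule in the basis (u, v); all three determinants are ±1, so the coordinates of w are
  -- ±1.
  have key : ∀ a b c : ℤ, (a = 1 ∨ a = -1) → u.1 * v.2 - v.1 * u.2 = a →
      u.1 * w.2 - w.1 * u.2 = b → v.1 * w.2 - w.1 * v.2 = c →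
      w.1 = a * (b * v.1 - c * u.1) ∧ w.2 = a * (b * v.2 - c * u.2) := by
    intro a b c ha h1 h2 h3
    have ha : a * a = 1 := by rcases ha with rfl | rfl <;> norm_num
    constructor
    · linear_combination (-w.1) * ha + a * v.1 * h2 - a * u.1 * h3 - a * w.1 * h1
    · linear_combination (-w.2) * ha + a * v.2 * h2 - a * u.2 * h3 - a * w.2 * h1
  obtain ⟨k1, k2⟩ := key _ _ _ h.det rfl rfl rfl
  rcases h.det with h | h <;> rcases hu.det with hu | hu <;> rcases hv.det with hv | hv <;>
    rw [h, hu, hv] at k1 k2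
  all_goals
    first
    | (left; left; ext <;> simp <;> linarith)
    | (left; right; ext <;> simp <;> linarith)
    | (right; left; ext <;> simp <;> linarith)
    | (right; right; ext <;> simp <;> linarith)

theorem reg_ne_of_isBasis {u v : ℤ × ℤ} (h : IsBasis u v) : reg (u + v) ≠ reg (u - v) := by
  intro he
  have h1 := h.left.symm.coprime
  have h2 := h.sub.symm.coprime
  rcases eq_or_eq_neg_of_reg_eq h1 h2 he with h' | h'
  · have : v = 0 := by
      have : (2 : ℤ) • v = 0 := by
        have := sub_eq_zero.2 h'
        rw [← this]; module
      simpa [zsmul_eq_mul, two_smul, Prod.ext_iff] using this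
    subst this; simp [IsBasis] at h
  · have : u = 0 := by
      have : (2 : ℤ) • u = 0 := by
        have := sub_eq_zero.2 h'
        rw [← this]; module
      simpa [zsmul_eq_mul, two_smul, Prod.ext_iff] using this
    subst this; simp [IsBasis] at h

theorem IsBasis.isEdge {u v : ℤ × ℤ} (h : IsBasis u v) :
    IsEdge (reg u) (reg v) (reg (u + v)) (reg (u - v)) := by
  refine ⟨h.adj, reg_ne_of_isBasis h, h.left.adj, h.right.symm.adj, h.sub.adj, ?_⟩
  have := h.symm.sub.adj
  rwa [← reg_neg (v - u), neg_sub] at this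

theorem isEdge_swap {X Y Z W : Region} (h : IsEdge X Y Z W) : IsEdge Y X Z W := by
  obtain ⟨h1, h2, h3, h4, h5, h6⟩ := h
  exact ⟨adj_symm h1, h2, h4, h3, h6, h5⟩

theorem isEdge_swap' {X Y Z W : Region} (h : IsEdge X Y Z W) : IsEdge X Y W Z := by
  obtain ⟨h1, h2, h3, h4, h5, h6⟩ := h
  exact ⟨h1, h2.symm, h5, h6, h3, h4⟩

/-- The two regions adjacent to two adjacent regions. -/
theorem eq_reg_add_or_eq_reg_sub {X Y Z : Region} {u v : ℤ × ℤ} (h : IsBasis u v)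
    (hu : reg u = X) (hv : reg v = Y) (hX : Adj X Z) (hY : Adj Y Z) :
    Z = reg (u + v) ∨ Z = reg (u - v) := by
  have aux : ∀ {w : ℤ × ℤ} {T : Region}, IsCoprime w.1 w.2 → reg w = T → Adj T Z →
      IsBasis w (num Z, den Z) := by
    rintro w T hw rfl hT
    obtain ⟨e, he, h1, h2⟩ := num_den_reg hw
    rw [Adj, h1, h2] at hT
    rw [IsBasis, ← hT]
    rcases he with rfl | rfl
    · simp
    · rw [← abs_neg]; congr 1; ring
  have hz := reg_num_den Z
  rcases eq_add_or_eq_sub_of_isBasis h (aux h.coprime hu hX) (aux h.symm.coprime hv hY) with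
    (e | e) | (e | e) <;> rw [e] at hz
  · exact .inl hz.symm
  · rw [reg_neg] at hz; exact .inl hz.symm
  · exact .inr hz.symm
  · rw [reg_neg] at hz; exact .inr hz.symm

theorem exists_isEdge {X Y Z : Region} (h : Adj X Y) (hX : Adj X Z) (hY : Adj Y Z) :
    ∃ W, IsEdge X Y Z W := by
  have hb := isBasis_of_adj h
  have he := hb.isEdge
  rw [reg_num_den, reg_num_den] at he
  rcases eq_reg_add_or_eq_reg_sub hb (reg_num_den X) (reg_num_den Y) hX hY with rfl | rfl
  · exact ⟨_, he⟩
  · exact ⟨_, isEdge_swap' he⟩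

/-! ## The relations of a Markoff map in terms of lattice vectors -/

variable {μ : Param}

theorem MarkoffMap.vertex_symm (φ : MarkoffMap μ) {X Y Z : Region} (h : Adj X Y) (hX : Adj X Z)
    (hY : Adj Y Z) : φ X ^ 2 + φ Y ^ 2 + φ Z ^ 2 + φ X * φ Y * φ Z =
      μ.coef (color X) * φ X + μ.coef (color Y) * φ Y + μ.coef (color Z) * φ Z + μ.s := by
  have c1 := color_ne_of_adj h
  have c2 := color_ne_of_adj hX
  have c3 := color_ne_of_adj hY
  have hX' := adj_symm hX
  have hY' := adj_symm hY
  have h' := adj_symm h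
  have key : ∀ {X Y Z}, IsVertex X Y Z → φ X ^ 2 + φ Y ^ 2 + φ Z ^ 2 + φ X * φ Y * φ Z =
      μ.coef 0 * φ X + μ.coef 1 * φ Y + μ.coef 2 * φ Z + μ.s :=
    fun {X Y Z} h => φ.vertex X Y Z h
  -- The three colours are distinct; each of the six orders is a permutation of the vertex relation.
  rcases eq_or_ne (color X) 0 with x | x <;> rcases eq_or_ne (color Y) 0 with y | y <;>
  rcases eq_or_ne (color X) 1 with x' | x' <;> rcases eq_or_ne (color Y) 1 with y' | y'
  all_goals first
    | omega
    | (have z : color Z = 2 := by omega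
       first
       | (rw [x, y', z]; linear_combination key ⟨x, y', z, h, hY, hX⟩)
       | (rw [x', y, z]; linear_combination key ⟨y, x', z, h', hX, hY⟩))
    | (have z : color Z = 1 := by omega
       first
       | (have y2 : color Y = 2 := by omega
          rw [x, y2, z]; linear_combination key ⟨x, z, y2, hX, hY', h⟩)
       | (have x2 : color X = 2 := by omega
          rw [x2, y, z]; linear_combination key ⟨y, z, x2, hY, hX', h'⟩))
    | (have z : color Z = 0 := by omega
       first
       | (have y2 : color Y = 2 := by omega
          rw [x', y2, z]; linear_combination key ⟨z, x', y2, hX', h, hY'⟩)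
       | (have x2 : color X = 2 := by omega
          rw [x2, y', z]; linear_combination key ⟨z, y', x2, hY', h', hX'⟩))

/-- The value of a Markoff map at the slope of a lattice vector. -/
def MarkoffMap.val (φ : MarkoffMap μ) (w : ℤ × ℤ) : ℂ := φ (reg w)

theorem MarkoffMap.val_neg (φ : MarkoffMap μ) (w : ℤ × ℤ) : φ.val (-w) = φ.val w := by
  rw [val, reg_neg, val]

theorem MarkoffMap.val_sub_comm (φ : MarkoffMap μ) (u v : ℤ × ℤ) :
    φ.val (u - v) = φ.val (v - u) := by
  rw [← φ.val_neg, neg_sub]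

theorem MarkoffMap.val_add (φ : MarkoffMap μ) {u v : ℤ × ℤ} (h : IsBasis u v) :
    φ.val (u + v) + φ.val (u - v) = μ.coef (color (reg (u + v))) - φ.val u * φ.val v :=
  φ.edge _ _ _ _ h.isEdge

theorem norm_coef_le (μ : Param) (i : Fin 3) : ‖μ.coef i‖ ≤ 2 * alpha μ := by
  have h : 2 * alpha μ = max ‖μ.p‖ (max ‖μ.q‖ ‖μ.r‖) := by rw [alpha]; ring
  rw [h]
  fin_cases i <;> simp [Param.coef]

theorem alpha_nonneg (μ : Param) : 0 ≤ alpha μ := by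
  have := (norm_nonneg _).trans (norm_coef_le μ 0)
  linarith

/-- The edge relation makes the value at u + v a polynomial in those at u, v and u − v. The third
value is carried along because the child edges have u − (u + v) = −v and (u + v) − v = u behind
them. -/
theorem continuous_val_of_cone {u v w : ℤ × ℤ} (h : Cone u v w) : IsBasis u v →
    (Continuous fun φ : MarkoffMap μ => φ.val u) → (Continuous fun φ : MarkoffMap μ => φ.val v) →
    (Continuous fun φ : MarkoffMap μ => φ.val (u - v)) →
    Continuous fun φ : MarkoffMap μ => φ.val w := by
  have key : ∀ {u v : ℤ × ℤ}, IsBasis u v →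
      (Continuous fun φ : MarkoffMap μ => φ.val u) →
      (Continuous fun φ : MarkoffMap μ => φ.val v) →
      (Continuous fun φ : MarkoffMap μ => φ.val (u - v)) →
      Continuous fun φ : MarkoffMap μ => φ.val (u + v) := by
    intro u v h hu hv huv
    have e : (fun φ : MarkoffMap μ => φ.val (u + v)) = fun φ =>
        μ.coef (color (reg (u + v))) - φ.val u * φ.val v - φ.val (u - v) :=
      funext fun φ => eq_sub_of_add_eq (φ.val_add h)
    rw [e]
    exact (continuous_const.sub (hu.mul hv)).sub huv
  induction h with
  | head u v => exact key
  | @left u v w _ ih =>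
    intro h hu hv huv
    refine ih h.left hu (key h hu hv huv) ?_
    simpa [MarkoffMap.val_neg] using hv
  | @right u v w _ ih =>
    intro h hu hv huv
    refine ih h.right (key h hu hv huv) hv ?_
    simpa using hu

/-! ### Covering all slopes by two cones; continuity of evaluation. -/

theorem reg_zero_one : reg (0, 1) = ((0 : ℚ) : Region) := by simp [reg]
theorem reg_one_zero : reg (1, 0) = OnePoint.infty := by simp [reg]
theorem reg_one_neg_one : reg (1, -1) = ((-1 : ℚ) : Region) := by simp [reg]

/-- Every slope is `∞`, `0`, positive, or negative. -/
theorem region_cases (X : Region) : X = reg (1, 0) ∨ X = reg (0, 1) ∨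
    (∃ w, Cone (1, 0) (0, 1) w ∧ X = reg w) ∨ ∃ w, Cone (0, 1) (-1, 0) w ∧ X = reg w := by
  induction X using OnePoint.rec with
  | infty => left; rw [reg_one_zero]
  | coe q =>
    right
    rcases lt_trichotomy q 0 with hq | rfl | hq
    · right; right
      refine ⟨_, .of_coprime (0, 1) (-1, 0) q.den q.num.natAbs q.pos
        (by simpa using hq.ne) q.reduced.symm, ?_⟩
      rw [← reg_num_den (q : Region)]
      congr 1
      have h1 : num (q : Region) = q.num := rfl
      have h2 : den (q : Region) = q.den := rfl
      have := Rat.num_neg.2 hq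
      rw [h1, h2]
      ext <;> simp
      rw [abs_of_neg this]; simp
    · left; rw [reg_zero_one]
    · right; left
      refine ⟨_, .of_coprime (1, 0) (0, 1) q.num.natAbs q.den
        (by simpa using hq.ne') q.pos q.reduced, ?_⟩
      rw [← reg_num_den (q : Region)]
      congr 1
      have h1 : num (q : Region) = q.num := rfl
      have h2 : den (q : Region) = q.den := rfl
      have := Rat.num_pos.2 hq
      rw [h1, h2]
      ext <;> simp
      rw [abs_of_pos this]

theorem isBasis_std : IsBasis (1, 0) (0, 1) := by simp [IsBasis]
theorem isBasis_rot : IsBasis (0, 1) (-1, 0) := by simp [IsBasis]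

theorem continuous_apply (X : Region) : Continuous fun φ : MarkoffMap μ => φ X := by
  have h : Continuous fun φ : MarkoffMap μ =>
      (φ ((0 : ℚ) : Region), φ OnePoint.infty, φ ((-1 : ℚ) : Region)) := continuous_induced_dom
  have h0 : Continuous fun φ : MarkoffMap μ => φ.val (0, 1) := by
    simpa only [MarkoffMap.val, reg_zero_one] using h.fst
  have h1 : Continuous fun φ : MarkoffMap μ => φ.val (1, 0) := by
    simpa only [MarkoffMap.val, reg_one_zero] using h.snd.fst
  have h2 : Continuous fun φ : MarkoffMap μ => φ.val ((1, 0) - (0, 1)) := by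
    simpa [MarkoffMap.val, reg_one_neg_one] using h.snd.snd
  rcases region_cases X with rfl | rfl | ⟨w, hw, rfl⟩ | ⟨w, hw, rfl⟩
  · exact h1
  · exact h0
  · exact continuous_val_of_cone hw isBasis_std h1 h0 h2
  · refine continuous_val_of_cone hw isBasis_rot h0 ?_ ?_
    · rw [show ((-1, 0) : ℤ × ℤ) = -(1, 0) by simp]
      simpa only [MarkoffMap.val_neg] using h1
    · have := continuous_val_of_cone (.head _ _) isBasis_std h1 h0 h2
      simpa [add_comm] using this

theorem continuous_val (w : ℤ × ℤ) : Continuous fun φ : MarkoffMap μ => φ.val w :=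
  continuous_apply _

end

/-! ## A bound for the smallest modulus around a sink -/

/-- With c the largest modulus, `h2` gives abc ≤ 7c² and `h1` gives c² ≤ 3(a² + b²). Together a²b² ≤
147(a² + b²), which fails when a² and b² are at least 441 = 21². -/
theorem sink_inequality {A S a b c : ℝ} (hA : 0 ≤ A) (hS : 0 ≤ S) (ha : 21 + A + S < a)
    (hb : 21 + A + S < b) (hac : a ≤ c) (hbc : b ≤ c)
    (h1 : c ^ 2 ≤ a ^ 2 + b ^ 2 + A * (a + b) + S)
    (h2 : a * b * c ≤ a ^ 2 + b ^ 2 + c ^ 2 + A * (a + b + c) + S) : False := by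
  have hc : 21 + A + S < c := by linarith
  have h3 : a * b ≤ 7 * c := by
    have : a * b * c ≤ 7 * c * c := by nlinarith
    exact le_of_mul_le_mul_right this (by linarith)
  have h4 : c ^ 2 ≤ 3 * (a ^ 2 + b ^ 2) := by nlinarith
  have h5 : (a * b) ^ 2 ≤ 49 * c ^ 2 := by
    have : 0 ≤ a * b := mul_nonneg (by linarith) (by linarith)
    nlinarith
  have ha2 : 441 ≤ a ^ 2 := by nlinarith
  have hb2 : 441 ≤ b ^ 2 := by nlinarith
  have e : (a * b) ^ 2 = a ^ 2 * b ^ 2 := by ring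
  nlinarith

/-- Here z and z' are the two roots of the vertex equation in its third variable, so their product
is x² + y² − px − qy − s, and |z|² ≤ |zz'|. -/
theorem norm_sq_le_of_vieta {A S : ℝ} {p q r s x y z z' : ℂ} (hp : ‖p‖ ≤ A) (hq : ‖q‖ ≤ A)
    (hs : ‖s‖ ≤ S) (hv : x ^ 2 + y ^ 2 + z ^ 2 + x * y * z = p * x + q * y + r * z + s)
    (he : z + z' = r - x * y) (hz : ‖z‖ ≤ ‖z'‖) :
    ‖z‖ ^ 2 ≤ ‖x‖ ^ 2 + ‖y‖ ^ 2 + A * (‖x‖ + ‖y‖) + S := by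
  have h : z * z' = x ^ 2 + y ^ 2 - p * x - q * y - s := by linear_combination z * he - hv
  calc ‖z‖ ^ 2 ≤ ‖z‖ * ‖z'‖ := by nlinarith [norm_nonneg z]
    _ = ‖x ^ 2 + y ^ 2 - p * x - q * y - s‖ := by rw [← norm_mul, h]
    _ ≤ ‖x ^ 2‖ + ‖y ^ 2‖ + ‖p * x‖ + ‖q * y‖ + ‖s‖ := by
      refine (norm_sub_le _ _).trans (add_le_add ?_ le_rfl)
      refine (norm_sub_le _ _).trans (add_le_add ?_ le_rfl)
      refine (norm_sub_le _ _).trans (add_le_add ?_ le_rfl)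
      exact norm_add_le _ _
    _ ≤ _ := by
      rw [norm_pow, norm_pow, norm_mul, norm_mul]
      nlinarith [norm_nonneg x, norm_nonneg y]

theorem exists_isSinkBound (μ : Param) : ∃ m, IsSinkBound μ m := by
  have hA := alpha_nonneg μ
  have hS := norm_nonneg μ.s
  refine ⟨21 + 2 * alpha μ + ‖μ.s‖, by linarith, ?_⟩
  rintro φ X Y Z ⟨⟨cX, cY, cZ, hXY, hYZ, hXZ⟩, h1, h2, h3⟩
  obtain ⟨X', eX⟩ := exists_isEdge hYZ (adj_symm hXY) (adj_symm hXZ)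
  obtain ⟨Y', eY⟩ := exists_isEdge hXZ hXY (adj_symm hYZ)
  obtain ⟨Z', eZ⟩ := exists_isEdge hXY hXZ hYZ
  have hv := φ.vertex X Y Z ⟨cX, cY, cZ, hXY, hYZ, hXZ⟩
  rw [IsMarkoffTriple] at hv
  have hX : φ X + φ X' = μ.coef (color X) - φ Y * φ Z := φ.edge _ _ _ _ eX
  have hY : φ Y + φ Y' = μ.coef (color Y) - φ X * φ Z := φ.edge _ _ _ _ eY
  have hZ : φ Z + φ Z' = μ.coef (color Z) - φ X * φ Y := φ.edge _ _ _ _ eZ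
  rw [cX] at hX
  replace hX : φ X + φ X' = μ.p - φ Y * φ Z := hX
  rw [cY] at hY
  replace hY : φ Y + φ Y' = μ.q - φ X * φ Z := hY
  rw [cZ] at hZ
  replace hZ : φ Z + φ Z' = μ.r - φ X * φ Y := hZ
  have hp : ‖μ.p‖ ≤ 2 * alpha μ := norm_coef_le μ 0
  have hq : ‖μ.q‖ ≤ 2 * alpha μ := norm_coef_le μ 1
  have hr : ‖μ.r‖ ≤ 2 * alpha μ := norm_coef_le μ 2
  have iX := norm_sq_le_of_vieta (s := μ.s) (x := φ Y) (y := φ Z) hq hr le_rfl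
    (by linear_combination hv) hX (h1 X' eX)
  have iY := norm_sq_le_of_vieta (s := μ.s) (x := φ X) (y := φ Z) hp hr le_rfl
    (by linear_combination hv) hY (h2 Y' eY)
  have iZ := norm_sq_le_of_vieta (s := μ.s) (x := φ X) (y := φ Y) hp hq le_rfl
    (by linear_combination hv) hZ (h3 Z' eZ)
  have hprod : ‖φ X‖ * ‖φ Y‖ * ‖φ Z‖ ≤ ‖φ X‖ ^ 2 + ‖φ Y‖ ^ 2 + ‖φ Z‖ ^ 2
      + 2 * alpha μ * (‖φ X‖ + ‖φ Y‖ + ‖φ Z‖) + ‖μ.s‖ := by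
    have h : φ X * φ Y * φ Z = μ.p * φ X + μ.q * φ Y + μ.r * φ Z + μ.s
        - φ X ^ 2 - φ Y ^ 2 - φ Z ^ 2 := by linear_combination hv
    rw [← norm_mul, ← norm_mul, h]
    have : ‖μ.p * φ X + μ.q * φ Y + μ.r * φ Z + μ.s - φ X ^ 2 - φ Y ^ 2 - φ Z ^ 2‖ ≤
        ‖μ.p * φ X‖ + ‖μ.q * φ Y‖ + ‖μ.r * φ Z‖ + ‖μ.s‖ + ‖φ X ^ 2‖ + ‖φ Y ^ 2‖ + ‖φ Z ^ 2‖ := by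
      refine (norm_sub_le _ _).trans (add_le_add ?_ le_rfl)
      refine (norm_sub_le _ _).trans (add_le_add ?_ le_rfl)
      refine (norm_sub_le _ _).trans (add_le_add ?_ le_rfl)
      refine (norm_add_le _ _).trans (add_le_add ?_ le_rfl)
      refine (norm_add_le _ _).trans (add_le_add ?_ le_rfl)
      exact norm_add_le _ _
    simp only [norm_mul, norm_pow] at this
    nlinarith [norm_nonneg (φ X), norm_nonneg (φ Y), norm_nonneg (φ Z)]
  by_contra! hlt
  rw [lt_min_iff, lt_min_iff] at hlt
  obtain ⟨l1, l2, l3⟩ := hlt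
  have hA' : 0 ≤ 2 * alpha μ := by linarith
  -- Only the arrow across from the region of largest modulus is needed.
  rcases le_total ‖φ X‖ ‖φ Y‖ with o1 | o1 <;> rcases le_total ‖φ Y‖ ‖φ Z‖ with o2 | o2
  · exact sink_inequality hA' hS l1 l2 (o1.trans o2) o2 iZ hprod
  · exact sink_inequality hA' hS l1 l3 o1 o2 iY (by linarith)
  · rcases le_total ‖φ X‖ ‖φ Z‖ with o3 | o3
    · exact sink_inequality hA' hS l1 l2 o3 o2 iZ hprod
    · exact sink_inequality hA' hS l2 l3 o1 o3 iX (by linarith)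
  · exact sink_inequality hA' hS l2 l3 o1 (o2.trans o1) iX (by linarith)

/-! ## Linear recurrences with a hyperbolic characteristic equation -/

/-- The roots of t² + xt + 1 have product 1. Both have modulus 1 only if they are conjugate, and
then x = −2 Re l lies in [-2, 2]. -/
theorem exists_eigenvalue {x : ℂ} (hx : x ∉ realSegment) :
    ∃ l : ℂ, 1 < ‖l‖ ∧ x = -(l + l⁻¹) := by
  obtain ⟨l, hl⟩ : ∃ l : ℂ, l ^ 2 + x * l + 1 = 0 := by
    obtain ⟨d, hd⟩ := IsAlgClosed.exists_pow_nat_eq (x ^ 2 - 4) two_pos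
    exact ⟨(d - x) / 2, by linear_combination hd / 4⟩
  have h0 : l ≠ 0 := by rintro rfl; simp at hl
  have hxl : x = -(l + l⁻¹) := by field_simp; linear_combination hl
  rcases lt_trichotomy ‖l‖ 1 with h | h | h
  · refine ⟨l⁻¹, ?_, by rw [inv_inv, hxl]; ring⟩
    rw [norm_inv]
    exact (one_lt_inv₀ (norm_pos_iff.2 h0)).2 h
  · exfalso
    apply hx
    have hinv : l⁻¹ = (starRingEnd ℂ) l := by
      rw [Complex.inv_def, Complex.normSq_eq_norm_sq, h]; simp
    have hre := Complex.abs_re_le_norm l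
    rw [h, abs_le] at hre
    refine ⟨-(2 * l.re), ⟨by linarith, by linarith⟩, ?_⟩
    rw [hxl, hinv, Complex.add_conj]
    push_cast; ring
  · exact ⟨l, h, hxl⟩

/-- The unstable component y(n+1) − l⁻¹y(n) is multiplied by l at each step, so boundedness kills it
and leaves y(n) = l⁻ⁿy(0). -/
theorem tendsto_zero_of_bounded_recurrence {l x : ℂ} (hl : 1 < ‖l‖) (hx : x = -(l + l⁻¹))
    {y : ℕ → ℂ} (hy : ∀ n, y (n + 2) + x * y (n + 1) + y n = 0) {C : ℝ} (hC : ∀ n, ‖y n‖ ≤ C) :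
    Filter.Tendsto y Filter.atTop (nhds 0) := by
  have h0 : l ≠ 0 := norm_pos_iff.1 (one_pos.trans hl)
  have hu : ∀ n, y (n + 1) - l⁻¹ * y n = l ^ n * (y 1 - l⁻¹ * y 0) := by
    intro n
    induction n with
    | zero => simp
    | succ n ih =>
      have e : y (n + 1 + 1) - l⁻¹ * y (n + 1) = l * (y (n + 1) - l⁻¹ * y n) := by
        have := hy n
        rw [hx] at this
        field_simp at this ⊢
        linear_combination this
      rw [e, ih]; ring
  have hz : y 1 - l⁻¹ * y 0 = 0 := by
    by_contra hne
    have hpos := norm_pos_iff.2 hne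
    obtain ⟨n, hn⟩ := pow_unbounded_of_one_lt (2 * C / ‖y 1 - l⁻¹ * y 0‖) hl
    rw [div_lt_iff₀ hpos, ← norm_pow, ← norm_mul, ← hu] at hn
    have h1 := norm_sub_le (y (n + 1)) (l⁻¹ * y n)
    have h2 : ‖l⁻¹ * y n‖ ≤ ‖y n‖ := by
      rw [norm_mul, norm_inv]
      exact mul_le_of_le_one_left (norm_nonneg _) (inv_le_one_of_one_le₀ hl.le)
    linarith [hC n, hC (n + 1)]
  have hg : ∀ n, y n = (l⁻¹) ^ n * y 0 := by
    intro n
    induction n with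
    | zero => simp
    | succ n ih =>
      have := hu n
      rw [hz, mul_zero, sub_eq_zero] at this
      rw [this, ih]; ring
  rw [funext hg]
  have : ‖l⁻¹‖ < 1 := by rw [norm_inv]; exact inv_lt_one_of_one_lt₀ hl
  simpa using (tendsto_pow_atTop_nhds_zero_of_norm_lt_one this).mul_const (y 0)

/-- The stable component y(n+1) − l·y(n) is contracted by l⁻¹ at each step, up to an error of size
A. So a large y(n) is nearly aligned with the unstable direction. -/
theorem exists_bound_of_recurrence {l x : ℂ} (hl : 1 < ‖l‖) (hx : x = -(l + l⁻¹)) {y : ℕ → ℂ}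
    {A : ℝ} (hy : ∀ n, ‖y (n + 2) + x * y (n + 1) + y n‖ ≤ A) :
    ∃ V, ∀ n, ‖y (n + 1) - l * y n‖ ≤ V := by
  have h0 : l ≠ 0 := norm_pos_iff.1 (one_pos.trans hl)
  have hlt : ‖l‖⁻¹ < 1 := inv_lt_one_of_one_lt₀ hl
  have hpos : 0 < 1 - ‖l‖⁻¹ := by linarith
  -- A / (1 − |l|⁻¹) is the fixed point of V ↦ A + |l|⁻¹V.
  refine ⟨max ‖y 1 - l * y 0‖ (A / (1 - ‖l‖⁻¹)), fun n => ?_⟩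
  induction n with
  | zero => exact le_max_left _ _
  | succ n ih =>
    set V := max ‖y 1 - l * y 0‖ (A / (1 - ‖l‖⁻¹))
    have hV : A ≤ V * (1 - ‖l‖⁻¹) := (div_le_iff₀ hpos).1 (le_max_right _ _)
    have e : y (n + 1 + 1) - l * y (n + 1)
        = (y (n + 2) + x * y (n + 1) + y n) + l⁻¹ * (y (n + 1) - l * y n) := by
      rw [hx]; field_simp; ring
    rw [e]
    refine (norm_add_le _ _).trans ?_
    rw [norm_mul, norm_inv]
    have := mul_le_mul_of_nonneg_left ih (inv_nonneg.2 (norm_nonneg l))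
    linarith [hy n]

/-- Uniform exponential growth of the solutions of a perturbed hyperbolic recurrence that start
in a cone around the unstable direction. -/
theorem growth_of_cone {l : ℂ} (hl : 1 < ‖l‖) (A : ℝ) :
    ∃ d > 0, ∃ B₀ > 0, ∀ B ≥ B₀, ∀ (x : ℂ) (y : ℕ → ℂ), ‖x + (l + l⁻¹)‖ ≤ d →
      (∀ n, ‖y (n + 2) + x * y (n + 1) + y n‖ ≤ A) → B ≤ ‖y 0‖ →
      ‖y 1 - l * y 0‖ ≤ (‖l‖ - 1) / 2 * ‖y 0‖ →
      ∀ n, B * ((‖l‖ + 1) / 2) ^ n ≤ ‖y n‖ ∧ ‖y n‖ ≤ ‖y (n + 1)‖ := by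
  have h0 : l ≠ 0 := norm_pos_iff.1 (one_pos.trans hl)
  have hlt : ‖l‖⁻¹ < 1 := inv_lt_one_of_one_lt₀ hl
  set e := (‖l‖ - 1) / 2 with he
  set k := (‖l‖ + 1) / 2 with hk
  have hepos : 0 < e := by rw [he]; linarith
  have hk1 : 1 < k := by rw [hk]; linarith
  -- Chosen so that 2d + |l|⁻¹e = e: one d absorbs the perturbation of x, the other the
  -- inhomogeneity A, and the cone of aperture e is preserved.
  set d := e * (1 - ‖l‖⁻¹) / 2 with hd
  have hdpos : 0 < d := by rw [hd]; exact half_pos (mul_pos hepos (by linarith))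
  refine ⟨d, hdpos, max 1 (A / d), by positivity, ?_⟩
  intro B hB x y hx hy hB0 hv0
  have hB1 : 1 ≤ B := (le_max_left _ _).trans hB
  have hAB : A ≤ d * B := by
    rw [← div_le_iff₀' hdpos]; exact (le_max_right _ _).trans hB
  have key : ∀ {a b : ℂ}, ‖b - l * a‖ ≤ e * ‖a‖ → k * ‖a‖ ≤ ‖b‖ := by
    intro a b h
    have h1 : ‖l * a‖ ≤ ‖b‖ + ‖b - l * a‖ := by
      have := norm_sub_le b (b - l * a)
      rwa [sub_sub_cancel] at this
    rw [norm_mul] at h1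
    have : k = ‖l‖ - e := by rw [hk, he]; ring
    rw [this, sub_mul]; linarith
  have main : ∀ n, B * k ^ n ≤ ‖y n‖ ∧ ‖y (n + 1) - l * y n‖ ≤ e * ‖y n‖ := by
    intro n
    induction n with
    | zero => simpa using ⟨hB0, hv0⟩
    | succ n ih =>
      obtain ⟨h1, h2⟩ := ih
      have h3 := key h2
      have hge : ‖y n‖ ≤ ‖y (n + 1)‖ := by nlinarith [norm_nonneg (y n)]
      have h4 : B * k ^ (n + 1) ≤ ‖y (n + 1)‖ := by
        rw [pow_succ]; nlinarith
      refine ⟨h4, ?_⟩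
      have hBy : B ≤ ‖y (n + 1)‖ := by
        have : 1 ≤ k ^ (n + 1) := one_le_pow₀ hk1.le
        nlinarith
      have e1 : y (n + 1 + 1) - l * y (n + 1) = (y (n + 2) + x * y (n + 1) + y n)
          - (x + (l + l⁻¹)) * y (n + 1) + l⁻¹ * (y (n + 1) - l * y n) := by
        field_simp; ring
      rw [e1]
      refine (norm_add_le _ _).trans ((add_le_add (norm_sub_le _ _) le_rfl).trans ?_)
      rw [norm_mul, norm_mul, norm_inv]
      have i1 : ‖x + (l + l⁻¹)‖ * ‖y (n + 1)‖ ≤ d * ‖y (n + 1)‖ :=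
        mul_le_mul_of_nonneg_right hx (norm_nonneg _)
      have i2 : ‖l‖⁻¹ * ‖y (n + 1) - l * y n‖ ≤ ‖l‖⁻¹ * (e * ‖y (n + 1)‖) :=
        mul_le_mul_of_nonneg_left (h2.trans (mul_le_mul_of_nonneg_left hge hepos.le))
          (inv_nonneg.2 (norm_nonneg l))
      have i3 : A ≤ d * ‖y (n + 1)‖ := hAB.trans (mul_le_mul_of_nonneg_left hBy hdpos.le)
      have i4 : d * ‖y (n + 1)‖ + d * ‖y (n + 1)‖ + ‖l‖⁻¹ * (e * ‖y (n + 1)‖)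
          = e * ‖y (n + 1)‖ := by rw [hd]; ring
      linarith [hy n]
  intro n
  obtain ⟨h1, h2⟩ := main n
  exact ⟨h1, by nlinarith [norm_nonneg (y n), key h2]⟩

section

/-! ## Values around a region -/

variable {μ : Param}

theorem finite_setOf_conicDet_eq_zero (p q r s : ℂ) : {x | conicDet p q r s x = 0}.Finite := by
  open Polynomial in
  let P : ℂ[X] := (X ^ 2 - C p * X - C s) * (C 4 - X ^ 2) + X * C q * C r - C q ^ 2 - C r ^ 2
  have hP : P ≠ 0 := by
    intro h
    -- The conic determinant is a quartic in x with leading coefficient −1.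
    have h4 : P.coeff 4 = -1 := by
      have e : P = -X ^ 4 + C p * X ^ 3 + C (4 + s) * X ^ 2 + C (q * r - 4 * p) * X
          + C (-4 * s - q ^ 2 - r ^ 2) := by
        simp only [P, C_add, C_sub, C_mul, C_neg, C_pow]
        ring
      rw [e]
      generalize 4 + s = a, q * r - 4 * p = b, -4 * s - q ^ 2 - r ^ 2 = c
      simp
    rw [h] at h4
    simp at h4
  refine (P.rootSet_finite ℂ).subset fun x hx => ?_
  rw [mem_rootSet]
  refine ⟨hP, ?_⟩
  have hx : conicDet p q r s x = 0 := hx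
  rw [← hx]
  simp only [P, conicDet, map_sub, map_add, map_mul, map_pow, aeval_X, aeval_C, Algebra.algebraMap_self,
    RingHom.id_apply]

theorem finite_singularValues (μ : Param) : (singularValues μ).Finite :=
  (finite_setOf_conicDet_eq_zero _ _ _ _).union
    ((finite_setOf_conicDet_eq_zero _ _ _ _).union (finite_setOf_conicDet_eq_zero _ _ _ _))

theorem norm_center_le {x : ℂ} (hx : x ∈ singularValues μ) (h2 : x ≠ 2) (h2' : x ≠ -2)
    {i j : Fin 3} (hij : i ≠ j) :
    ‖(2 * μ.coef i - x * μ.coef j) / (4 - x ^ 2)‖ ≤ centerBound μ := by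
  refine le_csSup ?_ ⟨x, hx, h2, h2', i, j, hij, rfl⟩
  -- Boundedness has to be checked, since the real supremum of an unbounded set is 0 by convention.
  have hfin : (⋃ i : Fin 3, ⋃ j : Fin 3,
      (fun x => ‖(2 * μ.coef i - x * μ.coef j) / (4 - x ^ 2)‖) '' singularValues μ).Finite :=
    Set.finite_iUnion fun i => Set.finite_iUnion fun j => (finite_singularValues μ).image _
  refine hfin.bddAbove.mono ?_
  rintro t ⟨x, hx, -, -, i, j, -, rfl⟩
  simp only [Set.mem_iUnion]
  exact ⟨i, j, x, hx, rfl⟩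

/-- The determinant is symmetric in the coefficients of the two free variables, so the six orders
reduce to the three in the definition. -/
theorem mem_singularValues_of_conicDet {i j k : Fin 3} (hij : i ≠ j) (hik : i ≠ k) (hjk : j ≠ k)
    {x : ℂ} (h : conicDet (μ.coef i) (μ.coef j) (μ.coef k) μ.s x = 0) :
    x ∈ singularValues μ := by
  have hsymm : ∀ p q r s : ℂ, conicDet p q r s x = conicDet p r q s x := fun p q r s => by
    rw [conicDet, conicDet]; ring
  have c0 : μ.coef 0 = μ.p := rfl
  have c1 : μ.coef 1 = μ.q := rfl
  have c2 : μ.coef 2 = μ.r := rfl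
  have h' := (hsymm _ _ _ _).symm.trans h
  fin_cases i <;> fin_cases j <;> fin_cases k <;>
    simp only [Fin.zero_eta, Fin.mk_one, Fin.reduceFinMk, ne_eq, not_true_eq_false, c0, c1, c2]
      at hij hik hjk h h'
  · exact .inl h
  · exact .inl h'
  · exact .inr (.inl h')
  · exact .inr (.inl h)
  · exact .inr (.inr h)
  · exact .inr (.inr h')

/-- The recurrence satisfied by the values at the neighbours `v + nu` of `u`. -/
theorem val_ray_recurrence (φ : MarkoffMap μ) {u v : ℤ × ℤ} (h : IsBasis u v) (n : ℕ) :
    φ.val (v + (n + 2) • u) + φ.val u * φ.val (v + (n + 1) • u) + φ.val (v + n • u)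
      = μ.coef (color (reg (v + n • u))) := by
  have e := φ.val_add (h.add_nsmul (n + 1))
  rw [φ.val_sub_comm, show v + (n + 1) • u - u = v + n • u by module,
    show u + (v + (n + 1) • u) = v + n • u + u + u by module,
    color_reg_add_two (h.add_nsmul n)] at e
  rw [show v + (n + 2) • u = v + n • u + u + u by module]
  linear_combination e

theorem norm_ray_recurrence_le (φ : MarkoffMap μ) {u v : ℤ × ℤ} (h : IsBasis u v) (n : ℕ) :
    ‖φ.val (v + (n + 2) • u) + φ.val u * φ.val (v + (n + 1) • u) + φ.val (v + n • u)‖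
      ≤ 2 * alpha μ := by
  rw [val_ray_recurrence φ h]
  exact norm_coef_le _ _

theorem reg_ray_injective {u v : ℤ × ℤ} (h : IsBasis u v) :
    Function.Injective fun n : ℕ => reg (v + n • u) := by
  intro n m hnm
  have hne : u ≠ 0 := by rintro rfl; simp [IsBasis] at h
  rcases eq_or_eq_neg_of_reg_eq (h.add_nsmul n).symm.coprime (h.add_nsmul m).symm.coprime hnm
    with e | e
  · have e : (n : ℤ) • u = (m : ℤ) • u := by
      simpa only [natCast_zsmul] using add_left_cancel (a := v) (b := n • u) (c := m • u) e
    exact_mod_cast smul_left_injective ℤ hne e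
  · exfalso
    have e1 := congrArg Prod.fst e
    have e2 := congrArg Prod.snd e
    simp only [Prod.fst_add, Prod.snd_add, Prod.smul_fst, Prod.smul_snd, Prod.fst_neg,
      Prod.snd_neg, ← natCast_zsmul, smul_eq_mul] at e1 e2
    have : u.1 * v.2 - v.1 * u.2 = 0 := by
      have : 2 * (u.1 * v.2 - v.1 * u.2) = 0 := by
        linear_combination u.1 * e2 - u.2 * e1
      omega
    rw [IsBasis, this] at h
    simp at h

/-- Around a region the values of a map satisfying the BQ-conditions are unbounded, in both
directions. -/
theorem exists_lt_norm_val_ray {L : ℝ} (hM : centerBound μ + 1 ≤ L) {φ : MarkoffMap μ}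
    (hφ : φ ∈ bowditchMaps μ L) {u v : ℤ × ℤ} (h : IsBasis u v) (C : ℝ) :
    ∃ n : ℕ, C < ‖φ.val (v + n • u)‖ := by
  by_contra! hC
  obtain ⟨hreal, hfin⟩ := hφ
  set x := φ.val u with hx
  have hxr : x ∉ realSegment := hreal _
  obtain ⟨l, hl, hxl⟩ := exists_eigenvalue hxr
  have h2 : x ≠ 2 := by rintro h; exact hxr ⟨2, by norm_num, by simp [h]⟩
  have h2' : x ≠ -2 := by rintro h; exact hxr ⟨-2, by norm_num, by simp [h]⟩
  have hD : 4 - x ^ 2 ≠ 0 := by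
    intro h0
    have : (x - 2) * (x + 2) = 0 := by linear_combination -h0
    rcases mul_eq_zero.1 this with h | h
    · exact h2 (sub_eq_zero.1 h)
    · exact h2' (eq_neg_of_add_eq_zero_left h)
  set i := color (reg u)
  set j := color (reg v) with hj
  set k := color (reg (v + u)) with hk
  have huk : IsBasis u (v + u) := by simpa using h.add_nsmul 1
  have hij : i ≠ j := color_ne_of_adj h.adj
  have hik : i ≠ k := color_ne_of_adj huk.adj
  have hvk : IsBasis v (v + u) := h.symm.left
  have hjk : j ≠ k := color_ne_of_adj hvk.adj
  -- (w₀, w₁) is the centre of the conic obtained by fixing x, and also the 2-periodic solution of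
  -- the recurrence; `e0` and `e1` state both facts at once.
  set w₀ := (2 * μ.coef j - x * μ.coef k) / (4 - x ^ 2) with hw0
  set w₁ := (2 * μ.coef k - x * μ.coef j) / (4 - x ^ 2) with hw1
  have e0 : 2 * w₀ + x * w₁ = μ.coef j := by rw [hw0, hw1]; field_simp; ring
  have e1 : 2 * w₁ + x * w₀ = μ.coef k := by rw [hw0, hw1]; field_simp; ring
  have hcol : ∀ n : ℕ, color (reg (v + (2 * n) • u)) = j ∧ color (reg (v + (2 * n + 1) • u)) = k := by
    intro n
    induction n with
    | zero => simp [hj, hk]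
    | succ n ih =>
      rw [← ih.1, ← ih.2, ← color_reg_add_two (h.add_nsmul (2 * n)),
        ← color_reg_add_two (h.add_nsmul (2 * n + 1))]
      constructor
      · congr 2; module
      · congr 2; module
  let d : ℕ → ℂ := fun n => φ.val (v + n • u) - if Even n then w₀ else w₁
  have hd : ∀ n, d (n + 2) + x * d (n + 1) + d n = 0 := by
    intro n
    have hr := val_ray_recurrence φ h n
    rw [← hx] at hr
    rcases Nat.even_or_odd' n with ⟨m, rfl | rfl⟩
    · rw [(hcol m).1] at hr
      have a1 : Even (2 * m) := even_two_mul m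
      have a2 : ¬ Even (2 * m + 1) := by simp
      have a3 : Even (2 * m + 2) := ⟨m + 1, by ring⟩
      simp only [d, if_pos a1, if_neg a2, if_pos a3]
      linear_combination hr - e0
    · rw [(hcol m).2] at hr
      have a1 : ¬ Even (2 * m + 1) := by simp
      have a2 : Even (2 * m + 1 + 1) := ⟨m + 1, by ring⟩
      have a3 : ¬ Even (2 * m + 1 + 2) := by
        rw [show 2 * m + 1 + 2 = 2 * (m + 1) + 1 by ring]; simp
      simp only [d, if_neg a1, if_pos a2, if_neg a3]
      linear_combination hr - e1
  have hdC : ∀ n, ‖d n‖ ≤ C + (‖w₀‖ + ‖w₁‖) := by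
    intro n
    refine (norm_sub_le _ _).trans (add_le_add (hC n) ?_)
    split_ifs
    · linarith [norm_nonneg w₁]
    · linarith [norm_nonneg w₀]
  have hlim := tendsto_zero_of_bounded_recurrence hl hxl hd hdC
  have t0 : Filter.Tendsto (fun n : ℕ => φ.val (v + (2 * n) • u)) Filter.atTop (nhds w₀) := by
    have := (hlim.comp (Filter.tendsto_id.const_mul_atTop' two_pos)).add_const w₀
    simpa [d, Function.comp_def] using this
  have t1 : Filter.Tendsto (fun n : ℕ => φ.val (v + (2 * n + 1) • u)) Filter.atTop (nhds w₁) := by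
    have := ((hlim.comp (Filter.tendsto_add_atTop_nat 1)).comp
      (Filter.tendsto_id.const_mul_atTop' two_pos)).add_const w₁
    simpa [d, Function.comp_def] using this
  have hvert : ∀ n : ℕ, x ^ 2 + φ.val (v + (2 * n) • u) ^ 2 + φ.val (v + (2 * n + 1) • u) ^ 2
      + x * φ.val (v + (2 * n) • u) * φ.val (v + (2 * n + 1) • u)
      = μ.coef i * x + μ.coef j * φ.val (v + (2 * n) • u)
        + μ.coef k * φ.val (v + (2 * n + 1) • u) + μ.s := by
    intro n
    have hb : IsBasis (v + (2 * n) • u) (v + (2 * n + 1) • u) := by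
      have := (h.add_nsmul (2 * n)).symm.left
      rwa [show v + (2 * n) • u + u = v + (2 * n + 1) • u by module] at this
    have := φ.vertex_symm (h.add_nsmul (2 * n)).adj (h.add_nsmul (2 * n + 1)).adj hb.adj
    rw [(hcol n).1, (hcol n).2] at this
    exact this
  -- Passing to the limit in the vertex relations puts the centre on the conic, which must then be
  -- degenerate.
  have hlimv : x ^ 2 + w₀ ^ 2 + w₁ ^ 2 + x * w₀ * w₁
      = μ.coef i * x + μ.coef j * w₀ + μ.coef k * w₁ + μ.s := by
    have a := (((t0.pow 2).const_add (x ^ 2)).add (t1.pow 2)).add ((t0.const_mul x).mul t1)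
    have b := (((t0.const_mul (μ.coef j)).const_add (μ.coef i * x)).add
      (t1.const_mul (μ.coef k))).add_const μ.s
    exact tendsto_nhds_unique (a.congr hvert) b
  have hsing : x ∈ singularValues μ := by
    refine mem_singularValues_of_conicDet hij hik hjk ?_
    rw [conicDet, ← e0, ← e1]
    rw [← e0, ← e1] at hlimv
    linear_combination (4 - x ^ 2) * hlimv
  have hw : ‖w₀‖ + 1 ≤ L := (add_le_add (norm_center_le hsing h2 h2' hjk) le_rfl).trans hM
  have hev : ∀ᶠ n : ℕ in Filter.atTop, ‖φ.val (v + (2 * n) • u)‖ < ‖w₀‖ + 1 :=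
    t0.norm.eventually_lt_const (lt_add_one _)
  obtain ⟨N, hN⟩ := Filter.eventually_atTop.1 hev
  -- The even-indexed boundary regions from N on are distinct and have value below |w₀| + 1 ≤ L,
  -- against the finiteness condition.
  refine Set.infinite_of_injective_forall_mem (f := fun n : ℕ => reg (v + (2 * (n + N)) • u))
    ?_ (fun n => ?_) hfin
  · intro n m hnm
    have := reg_ray_injective h hnm
    omega
  · exact ((hN (n + N) (by omega)).le.trans hw : ‖φ.val (v + (2 * (n + N)) • u)‖ ≤ L)

end

section

/-! ## Uniform growth beyond an edge -/

variable {μ : Param} {L : ℝ}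

theorem MarkoffMap.norm_mul_norm_le (φ : MarkoffMap μ) {u v : ℤ × ℤ} (h : IsBasis u v) :
    ‖φ.val u‖ * ‖φ.val v‖ ≤ 2 * alpha μ + ‖φ.val (u + v)‖ + ‖φ.val (u - v)‖ := by
  have e : φ.val u * φ.val v
      = μ.coef (color (reg (u + v))) - φ.val (u + v) - φ.val (u - v) := by
    linear_combination φ.val_add h
  rw [← norm_mul, e]
  refine (norm_sub_le _ _).trans (add_le_add ((norm_sub_le _ _).trans ?_) le_rfl)
  exact add_le_add (norm_coef_le _ _) le_rfl

/-- The least growth of a Markoff map per step in the tree, where its values are at least `L`. -/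
def gap (μ : Param) (L : ℝ) : ℝ := L * (L - 2) - 2 * alpha μ

/-- L(L − 2) ≥ Lα ≥ 2α, the last inequality being strict if α > 0 and the left side being positive
if α = 0. -/
theorem gap_pos (hα : 2 + alpha μ ≤ L) (hL : 2 < L) : 0 < gap μ L := by
  rw [gap]; nlinarith [alpha_nonneg μ]

/-- Beyond the edge `u ∩ v` directed towards `u + v`, the values of `φ` grow. -/
def Escape (L : ℝ) (φ : MarkoffMap μ) (u v : ℤ × ℤ) : Prop :=
  L < ‖φ.val u‖ ∧ L < ‖φ.val v‖ ∧ ‖φ.val u‖ < ‖φ.val (u + v)‖ ∧ ‖φ.val v‖ < ‖φ.val (u + v)‖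

theorem Escape.symm {φ : MarkoffMap μ} {u v : ℤ × ℤ} (h : Escape L φ u v) : Escape L φ v u := by
  obtain ⟨h1, h2, h3, h4⟩ := h
  rw [add_comm] at h3 h4
  exact ⟨h2, h1, h4, h3⟩

/-- On the edge (u, u + v) the value behind is φ(v), smaller than φ(u+v). Thus |φ(2u+v)| − |φ(u+v)|
≥ (L − 2)|φ(u+v)| − 2α, and |φ(u+v)| > L. -/
theorem Escape.add_gap_le {φ : MarkoffMap μ} (hL : 2 < L) {u v : ℤ × ℤ}
    (hb : IsBasis u v) (h : Escape L φ u v) :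
    ‖φ.val (u + v)‖ + gap μ L ≤ ‖φ.val (u + (u + v))‖ := by
  obtain ⟨h1, h2, h3, h4⟩ := h
  have := φ.norm_mul_norm_le hb.left
  rw [sub_add_cancel_left, φ.val_neg] at this
  rw [gap]
  have i1 : L * ‖φ.val (u + v)‖ ≤ ‖φ.val u‖ * ‖φ.val (u + v)‖ :=
    mul_le_mul_of_nonneg_right h1.le (norm_nonneg _)
  nlinarith

theorem Escape.left {φ : MarkoffMap μ} (hα : 2 + alpha μ ≤ L) (hL : 2 < L) {u v : ℤ × ℤ}
    (hb : IsBasis u v) (h : Escape L φ u v) : Escape L φ u (u + v) := by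
  have h5 := h.add_gap_le hL hb
  have hg := gap_pos hα hL
  obtain ⟨h1, h2, h3, h4⟩ := h
  exact ⟨h1, h1.trans h3, by linarith, by linarith⟩

theorem Escape.right {φ : MarkoffMap μ} (hα : 2 + alpha μ ≤ L) (hL : 2 < L) {u v : ℤ × ℤ}
    (hb : IsBasis u v) (h : Escape L φ u v) : Escape L φ (u + v) v := by
  have := (h.symm.left hα hL hb.symm).symm
  rwa [add_comm v u] at this

theorem Escape.add_gap_le' {φ : MarkoffMap μ} (hL : 2 < L) {u v : ℤ × ℤ}
    (hb : IsBasis u v) (h : Escape L φ u v) :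
    ‖φ.val (u + v)‖ + gap μ L ≤ ‖φ.val (u + v + v)‖ := by
  have := h.symm.add_gap_le hL hb.symm
  rwa [add_comm v u, add_comm v] at this

theorem Escape.norm_le_of_cone {φ : MarkoffMap μ} (hα : 2 + alpha μ ≤ L) (hL : 2 < L)
    {u v w : ℤ × ℤ} (hw : Cone u v w) :
    IsBasis u v → Escape L φ u v → ‖φ.val (u + v)‖ ≤ ‖φ.val w‖ := by
  have hg := gap_pos hα hL
  induction hw with
  | head u v => exact fun _ _ => le_rfl
  | left _ ih =>
    intro hb h
    have := h.add_gap_le hL hb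
    exact le_trans (by linarith) (ih hb.left (h.left hα hL hb))
  | right _ ih =>
    intro hb h
    have := h.add_gap_le' hL hb
    exact le_trans (by linarith) (ih hb.right (h.right hα hL hb))

/-- The regions beyond an edge where some map in `U` has modulus at most `N`. -/
def smallSet (U : Set (MarkoffMap μ)) (N : ℝ) (u v : ℤ × ℤ) : Set (ℤ × ℤ) :=
  {w | Cone u v w ∧ ∃ φ ∈ U, ‖φ.val w‖ ≤ N}

theorem smallSet_finite_of_children {U : Set (MarkoffMap μ)} {N : ℝ} {u v : ℤ × ℤ}
    (h1 : (smallSet U N u (u + v)).Finite) (h2 : (smallSet U N (u + v) v).Finite) :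
    (smallSet U N u v).Finite := by
  refine ((Set.finite_singleton (u + v)).union (h1.union h2)).subset ?_
  rintro w ⟨hw, hφ⟩
  cases hw with
  | head => exact .inl rfl
  | left hw => exact .inr (.inl ⟨hw, hφ⟩)
  | right hw => exact .inr (.inr ⟨hw, hφ⟩)

theorem smallSet_swap (U : Set (MarkoffMap μ)) (N : ℝ) (u v : ℤ × ℤ) :
    smallSet U N u v = smallSet U N v u := by
  ext w
  exact ⟨fun h => ⟨h.1.swap, h.2⟩, fun h => ⟨h.1.swap, h.2⟩⟩

theorem smallSet_mono {U V : Set (MarkoffMap μ)} (h : U ⊆ V) (N : ℝ) (u v : ℤ × ℤ) :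
    smallSet U N u v ⊆ smallSet V N u v :=
  fun _ ⟨hw, φ, hφ, hN⟩ => ⟨hw, φ, h hφ, hN⟩

/-- After n steps every value exceeds n · gap for all maps in U at once, so only regions at bounded
depth can be small. -/
theorem smallSet_finite_of_escape (hα : 2 + alpha μ ≤ L) (hL : 2 < L) {U : Set (MarkoffMap μ)}
    {u v : ℤ × ℤ} (hb : IsBasis u v) (hU : ∀ φ ∈ U, Escape L φ u v) (N : ℝ) :
    (smallSet U N u v).Finite := by
  have hg := gap_pos hα hL
  have key : ∀ (n : ℕ) {u v : ℤ × ℤ}, IsBasis u v → (∀ φ ∈ U, Escape L φ u v) →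
      (∀ φ ∈ U, N - n * gap μ L < ‖φ.val (u + v)‖) → (smallSet U N u v).Finite := by
    intro n
    induction n with
    | zero =>
      intro u v hb hU hN
      convert Set.finite_empty
      rw [Set.eq_empty_iff_forall_notMem]
      rintro w ⟨hw, φ, hφ, hle⟩
      have h1 := (hU φ hφ).norm_le_of_cone hα hL hw hb
      have h2 := hN φ hφ
      simp at h2
      linarith
    | succ n ih =>
      intro u v hb hU hN
      push_cast at hN
      refine smallSet_finite_of_children (ih hb.left (fun φ hφ => (hU φ hφ).left hα hL hb) ?_)
        (ih hb.right (fun φ hφ => (hU φ hφ).right hα hL hb) ?_)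
      · intro φ hφ
        linarith [(hU φ hφ).add_gap_le hL hb, hN φ hφ]
      · intro φ hφ
        linarith [(hU φ hφ).add_gap_le' hL hb, hN φ hφ]
  obtain ⟨n, hn⟩ := exists_nat_gt (N / gap μ L)
  rw [div_lt_iff₀ hg] at hn
  refine key n hb hU fun φ hφ => ?_
  linarith [norm_nonneg (φ.val (u + v))]

/-! ### Growth along the boundary of one region. -/

/-- Along the boundary of `u` in the direction `v, v + u, v + 2u, …`, all branches leaving this
boundary escape, and the values grow. -/
def RayEscape (L : ℝ) (φ : MarkoffMap μ) (u v : ℤ × ℤ) : Prop :=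
  ∀ n : ℕ, Escape L φ (u + (v + n • u)) (v + n • u) ∧
    ‖φ.val (v + n • u)‖ ≤ ‖φ.val (u + (v + n • u))‖

theorem RayEscape.shift {φ : MarkoffMap μ} {u v : ℤ × ℤ} (h : RayEscape L φ u v) :
    RayEscape L φ u (u + v) := by
  intro n
  have := h (n + 1)
  rwa [show v + (n + 1) • u = u + v + n • u by module] at this

theorem RayEscape.norm_le_of_cone {φ : MarkoffMap μ} (hα : 2 + alpha μ ≤ L) (hL : 2 < L)
    {u v w : ℤ × ℤ} (hw : Cone u v w) :
    IsBasis u v → RayEscape L φ u v → ‖φ.val v‖ ≤ ‖φ.val w‖ := by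
  induction hw with
  | head u v => intro _ h; simpa using (h 0).2
  | @left u v w _ ih =>
    intro hb h
    refine le_trans ?_ (ih hb.left h.shift)
    simpa using (h 0).2
  | @right u v w hw _ =>
    intro hb h
    have h0 : Escape L φ (u + v) v := by simpa using (h 0).1
    exact h0.2.2.2.le.trans (h0.norm_le_of_cone hα hL hw hb.right)

/-- Only the first n branches off the boundary of u can contain small values, and each contributes
finitely many. Here φ(u) itself may be small. -/
theorem smallSet_finite_of_rayEscape (hα : 2 + alpha μ ≤ L) (hL : 2 < L)
    {U : Set (MarkoffMap μ)} {N : ℝ} (n : ℕ) {u v : ℤ × ℤ} (hb : IsBasis u v)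
    (hU : ∀ φ ∈ U, RayEscape L φ u v) (hN : ∀ φ ∈ U, N < ‖φ.val (v + n • u)‖) :
    (smallSet U N u v).Finite := by
  induction n generalizing v with
  | zero =>
    convert Set.finite_empty
    rw [Set.eq_empty_iff_forall_notMem]
    rintro w ⟨hw, φ, hφ, hle⟩
    have h1 := (hU φ hφ).norm_le_of_cone hα hL hw hb
    have h2 := hN φ hφ
    simp at h2
    linarith
  | succ n ih =>
    refine smallSet_finite_of_children (ih hb.left (fun φ hφ => (hU φ hφ).shift) ?_) ?_
    · intro φ hφ
      rw [show u + v + n • u = v + (n + 1) • u by module]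
      exact hN φ hφ
    · refine smallSet_finite_of_escape hα hL hb.right (fun φ hφ => ?_) N
      simpa using (hU φ hφ 0).1

/-! ## Local uniformity -/

/-- Near `φ₀`, the values beyond an edge are uniformly proper. -/
def Good (φ₀ : MarkoffMap μ) (u v : ℤ × ℤ) : Prop :=
  ∃ U ∈ nhds φ₀, ∀ N, (smallSet U N u v).Finite

theorem Good.symm {φ₀ : MarkoffMap μ} {u v : ℤ × ℤ} (h : Good φ₀ u v) : Good φ₀ v u := by
  obtain ⟨U, hU, h⟩ := h
  exact ⟨U, hU, fun N => by rw [smallSet_swap]; exact h N⟩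

theorem good_of_children {φ₀ : MarkoffMap μ} {u v : ℤ × ℤ} (h1 : Good φ₀ u (u + v))
    (h2 : Good φ₀ (u + v) v) : Good φ₀ u v := by
  obtain ⟨U, hU, h1⟩ := h1
  obtain ⟨V, hV, h2⟩ := h2
  refine ⟨U ∩ V, Filter.inter_mem hU hV, fun N => smallSet_finite_of_children
    ((h1 N).subset (smallSet_mono Set.inter_subset_left _ _ _))
    ((h2 N).subset (smallSet_mono Set.inter_subset_right _ _ _))⟩

theorem good_of_escape (hα : 2 + alpha μ ≤ L) (hL : 2 < L) {φ₀ : MarkoffMap μ} {u v : ℤ × ℤ}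
    (hb : IsBasis u v) (h : Escape L φ₀ u v) : Good φ₀ u v := by
  refine ⟨{φ | Escape L φ u v}, IsOpen.mem_nhds ?_ h,
    smallSet_finite_of_escape hα hL hb fun φ hφ => hφ⟩
  have c := fun w => (continuous_val (μ := μ) w).norm
  exact (isOpen_lt continuous_const (c _)).inter ((isOpen_lt continuous_const (c _)).inter
    ((isOpen_lt (c _) (c _)).inter (isOpen_lt (c _) (c _))))

theorem escape_of_norm_le (hα : 2 + alpha μ ≤ L) (hL : 2 < L) {φ : MarkoffMap μ}
    {u v : ℤ × ℤ} (hb : IsBasis u v) (hu : L < ‖φ.val u‖) (hv : L < ‖φ.val v‖)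
    (h : ‖φ.val (u - v)‖ ≤ ‖φ.val (u + v)‖) : Escape L φ u v := by
  have h1 := φ.norm_mul_norm_le hb
  have hg := gap_pos hα hL
  rw [gap] at hg
  refine ⟨hu, hv, ?_, ?_⟩ <;> nlinarith

/-- If a child edge does not escape, the edge inequality bounds both of its sides by |φ(v)| − gap/2
(or the same with u). This descent cannot continue forever while all values exceed L. -/
theorem good_of_norm_gt (hα : 2 + alpha μ ≤ L) (hL : 2 < L) {φ : MarkoffMap μ} {u v : ℤ × ℤ}
    (hb : IsBasis u v) (hu : L < ‖φ.val u‖) (hv : L < ‖φ.val v‖)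
    (hw : ∀ w, Cone u v w → L < ‖φ.val w‖) : Good φ u v := by
  have hg := gap_pos hα hL
  have key : ∀ (n : ℕ) {u v : ℤ × ℤ}, IsBasis u v → L < ‖φ.val u‖ → L < ‖φ.val v‖ →
      (∀ w, Cone u v w → L < ‖φ.val w‖) → ‖φ.val u‖ ≤ n * (gap μ L / 2) →
      ‖φ.val v‖ ≤ n * (gap μ L / 2) → Good φ u v := by
    intro n
    induction n with
    | zero => intro u v _ hu _ _ h; simp at h; rw [h] at hu; simp at hu; linarith
    | succ n ih =>
      have child : ∀ {u v : ℤ × ℤ}, IsBasis u v → L < ‖φ.val u‖ → L < ‖φ.val v‖ →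
          (∀ w, Cone u v w → L < ‖φ.val w‖) → ‖φ.val v‖ ≤ (n + 1 : ℕ) * (gap μ L / 2) →
          Good φ u (u + v) := by
        intro u v hb hu hv hw hvn
        have huv := hw _ (.head u v)
        by_cases h : ‖φ.val (u - (u + v))‖ ≤ ‖φ.val (u + (u + v))‖
        · exact good_of_escape hα hL hb.left (escape_of_norm_le hα hL hb.left hu huv h)
        · push Not at h
          have h1 := φ.norm_mul_norm_le hb.left
          rw [sub_add_cancel_left, φ.val_neg] at h h1
          push_cast at hvn
          -- Here |φ(u)||φ(u+v)| ≤ 2α + 2|φ(v)| with both factors above L, which bounds each factor.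
          refine ih hb.left hu huv (fun w h => hw w h.left) ?_ ?_ <;> rw [gap] at * <;> nlinarith
      intro u v hb hu hv hw hun hvn
      refine good_of_children (child hb hu hv hw hvn) ?_
      have := (child hb.symm hv hu (fun w h => hw w h.swap) hun).symm
      rwa [add_comm] at this
  obtain ⟨n, hn⟩ := exists_nat_gt (max ‖φ.val u‖ ‖φ.val v‖ / (gap μ L / 2))
  rw [div_lt_iff₀ (by linarith)] at hn
  exact key n hb hu hv hw ((le_max_left _ _).trans hn.le) ((le_max_right _ _).trans hn.le)

/-- Behind the branch edge (u + v + nu, v + nu) lies u, whose value is fixed. So the product of two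
large values forces the value ahead to dominate as soon as B ≥ 2 + 2α + |φ(u)|. -/
theorem rayEscape_of_growth {φ : MarkoffMap μ} (hL : 0 < L) {u v : ℤ × ℤ} (hb : IsBasis u v)
    {B k : ℝ} (hk : 1 < k) (hB : L ≤ B) (hB' : 2 + 2 * alpha μ + ‖φ.val u‖ ≤ B)
    (h0 : B < ‖φ.val v‖) (h : ∀ n : ℕ, B * k ^ n ≤ ‖φ.val (v + n • u)‖ ∧
      ‖φ.val (v + n • u)‖ ≤ ‖φ.val (v + (n + 1) • u)‖) : RayEscape L φ u v := by
  intro n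
  obtain ⟨i1, i2⟩ := h n
  have i0 : B < ‖φ.val (v + n • u)‖ := by
    rcases n with _ | n
    · simpa using h0
    · refine lt_of_lt_of_le ?_ i1
      have : 1 < k ^ (n + 1) := one_lt_pow₀ hk (by omega)
      nlinarith
  rw [show v + (n + 1) • u = u + (v + n • u) by module] at i2
  have hprod := φ.norm_mul_norm_le (hb.add_nsmul n).right
  rw [add_sub_cancel_right] at hprod
  have hA := alpha_nonneg μ
  have hx := norm_nonneg (φ.val u)
  have hlt : ‖φ.val (u + (v + n • u))‖ < ‖φ.val (u + (v + n • u) + (v + n • u))‖ := by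
    nlinarith
  exact ⟨⟨by linarith, by linarith, hlt, by linarith⟩, i2⟩

/-- The maps whose values along the boundary of `u` start, at `v`, in the cone around the unstable
direction `l` of the recurrence. -/
def rayNhds (μ : Param) (l : ℂ) (B d : ℝ) (u v : ℤ × ℤ) : Set (MarkoffMap μ) :=
  {φ | B < ‖φ.val v‖ ∧ ‖φ.val (v + u) - l * φ.val v‖ < (‖l‖ - 1) / 2 * ‖φ.val v‖ ∧
    ‖φ.val u + (l + l⁻¹)‖ < d}

theorem isOpen_rayNhds (l : ℂ) (B d : ℝ) (u v : ℤ × ℤ) : IsOpen (rayNhds μ l B d u v) := by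
  have c := fun w => continuous_val (μ := μ) w
  have h1 := isOpen_lt continuous_const (c v).norm (f := fun _ => B)
  have h2 := isOpen_lt ((c (v + u)).sub ((c v).const_mul l)).norm
    ((c v).norm.const_mul ((‖l‖ - 1) / 2))
  have h3 := isOpen_lt ((c u).add_const (l + l⁻¹)).norm (continuous_const (y := d))
  exact h1.inter (h2.inter h3)

theorem smallSet_rayNhds_finite (hα : 2 + alpha μ ≤ L) (hL : 2 < L) {l : ℂ} (hl : 1 < ‖l‖)
    {B d : ℝ} (hB : L ≤ B) (hB' : 2 + 2 * alpha μ + ‖l + l⁻¹‖ + d ≤ B)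
    (hgrow : ∀ (x : ℂ) (y : ℕ → ℂ), ‖x + (l + l⁻¹)‖ ≤ d →
      (∀ n, ‖y (n + 2) + x * y (n + 1) + y n‖ ≤ 2 * alpha μ) → B ≤ ‖y 0‖ →
      ‖y 1 - l * y 0‖ ≤ (‖l‖ - 1) / 2 * ‖y 0‖ →
      ∀ n, B * ((‖l‖ + 1) / 2) ^ n ≤ ‖y n‖ ∧ ‖y n‖ ≤ ‖y (n + 1)‖)
    {u v : ℤ × ℤ} (hb : IsBasis u v) (N : ℝ) : (smallSet (rayNhds μ l B d u v) N u v).Finite := by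
  have hk : 1 < (‖l‖ + 1) / 2 := by linarith
  have hgrow' : ∀ φ ∈ rayNhds μ l B d u v, ∀ m : ℕ,
      B * ((‖l‖ + 1) / 2) ^ m ≤ ‖φ.val (v + m • u)‖ ∧
      ‖φ.val (v + m • u)‖ ≤ ‖φ.val (v + (m + 1) • u)‖ := by
    rintro φ ⟨h1, h2, h3⟩
    refine hgrow (φ.val u) (fun m => φ.val (v + m • u)) h3.le (norm_ray_recurrence_le φ hb) ?_ ?_
    · simpa only [zero_smul, add_zero] using h1.le
    · simpa only [zero_smul, add_zero, one_smul] using h2.le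
  have hray : ∀ φ ∈ rayNhds μ l B d u v, RayEscape L φ u v := by
    intro φ hφ
    refine rayEscape_of_growth (by linarith) hb hk hB ?_ hφ.1 (hgrow' φ hφ)
    have := norm_sub_le (φ.val u + (l + l⁻¹)) (l + l⁻¹)
    rw [add_sub_cancel_right] at this
    linarith [hφ.2.2]
  obtain ⟨m, hm⟩ := pow_unbounded_of_one_lt (N / B) hk
  rw [div_lt_iff₀' (by linarith)] at hm
  exact smallSet_finite_of_rayEscape hα hL m hb hray fun φ hφ => hm.trans_le (hgrow' φ hφ m).1

/-- The deviation from the unstable direction stays below V while the values are unbounded, so at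
some n the map enters the open growth cone `rayNhds`. -/
theorem exists_good_ray (hα : 2 + alpha μ ≤ L) (hL : 2 < L) (hM : centerBound μ + 1 ≤ L)
    {φ₀ : MarkoffMap μ} (hφ : φ₀ ∈ bowditchMaps μ L) {u v : ℤ × ℤ} (hb : IsBasis u v) :
    ∃ n : ℕ, Good φ₀ u (v + n • u) := by
  obtain ⟨l, hl, hxl⟩ := exists_eigenvalue (hφ.1 (reg u))
  obtain ⟨d, hd, B₀, hB₀, hgrow⟩ := growth_of_cone hl (2 * alpha μ)
  obtain ⟨V, hV⟩ := exists_bound_of_recurrence (y := fun n => φ₀.val (v + n • u)) hl hxl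
    (norm_ray_recurrence_le φ₀ hb)
  obtain ⟨B, hB1, hB2, hB3⟩ : ∃ B, B₀ ≤ B ∧ L ≤ B ∧ 2 + 2 * alpha μ + ‖l + l⁻¹‖ + d ≤ B :=
    ⟨max B₀ (max L _), le_max_left _ _, (le_max_left _ _).trans (le_max_right _ _),
      (le_max_right _ _).trans (le_max_right _ _)⟩
  have he : 0 < (‖l‖ - 1) / 2 := by linarith
  obtain ⟨n, hn⟩ := exists_lt_norm_val_ray hM hφ hb (max B (V / ((‖l‖ - 1) / 2)))
  obtain ⟨hn1, hn2⟩ := max_lt_iff.1 hn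
  rw [div_lt_iff₀' he] at hn2
  refine ⟨n, rayNhds μ l B d u (v + n • u), (isOpen_rayNhds _ _ _ _ _).mem_nhds ⟨hn1, ?_, ?_⟩,
    smallSet_rayNhds_finite hα hL hl hB2 hB3 (hgrow B hB1) (hb.add_nsmul n)⟩
  · refine lt_of_le_of_lt ?_ hn2
    have := hV n
    rwa [show v + (n + 1) • u = v + n • u + u by module] at this
  · have : φ₀.val u + (l + l⁻¹) = 0 := by rw [MarkoffMap.val, hxl]; ring
    rw [this, norm_zero]
    exact hd

theorem Cone.of_add_nsmul {u v w : ℤ × ℤ} (n : ℕ) (h : Cone u (v + n • u) w) : Cone u v w := by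
  induction n with
  | zero => simpa using h
  | succ n ih =>
    apply ih
    rw [show v + (n + 1) • u = u + (v + n • u) by module] at h
    exact h.left

theorem Cone.add_nsmul (u v : ℤ × ℤ) (n : ℕ) : Cone u v (u + (v + n • u)) :=
  (Cone.head u (v + n • u)).of_add_nsmul n

/-- Only n branches are used before the good tail, so a finite intersection of neighbourhoods
suffices. -/
theorem good_of_branches {φ₀ : MarkoffMap μ} {u v : ℤ × ℤ} (n : ℕ) (hn : Good φ₀ u (v + n • u))
    (h : ∀ n : ℕ, Good φ₀ (u + (v + n • u)) (v + n • u)) : Good φ₀ u v := by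
  induction n with
  | zero => simpa using hn
  | succ n ih =>
    apply ih
    refine good_of_children ?_ (h n)
    rwa [show u + (v + n • u) = v + (n + 1) • u by module]

theorem good_of_cone_norm_gt (hα : 2 + alpha μ ≤ L) (hL : 2 < L) (hM : centerBound μ + 1 ≤ L)
    {φ : MarkoffMap μ} (hφ : φ ∈ bowditchMaps μ L) {u v : ℤ × ℤ}
    (hb : IsBasis u v) (hw : ∀ w, Cone u v w → L < ‖φ.val w‖) : Good φ u v := by
  -- If v is large, every branch off u has two large sides. In general the branch at m = 0 still has
  -- the possibly small side v, but its other side u + v is large, so `half` applies with v as the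
  -- ray axis.
  have half : ∀ {u v : ℤ × ℤ}, IsBasis u v → (∀ w, Cone u v w → L < ‖φ.val w‖) →
      L < ‖φ.val v‖ → Good φ u v := by
    intro u v hb hw hv
    obtain ⟨n, hn⟩ := exists_good_ray hα hL hM hφ hb
    refine good_of_branches n hn fun m => ?_
    refine good_of_norm_gt hα hL (hb.add_nsmul m).right (hw _ (.add_nsmul u v m)) ?_
      fun w h => hw w (Cone.of_add_nsmul m h.right)
    rcases m with _ | m
    · simpa using hv
    · rw [show v + (m + 1) • u = u + (v + m • u) by module]
      exact hw _ (.add_nsmul u v m)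
  obtain ⟨n, hn⟩ := exists_good_ray hα hL hM hφ hb
  refine good_of_branches n hn fun m => Good.symm ?_
  exact half (hb.add_nsmul m).right.symm
    (fun w h => hw w (Cone.of_add_nsmul m h.swap.right)) (hw _ (.add_nsmul u v m))

theorem Cone.add_le_map (f : ℤ × ℤ →+ ℤ) {u v w : ℤ × ℤ} (h : Cone u v w) :
    1 ≤ f u → 1 ≤ f v → f u + f v ≤ f w := by
  induction h with
  | head u v => intro _ _; rw [map_add]
  | left _ ih => intro h1 h2; rw [map_add] at ih; have := ih h1 (by omega); omega
  | right _ ih => intro h1 h2; rw [map_add] at ih; have := ih (by omega) h2; omega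

theorem finite_primitive {S : Set Region} (hS : S.Finite) :
    {w : ℤ × ℤ | IsCoprime w.1 w.2 ∧ reg w ∈ S}.Finite := by
  refine ((hS.image fun X => (num X, den X)).union
    (hS.image fun X => -(num X, den X))).subset ?_
  rintro w ⟨hw, hS⟩
  rcases eq_or_eq_neg_of_reg_eq (u := (num (reg w), den (reg w))) (isCoprime_num_den _) hw
    (reg_num_den _) with h | h
  · exact .inl ⟨_, hS, h⟩
  · exact .inr ⟨_, hS, by simp only [h, neg_neg]⟩

/-- The functional f measures depth: it is bounded by K on the finitely many small vectors, at least
f(u) + f(v) on the cone, and that sum increases at each child. -/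
theorem good_of_mem_bowditchMaps (hα : 2 + alpha μ ≤ L) (hL : 2 < L)
    (hM : centerBound μ + 1 ≤ L) {φ : MarkoffMap μ} (hφ : φ ∈ bowditchMaps μ L)
    (f : ℤ × ℤ →+ ℤ) {u v : ℤ × ℤ} (hb : IsBasis u v) (hu : 1 ≤ f u) (hv : 1 ≤ f v) :
    Good φ u v := by
  obtain ⟨K, hK⟩ := ((finite_primitive hφ.2).image f).bddAbove
  have hK' : ∀ w : ℤ × ℤ, IsCoprime w.1 w.2 → ‖φ.val w‖ ≤ L → f w ≤ K :=
    fun w h1 h2 => hK ⟨w, ⟨h1, h2⟩, rfl⟩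
  have key : ∀ (n : ℕ) {u v : ℤ × ℤ}, IsBasis u v → 1 ≤ f u → 1 ≤ f v → K - (f u + f v) < n →
      Good φ u v := by
    intro n
    induction n with
    | zero =>
      intro u v hb hu hv hn
      refine good_of_cone_norm_gt hα hL hM hφ hb fun w hw => ?_
      by_contra! hle
      have h1 := hK' w (hw.coprime hb) hle
      have h2 := hw.add_le_map f hu hv
      push_cast at hn
      omega
    | succ n ih =>
      intro u v hb hu hv hn
      push_cast at hn
      refine good_of_children (ih hb.left hu ?_ ?_) (ih hb.right ?_ hv ?_) <;>
        rw [map_add] <;> omega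
  exact key (K - (f u + f v) + 1).toNat hb hu hv (by omega)

/-- Near a map satisfying the BQ-conditions, Markoff maps are uniformly proper. -/
theorem exists_nhds_finite (hα : 2 + alpha μ ≤ L) (hL : 2 < L) (hM : centerBound μ + 1 ≤ L)
    {φ₀ : MarkoffMap μ} (hφ : φ₀ ∈ bowditchMaps μ L) :
    ∃ U ∈ nhds φ₀, ∀ N : ℝ, {X : Region | ∃ φ ∈ U, ‖φ X‖ ≤ N}.Finite := by
  -- The functionals a + b and b − a are positive on the two cones that contain the positive and the
  -- negative slopes.
  obtain ⟨U, hU, h1⟩ := good_of_mem_bowditchMaps hα hL hM hφ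
    (AddMonoidHom.fst ℤ ℤ + AddMonoidHom.snd ℤ ℤ) isBasis_std (by simp) (by simp)
  obtain ⟨V, hV, h2⟩ := good_of_mem_bowditchMaps hα hL hM hφ
    (AddMonoidHom.snd ℤ ℤ - AddMonoidHom.fst ℤ ℤ) isBasis_rot (by simp) (by simp)
  refine ⟨U ∩ V, Filter.inter_mem hU hV, fun N => ?_⟩
  refine ((((h1 N).union (h2 N)).image reg).union
    (Set.toFinite {reg (1, 0), reg (0, 1)})).subset ?_
  rintro X ⟨φ, ⟨hφU, hφV⟩, hN⟩
  rcases region_cases X with rfl | rfl | ⟨w, hw, rfl⟩ | ⟨w, hw, rfl⟩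
  · exact .inr (by simp)
  · exact .inr (by simp)
  · exact .inl ⟨w, .inl ⟨hw, φ, hφU, hN⟩, rfl⟩
  · exact .inl ⟨w, .inr ⟨hw, φ, hφV, hN⟩, rfl⟩

/-! ### Openness, and uniform properness on compact sets. -/

theorem isClosed_realSegment : IsClosed realSegment :=
  (isCompact_Icc.image Complex.continuous_ofReal).isClosed

theorem isOpen_bowditchMaps (hα : 2 + alpha μ ≤ L) (hL : 2 < L) (hM : centerBound μ + 1 ≤ L) :
    IsOpen (bowditchMaps μ L) := by
  rw [isOpen_iff_mem_nhds]
  intro φ₀ hφ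
  obtain ⟨U, hU, hfin⟩ := exists_nhds_finite hα hL hM hφ
  have hF := hfin L
  -- [-2, 2] lies in the disc of radius L, so avoiding it is at stake only on a finite set of
  -- regions.
  have hV : {φ : MarkoffMap μ | ∀ X ∈ {X : Region | ∃ φ ∈ U, ‖φ X‖ ≤ L}, φ X ∉ realSegment}
      ∈ nhds φ₀ := by
    have := (Filter.biInter_mem hF (f := nhds φ₀)
      (s := fun X => {φ : MarkoffMap μ | φ X ∉ realSegment})).2 fun X _ =>
      (isClosed_realSegment.isOpen_compl.preimage (continuous_apply X)).mem_nhds (hφ.1 X)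
    refine Filter.mem_of_superset this fun φ hφ X hX => ?_
    exact Set.mem_iInter₂.1 hφ X hX
  filter_upwards [hU, hV] with φ hφU hφV
  refine ⟨fun X hX => ?_, hF.subset fun X hX => ⟨φ, hφU, hX⟩⟩
  refine hφV X ⟨φ, hφU, ?_⟩ hX
  obtain ⟨t, ht, hXt⟩ := hX
  rw [← hXt]
  simp only [Complex.norm_real, Real.norm_eq_abs]
  exact (abs_le.2 ht).trans hL.le

theorem finite_small_of_isCompact (hα : 2 + alpha μ ≤ L) (hL : 2 < L) (hM : centerBound μ + 1 ≤ L)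
    {K : Set (MarkoffMap μ)} (hK : IsCompact K) (hKL : K ⊆ bowditchMaps μ L) (N : ℝ) :
    {X : Region | ∃ φ ∈ K, ‖φ X‖ ≤ N}.Finite := by
  refine hK.induction_on (p := fun S => {X : Region | ∃ φ ∈ S, ‖φ X‖ ≤ N}.Finite) ?_ ?_ ?_ ?_
  · simp
  · intro S T hST h
    exact h.subset fun X ⟨φ, hφ, h⟩ => ⟨φ, hST hφ, h⟩
  · intro S T hS hT
    refine (hS.union hT).subset ?_
    rintro X ⟨φ, hφ | hφ, h⟩
    · exact .inl ⟨φ, hφ, h⟩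
    · exact .inr ⟨φ, hφ, h⟩
  · intro φ hφ
    obtain ⟨U, hU, h⟩ := exists_nhds_finite hα hL hM (hKL hφ)
    exact ⟨U, mem_nhdsWithin_of_mem_nhds hU, h N⟩

end

/-! ## The mapping class group acts faithfully on slopes -/

theorem twistAB_mem : twistAB ∈ modAut := Subgroup.subset_closure (.inl (.inl rfl))
theorem twistBC_mem : twistBC ∈ modAut := Subgroup.subset_closure (.inl (.inr (.inl rfl)))
theorem twistCA_mem : twistCA ∈ modAut := Subgroup.subset_closure (.inl (.inr (.inr rfl)))

/-- The mapping class of an automorphism. -/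
def mcg (f : modAut) : MCG := QuotientGroup.mk f

theorem mcg_mul (f g : modAut) : mcg (f * g) = mcg f * mcg g := rfl
theorem mcg_inv (f : modAut) : mcg f⁻¹ = (mcg f)⁻¹ := rfl

theorem mcg_surjective : Function.Surjective mcg := Quotient.mk_surjective

theorem mcg_smul (f : modAut) (X : Region) : mcg f • X = moebius (linearPart f) X := rfl

theorem mcg_eq_one_iff {f : modAut} : mcg f = 1 ↔ ∃ x, f.1 = MulAut.conj x := by
  rw [mcg, QuotientGroup.eq_one_iff, Subgroup.mem_subgroupOf]
  exact ⟨fun ⟨x, hx⟩ => ⟨x, hx.symm⟩, fun ⟨x, hx⟩ => ⟨x, hx.symm⟩⟩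

theorem mcg_eq_iff {f g : modAut} : mcg f = mcg g ↔ ∃ x, g.1 = f.1 * MulAut.conj x := by
  rw [← inv_mul_eq_one, ← mcg_inv, ← mcg_mul, mcg_eq_one_iff]
  simp [inv_mul_eq_iff_eq_mul]

def tAB : MCG := mcg ⟨twistAB, twistAB_mem⟩
def tBC : MCG := mcg ⟨twistBC, twistBC_mem⟩
def tCA : MCG := mcg ⟨twistCA, twistCA_mem⟩

theorem mkAut_gens (u v : Fin 3 → SurfaceGroup) (h₁ h₂) :
    mkAut u v h₁ h₂ gA = u 0 ∧ mkAut u v h₁ h₂ gB = u 1 ∧ mkAut u v h₁ h₂ gC = u 2 :=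
  ⟨mkAut_of u v h₁ h₂ 0, mkAut_of u v h₁ h₂ 1, mkAut_of u v h₁ h₂ 2⟩

theorem twistAB_gens : twistAB gA = gA ∧ twistAB gB = gB ∧
    twistAB gC = (gA * gB)⁻¹ * gC * (gA * gB) := mkAut_gens _ _ _ _

theorem twistBC_gens : twistBC gA = (gB * gC)⁻¹ * gA * (gB * gC) ∧ twistBC gB = gB ∧
    twistBC gC = gC := mkAut_gens _ _ _ _

theorem twistCA_gens : twistCA gA = gA ∧ twistCA gB = (gC * gA)⁻¹ * gB * (gC * gA) ∧
    twistCA gC = gC := mkAut_gens _ _ _ _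

/-- The lantern relation. -/
theorem lantern : twistAB * twistBC * twistCA = MulAut.conj (gC * gA * gB)⁻¹ := by
  obtain ⟨a1, a2, a3⟩ := twistAB_gens
  obtain ⟨b1, b2, b3⟩ := twistBC_gens
  obtain ⟨c1, c2, c3⟩ := twistCA_gens
  have key : (twistAB * twistBC * twistCA) gA = MulAut.conj (gC * gA * gB)⁻¹ gA ∧
      (twistAB * twistBC * twistCA) gB = MulAut.conj (gC * gA * gB)⁻¹ gB ∧
      (twistAB * twistBC * twistCA) gC = MulAut.conj (gC * gA * gB)⁻¹ gC := by
    refine ⟨?_, ?_, ?_⟩ <;> rw [MulAut.conj_apply] <;>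
      simp only [MulAut.mul_apply, map_mul, map_inv, a1, a2, a3, b1, b2, b3, c1, c2, c3] <;> group
  apply MulEquiv.toMonoidHom_injective
  ext i
  fin_cases i
  · exact key.1
  · exact key.2.1
  · exact key.2.2

theorem tAB_mul_tBC_mul_tCA : tAB * tBC * tCA = 1 :=
  mcg_eq_one_iff.2 ⟨_, lantern⟩

/-- The lantern relation expresses the third twist through the other two. -/
theorem lift_twists_surjective :
    Function.Surjective (FreeGroup.lift ![tAB, tBC] : FreeGroup (Fin 2) →* MCG) := by
  rw [← MonoidHom.range_eq_top, eq_top_iff]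
  have hA : tAB ∈ (FreeGroup.lift ![tAB, tBC]).range := ⟨FreeGroup.of 0, by simp⟩
  have hB : tBC ∈ (FreeGroup.lift ![tAB, tBC]).range := ⟨FreeGroup.of 1, by simp⟩
  rintro g -
  obtain ⟨⟨f, hf⟩, rfl⟩ := mcg_surjective g
  induction hf using Subgroup.closure_induction with
  | mem x hx =>
    rcases hx with (rfl | rfl | rfl) | ⟨y, rfl⟩
    · exact hA
    · exact hB
    · have : tCA = (tAB * tBC)⁻¹ := (eq_inv_of_mul_eq_one_right tAB_mul_tBC_mul_tCA)
      change tCA ∈ _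
      rw [this]
      exact inv_mem (mul_mem hA hB)
    · rw [mcg_eq_one_iff.2 ⟨y, rfl⟩]
      exact one_mem _
  | one => exact one_mem (FreeGroup.lift ![tAB, tBC]).range
  | mul x y hx hy ihx ihy => exact mul_mem ihx ihy
  | inv x hx ih => exact inv_mem ih

/-! ### Explicit action of the twists on slopes. -/

theorem moebius_reg (A : SL(2, ℤ)) {w : ℤ × ℤ} (hw : IsCoprime w.1 w.2) :
    moebius A (reg w) = reg (A.1 0 0 * w.1 + A.1 0 1 * w.2, A.1 1 0 * w.1 + A.1 1 1 * w.2) := by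
  obtain ⟨e, he, h1, h2⟩ := num_den_moebius A (reg w)
  obtain ⟨e', he', h1', h2'⟩ := num_den_reg hw
  rw [← reg_num_den (moebius A (reg w)), h1, h2, h1', h2']
  rcases he with rfl | rfl <;> rcases he' with rfl | rfl
  · congr 1; ext <;> ring
  · rw [← reg_neg]; congr 1; ext <;> simp <;> ring
  · rw [← reg_neg]; congr 1; ext <;> simp
  · congr 1; ext <;> ring

theorem linearPart_eq {f : modAut} {A : SL(2, ℤ)} (h : HasLinearPart f.1 A) : linearPart f = A :=
  (linearPart_spec f).unique h

theorem smul_reg_of_hasLinearPart {f : modAut} {A : SL(2, ℤ)} (h : HasLinearPart f.1 A)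
    {w : ℤ × ℤ} (hw : IsCoprime w.1 w.2) : mcg f • reg w =
      reg (A.1 0 0 * w.1 + A.1 0 1 * w.2, A.1 1 0 * w.1 + A.1 1 1 * w.2) := by
  rw [mcg_smul, linearPart_eq h, moebius_reg _ hw]

theorem tAB_smul_reg {a b : ℤ} (h : IsCoprime a b) : tAB • reg (a, b) = reg (a, b - 2 * a) := by
  refine (smul_reg_of_hasLinearPart (f := ⟨twistAB, twistAB_mem⟩) hasLinearPart_twistAB h).trans ?_
  congr 1; ext <;> simp; ring

theorem tBC_smul_reg {a b : ℤ} (h : IsCoprime a b) : tBC • reg (a, b) = reg (a + 2 * b, b) := by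
  refine (smul_reg_of_hasLinearPart (f := ⟨twistBC, twistBC_mem⟩) hasLinearPart_twistBC h).trans ?_
  congr 1; ext <;> simp

theorem tCA_smul_reg {a b : ℤ} (h : IsCoprime a b) :
    tCA • reg (a, b) = reg (3 * a + 2 * b, -2 * a - b) := by
  refine (smul_reg_of_hasLinearPart (f := ⟨twistCA, twistCA_mem⟩) hasLinearPart_twistCA h).trans ?_
  congr 1; ext <;> simp; ring

theorem tAB_inv_smul_reg {a b : ℤ} (h : IsCoprime a b) :
    tAB⁻¹ • reg (a, b) = reg (a, b + 2 * a) := by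
  have h' : IsCoprime a (b + 2 * a) := by
    rw [mul_comm]; exact h.add_mul_left_right 2
  rw [inv_smul_eq_iff, tAB_smul_reg h']
  simp

theorem tBC_inv_smul_reg {a b : ℤ} (h : IsCoprime a b) :
    tBC⁻¹ • reg (a, b) = reg (a - 2 * b, b) := by
  have h' : IsCoprime (a - 2 * b) b := by
    have := h.add_mul_left_left (-2)
    rwa [show a + b * (-2) = a - 2 * b by ring] at this
  rw [inv_smul_eq_iff, tBC_smul_reg h']
  simp

theorem reg_ofRat (q : ℚ) : (q : Region) = reg (q.num, q.den) := (reg_num_den (q : Region)).symm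

theorem tBC_smul_coe (q : ℚ) : tBC • (q : Region) = ((q + 2 : ℚ) : Region) := by
  have hd : (q.den : ℚ) ≠ 0 := by exact_mod_cast q.den_nz
  have hc : IsCoprime q.num (q.den : ℤ) := isCoprime_num_den (q : Region)
  rw [reg_ofRat, tBC_smul_reg hc, reg, if_neg (by simp)]
  congr 1
  push_cast
  rw [add_div, mul_div_assoc, div_self hd, Rat.num_div_den, mul_one]

theorem tBC_smul_infty : tBC • (OnePoint.infty : Region) = OnePoint.infty := by
  rw [← reg_one_zero, tBC_smul_reg isCoprime_one_left]; simp

theorem tBC_inv_smul_coe (q : ℚ) : tBC⁻¹ • (q : Region) = ((q - 2 : ℚ) : Region) := by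
  rw [inv_smul_eq_iff, tBC_smul_coe, sub_add_cancel]

theorem tAB_smul_coe (q : ℚ) (h : 1 - 2 * q ≠ 0) :
    tAB • (q : Region) = ((q / (1 - 2 * q) : ℚ) : Region) := by
  have hd : (q.den : ℚ) ≠ 0 := by exact_mod_cast q.den_nz
  have hden : (((q.den : ℤ) - 2 * q.num : ℤ) : ℚ) = q.den * (1 - 2 * q) := by
    push_cast
    rw [← Rat.mul_den_eq_num q]; ring
  have hc : IsCoprime q.num (q.den : ℤ) := isCoprime_num_den (q : Region)
  rw [reg_ofRat, tAB_smul_reg hc, reg]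
  simp only [hden]
  rw [if_neg (mul_ne_zero hd h), ← Rat.mul_den_eq_num q, mul_comm, mul_div_mul_left _ _ hd]

theorem tAB_inv_smul_coe (q : ℚ) (h : 1 + 2 * q ≠ 0) :
    tAB⁻¹ • (q : Region) = ((q / (1 + 2 * q) : ℚ) : Region) := by
  have e : 1 - 2 * (q / (1 + 2 * q)) = (1 + 2 * q)⁻¹ := by field_simp; ring
  rw [inv_smul_eq_iff, tAB_smul_coe]
  · congr 1
    rw [e, div_inv_eq_mul, div_mul_cancel₀ _ h]
  · rw [e]; exact inv_ne_zero h

theorem tAB_smul_infty : tAB • (OnePoint.infty : Region) = ((-1 / 2 : ℚ) : Region) := by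
  rw [← reg_one_zero, tAB_smul_reg isCoprime_one_left]
  simp [reg]
  norm_num

theorem tAB_inv_smul_infty : tAB⁻¹ • (OnePoint.infty : Region) = ((1 / 2 : ℚ) : Region) := by
  rw [← reg_one_zero, tAB_inv_smul_reg isCoprime_one_left]
  simp [reg]

/-! ### Ping-pong for two twists. -/

/-- The rational slopes with a given property. -/
def slopeSet (P : ℚ → Prop) : Set Region := {X | ∃ q : ℚ, P q ∧ X = q}

theorem coe_mem_slopeSet (P : ℚ → Prop) (q : ℚ) : (q : Region) ∈ slopeSet P ↔ P q :=
  ⟨fun ⟨q', h, e⟩ => by rwa [OnePoint.coe_injective e], fun h => ⟨q, h, rfl⟩⟩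

theorem infty_notMem_slopeSet (P : ℚ → Prop) : OnePoint.infty ∉ slopeSet P :=
  fun ⟨q, _, e⟩ => OnePoint.infty_ne_coe q e

theorem tAB_smul_mem {X : Region} (hX : X ∉ slopeSet fun q => 0 < q ∧ q < 1) :
    tAB • X ∈ slopeSet fun q => -1 ≤ q ∧ q ≤ 0 := by
  induction X using OnePoint.rec with
  | infty =>
    rw [tAB_smul_infty, coe_mem_slopeSet]
    norm_num
  | coe q =>
    rw [coe_mem_slopeSet] at hX
    by_cases h : q ≤ 0
    · have h1 : 0 < 1 - 2 * q := by linarith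
      rw [tAB_smul_coe q h1.ne', coe_mem_slopeSet, le_div_iff₀ h1]
      exact ⟨by linarith, div_nonpos_of_nonpos_of_nonneg h h1.le⟩
    · have h0 : 1 ≤ q := by by_contra! hlt; exact hX ⟨by linarith, hlt⟩
      have h1 : 1 - 2 * q < 0 := by linarith
      rw [tAB_smul_coe q h1.ne, coe_mem_slopeSet, le_div_iff_of_neg h1]
      exact ⟨by linarith, div_nonpos_of_nonneg_of_nonpos (by linarith) h1.le⟩

theorem tAB_inv_smul_mem {X : Region} (hX : X ∉ slopeSet fun q => -1 ≤ q ∧ q ≤ 0) :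
    tAB⁻¹ • X ∈ slopeSet fun q => 0 < q ∧ q < 1 := by
  induction X using OnePoint.rec with
  | infty =>
    rw [tAB_inv_smul_infty, coe_mem_slopeSet]
    norm_num
  | coe q =>
    rw [coe_mem_slopeSet] at hX
    by_cases h : 0 < q
    · have h1 : 0 < 1 + 2 * q := by linarith
      rw [tAB_inv_smul_coe q h1.ne', coe_mem_slopeSet, div_lt_one h1]
      exact ⟨div_pos h h1, by linarith⟩
    · have h0 : q < -1 := by by_contra! hlt; exact hX ⟨hlt, by linarith⟩
      have h1 : 1 + 2 * q < 0 := by linarith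
      rw [tAB_inv_smul_coe q h1.ne, coe_mem_slopeSet, div_lt_one_of_neg h1]
      exact ⟨div_pos_of_neg_of_neg (by linarith) h1, by linarith⟩

theorem tBC_smul_mem {X : Region} (hX : X ∉ slopeSet fun q => q < -1) :
    tBC • X ∈ slopeSet (fun q => 1 ≤ q) ∪ {OnePoint.infty} := by
  induction X using OnePoint.rec with
  | infty => exact .inr tBC_smul_infty
  | coe q =>
    rw [coe_mem_slopeSet, not_lt] at hX
    rw [tBC_smul_coe]
    exact .inl ((coe_mem_slopeSet _ _).2 (by linarith))

theorem tBC_inv_smul_mem {X : Region} (hX : X ∉ slopeSet (fun q => 1 ≤ q) ∪ {OnePoint.infty}) :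
    tBC⁻¹ • X ∈ slopeSet fun q => q < -1 := by
  induction X using OnePoint.rec with
  | infty => exact absurd (.inr rfl) hX
  | coe q =>
    have hq : q < 1 := by
      by_contra! hle
      exact hX (.inl ((coe_mem_slopeSet _ _).2 hle))
    rw [tBC_inv_smul_coe, coe_mem_slopeSet]
    linarith

/-- Ping-pong on the partition of ℚ ∪ {∞} into [-1, 0], (0, 1), [1, ∞] and (-∞, -1): the two twists
attract into the first and third sets, their inverses into the second and fourth. -/
theorem slopeHom_lift_injective :
    Function.Injective (FreeGroup.lift ![slopeHom tAB, slopeHom tBC] :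
      FreeGroup (Fin 2) →* Equiv.Perm Region) := by
  have inv_smul_def : ∀ (g : MCG) (X : Region), (slopeHom g)⁻¹ • X = g⁻¹ • X := fun g X => by
    rw [← map_inv]; rfl
  let S : Fin 2 → Set Region := ![slopeSet fun q => -1 ≤ q ∧ q ≤ 0,
    slopeSet (fun q => 1 ≤ q) ∪ {OnePoint.infty}]
  let T : Fin 2 → Set Region := ![slopeSet fun q => 0 < q ∧ q < 1, slopeSet fun q => q < -1]
  refine FreeGroup.injective_lift_of_ping_pong _ S T ?_ ?_ ?_ ?_ ?_ ?_
  · intro i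
    fin_cases i
    · exact ⟨((0 : ℚ) : Region), 0, by norm_num, rfl⟩
    · exact ⟨OnePoint.infty, .inr rfl⟩
  · intro i j hij
    refine Set.disjoint_left.2 fun X => ?_
    induction X using OnePoint.rec with
    | infty => fin_cases i <;> fin_cases j <;> simp [S, infty_notMem_slopeSet] at hij ⊢
    | coe q =>
      fin_cases i <;> fin_cases j <;> simp [S, coe_mem_slopeSet] at hij ⊢ <;> intros <;> linarith
  · intro i j hij
    refine Set.disjoint_left.2 fun X => ?_
    induction X using OnePoint.rec with
    | infty => fin_cases i <;> fin_cases j <;> simp [T, infty_notMem_slopeSet] at hij ⊢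
    | coe q =>
      fin_cases i <;> fin_cases j <;> simp [T, coe_mem_slopeSet] at hij ⊢ <;> intros <;> linarith
  · intro i j
    refine Set.disjoint_left.2 fun X => ?_
    induction X using OnePoint.rec with
    | infty => fin_cases i <;> fin_cases j <;> simp [S, T, infty_notMem_slopeSet]
    | coe q =>
      fin_cases i <;> fin_cases j <;> simp [S, T, coe_mem_slopeSet] <;> intros <;> linarith
  · rintro i _ ⟨X, hX, rfl⟩
    fin_cases i
    · exact tAB_smul_mem hX
    · exact tBC_smul_mem hX
  · rintro i _ ⟨X, hX, rfl⟩
    fin_cases i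
    · have := tAB_inv_smul_mem hX
      rwa [← inv_smul_def] at this
    · have := tBC_inv_smul_mem hX
      rwa [← inv_smul_def] at this

/-- A word in the two generating twists that acts trivially on slopes is already the trivial word.
-/
theorem slopeHom_injective : Function.Injective slopeHom := by
  rw [injective_iff_map_eq_one]
  intro g hg
  obtain ⟨w, rfl⟩ := lift_twists_surjective g
  have e : slopeHom.comp (FreeGroup.lift ![tAB, tBC])
      = FreeGroup.lift ![slopeHom tAB, slopeHom tBC] := by
    ext1 i; fin_cases i <;> simp
  have : FreeGroup.lift ![slopeHom tAB, slopeHom tBC] w = 1 := by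
    rw [← e]; exact hg
  rw [(injective_iff_map_eq_one _).1 slopeHom_lift_injective w this, map_one]

/-- A mapping class that fixes two adjacent slopes is trivial. -/
theorem eq_one_of_smul_eq {g : MCG} {u v : ℤ × ℤ} (hb : IsBasis u v) (hu : g • reg u = reg u)
    (hv : g • reg v = reg v) : g = 1 := by
  apply slopeHom_injective
  rw [map_one]
  obtain ⟨f, rfl⟩ := mcg_surjective g
  change moebius (linearPart f) = 1
  rw [mcg_smul] at hu hv
  generalize linearPart f = A at *
  have hdet : A.1 0 0 * A.1 1 1 - A.1 0 1 * A.1 1 0 = 1 := by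
    rw [← Matrix.det_fin_two]; exact A.2
  have hcop : ∀ {w : ℤ × ℤ}, IsCoprime w.1 w.2 →
      IsCoprime (A.1 0 0 * w.1 + A.1 0 1 * w.2) (A.1 1 0 * w.1 + A.1 1 1 * w.2) := by
    rintro w ⟨x, y, h⟩
    refine ⟨x * A.1 1 1 - y * A.1 1 0, y * A.1 0 0 - x * A.1 0 1, ?_⟩
    linear_combination (x * w.1 + y * w.2) * hdet + h
  have sgn : ∀ {w : ℤ × ℤ}, IsCoprime w.1 w.2 → moebius A (reg w) = reg w →
      ∃ e : ℤ, (e = 1 ∨ e = -1) ∧ A.1 0 0 * w.1 + A.1 0 1 * w.2 = e * w.1 ∧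
        A.1 1 0 * w.1 + A.1 1 1 * w.2 = e * w.2 := by
    intro w hw h
    rw [moebius_reg A hw] at h
    rcases eq_or_eq_neg_of_reg_eq (hcop hw) hw h with e | e
    · exact ⟨1, .inl rfl, by simpa using congrArg Prod.fst e, by simpa using congrArg Prod.snd e⟩
    · exact ⟨-1, .inr rfl, by simpa using congrArg Prod.fst e, by simpa using congrArg Prod.snd e⟩
  obtain ⟨e, he, h1, h2⟩ := sgn hb.coprime hu
  obtain ⟨e', he', h1', h2'⟩ := sgn hb.symm.coprime hv
  set D := u.1 * v.2 - v.1 * u.2 with hD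
  have hD0 : D ≠ 0 := by rcases hb.det with h | h <;> rw [← hD] at h <;> rw [h] <;> norm_num
  -- A preserves the determinant of (u, v), but scales these vectors by e and e'. Equal signs make A
  -- = ±1.
  have hee : e * e' = 1 := by
    have : (e * e' - 1) * D = 0 := by
      rw [hD]
      linear_combination (-e' * v.2) * h1 + (e' * v.1) * h2
        - (A.1 0 0 * u.1 + A.1 0 1 * u.2) * h2' + (A.1 1 0 * u.1 + A.1 1 1 * u.2) * h1'
        + (u.1 * v.2 - v.1 * u.2) * hdet
    rcases mul_eq_zero.1 this with h | h
    · linarith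
    · exact absurd h hD0
  have hee' : e' = e := by
    rcases he with rfl | rfl <;> rcases he' with rfl | rfl <;> simp at hee ⊢
  subst hee'
  have c00 : A.1 0 0 = e' := mul_right_cancel₀ hD0 (by
    rw [hD]; linear_combination v.2 * h1 - u.2 * h1')
  have c01 : A.1 0 1 = 0 := mul_right_cancel₀ hD0 (by
    rw [hD]; linear_combination u.1 * h1' - v.1 * h1)
  have c10 : A.1 1 0 = 0 := mul_right_cancel₀ hD0 (by
    rw [hD]; linear_combination v.2 * h2 - u.2 * h2')
  have c11 : A.1 1 1 = e' := mul_right_cancel₀ hD0 (by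
    rw [hD]; linear_combination u.1 * h2' - v.1 * h2)
  rcases he with rfl | rfl
  · have : A = 1 := by
      ext i j
      fin_cases i <;> fin_cases j <;> simp [c00, c01, c10, c11]
    rw [this, map_one]
  · have : A = -1 := by
      ext i j
      fin_cases i <;> fin_cases j <;> simp [c00, c01, c10, c11]
    rw [this, moebius_neg_one]

/-! ## Orbits and stabilisers of slopes -/

/-- Lattice vectors of the slopes `0`, `∞`, `-1`. -/
def baseVec : Fin 3 → ℤ × ℤ := ![(0, -1), (1, 0), (1, -1)]

/-- Vectors completing `baseVec` to a basis of the lattice. -/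
def baseCompl : Fin 3 → ℤ × ℤ := ![(1, 0), (0, 1), (1, 0)]

/-- The slopes `0`, `∞`, `-1`. -/
def baseSlope (i : Fin 3) : Region := reg (baseVec i)

/-- The Dehn twists along `αβ`, `βγ`, `αγ`. -/
def twistAut : Fin 3 → modAut :=
  ![⟨twistAB, twistAB_mem⟩, ⟨twistBC, twistBC_mem⟩, ⟨twistCA, twistCA_mem⟩]

theorem isBasis_base (i : Fin 3) : IsBasis (baseVec i) (baseCompl i) := by
  fin_cases i <;> simp [IsBasis, baseVec, baseCompl]

theorem IsBasis.add_zsmul {u v : ℤ × ℤ} (h : IsBasis u v) (n : ℤ) : IsBasis u (v + n • u) := by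
  rw [IsBasis] at *
  rw [← h]; congr 1
  simp only [Prod.fst_add, Prod.snd_add, Prod.smul_fst, Prod.smul_snd, smul_eq_mul]; ring

theorem color_baseSlope (i : Fin 3) : color (baseSlope i) = i := by
  rw [baseSlope, color_reg (isBasis_base i).coprime]
  fin_cases i <;> simp [baseVec]

theorem baseSlope_eq (i j : Fin 3) (h : i ≠ j) :
    ∃ n : ℤ, baseSlope j = reg (baseCompl i + n • baseVec i) := by
  fin_cases i <;> fin_cases j <;> simp [baseSlope, baseVec, baseCompl] at h ⊢
  · exact ⟨0, by simp⟩
  · exact ⟨1, by simp⟩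
  · exact ⟨0, by rw [← reg_neg]; simp⟩
  · exact ⟨-1, by rw [← reg_neg]; simp⟩
  · exact ⟨-1, by rw [← reg_neg]; simp⟩
  · exact ⟨0, by simp⟩

theorem twist_smul_base (i : Fin 3) : mcg (twistAut i) • baseSlope i = baseSlope i := by
  fin_cases i
  · refine (tAB_smul_reg (isBasis_base 0).coprime).trans ?_
    simp [baseSlope, baseVec]
  · refine (tBC_smul_reg (isBasis_base 1).coprime).trans ?_
    simp [baseSlope, baseVec]
  · refine (tCA_smul_reg (isBasis_base 2).coprime).trans ?_
    simp [baseSlope, baseVec]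

/-- The signs in `baseVec` and `baseCompl` are arranged so that all three twists shift by +2. -/
theorem twist_smul_add (i : Fin 3) (n : ℤ) :
    mcg (twistAut i) • reg (baseCompl i + n • baseVec i)
      = reg (baseCompl i + (n + 2) • baseVec i) := by
  have hc := ((isBasis_base i).add_zsmul n).symm.coprime
  fin_cases i
  · refine (tAB_smul_reg hc).trans ?_
    congr 1; ext <;> simp [baseVec, baseCompl]; ring
  · refine (tBC_smul_reg hc).trans ?_
    congr 1; ext <;> simp [baseVec, baseCompl]
  · refine (tCA_smul_reg hc).trans ?_
    congr 1; ext <;> simp [baseVec, baseCompl] <;> ring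

theorem twist_zpow_smul_base (i : Fin 3) (k : ℤ) :
    mcg (twistAut i) ^ k • baseSlope i = baseSlope i :=
  (MulAction.mem_stabilizer_iff.1
    (zpow_mem (MulAction.mem_stabilizer_iff.2 (twist_smul_base i)) k))

theorem twist_zpow_smul_add (i : Fin 3) (k n : ℤ) :
    mcg (twistAut i) ^ k • reg (baseCompl i + n • baseVec i)
      = reg (baseCompl i + (n + 2 * k) • baseVec i) := by
  induction k using Int.induction_on with
  | zero => simp
  | succ k ih =>
    rw [add_comm, zpow_add, zpow_one, mul_smul, ih, twist_smul_add]
    congr 3; ring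
  | pred k ih =>
    rw [sub_eq_add_neg, add_comm, zpow_add, zpow_neg_one, mul_smul, ih, inv_smul_eq_iff,
      twist_smul_add]
    congr 3; ring

theorem exists_zsmul_of_det_eq_zero {u d : ℤ × ℤ} (hu : IsCoprime u.1 u.2)
    (h : u.1 * d.2 - d.1 * u.2 = 0) : ∃ n : ℤ, d = n • u := by
  obtain ⟨x, y, hxy⟩ := hu
  refine ⟨x * d.1 + y * d.2, ?_⟩
  ext
  · simp only [Prod.smul_fst, smul_eq_mul]
    linear_combination (-y) * h - d.1 * hxy
  · simp only [Prod.smul_snd, smul_eq_mul]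
    linear_combination x * h - d.2 * hxy

theorem exists_eq_reg_add_zsmul {u v : ℤ × ℤ} (h : IsBasis u v) {Y : Region}
    (hY : Adj (reg u) Y) : ∃ n : ℤ, Y = reg (v + n • u) := by
  have hw : IsBasis u (num Y, den Y) := by
    obtain ⟨e, he, h1, h2⟩ := num_den_reg h.coprime
    rw [Adj, h1, h2] at hY
    rw [IsBasis, ← hY]
    rcases he with rfl | rfl
    · simp
    · rw [← abs_neg]; congr 1; ring
  have key : ∀ w : ℤ × ℤ, reg w = Y → u.1 * v.2 - v.1 * u.2 = u.1 * w.2 - w.1 * u.2 →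
      ∃ n : ℤ, Y = reg (v + n • u) := by
    rintro w rfl hw
    obtain ⟨n, hn⟩ := exists_zsmul_of_det_eq_zero (d := w - v) h.coprime (by
      simp only [Prod.fst_sub, Prod.snd_sub]; linear_combination -hw)
    exact ⟨n, by rw [← hn]; simp⟩
  by_cases hs : u.1 * v.2 - v.1 * u.2 = u.1 * den Y - num Y * u.2
  · exact key _ (reg_num_den Y) hs
  · refine key (-(num Y, den Y)) (by rw [reg_neg, reg_num_den]) ?_
    simp only [Prod.fst_neg, Prod.snd_neg]
    rcases h.det with h | h <;> rcases hw.det with hw | hw <;> simp only at hw <;> rw [h] at hs ⊢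
    · exact absurd hw.symm hs
    · linarith
    · linarith
    · exact absurd hw.symm hs

/-- The neighbours of a base slope form a sequence indexed by ℤ, the colour records the parity of
the index, and the twist shifts the index by two. -/
theorem exists_zpow_smul_eq (i : Fin 3) {Y : Region} (n₀ : ℤ) (h : Adj (baseSlope i) Y)
    (hc : color Y = color (reg (baseCompl i + n₀ • baseVec i))) :
    ∃ k : ℤ, mcg (twistAut i) ^ k • Y = reg (baseCompl i + n₀ • baseVec i) := by
  obtain ⟨n, rfl⟩ := exists_eq_reg_add_zsmul (isBasis_base i) h
  rcases Int.even_or_odd' (n - n₀) with ⟨k, hk | hk⟩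
  · refine ⟨-k, ?_⟩
    rw [twist_zpow_smul_add]
    congr 3; linarith
  · exfalso
    have e : mcg (twistAut i) ^ (-k) • reg (baseCompl i + n • baseVec i)
        = reg (baseCompl i + n₀ • baseVec i + baseVec i) := by
      rw [twist_zpow_smul_add, show n + 2 * -k = n₀ + 1 by linarith, add_smul, one_smul, add_assoc]
    rw [← color_smul (mcg (twistAut i) ^ (-k)), e] at hc
    exact color_ne_of_adj ((isBasis_base i).add_zsmul n₀).symm.left.adj hc.symm

/-- A power of the twist brings a neighbour moved by g back to its place; then two adjacent slopes
are fixed. -/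
theorem exists_zpow_of_smul_eq {i : Fin 3} {g : MCG} (h : g • baseSlope i = baseSlope i) :
    ∃ k : ℤ, g = mcg (twistAut i) ^ k := by
  have hadj : Adj (baseSlope i) (g • reg (baseCompl i)) := by
    rw [← h, adj_smul]
    exact (isBasis_base i).adj
  obtain ⟨k, hk⟩ := exists_zpow_smul_eq i 0 hadj (by rw [color_smul]; simp)
  refine ⟨-k, ?_⟩
  rw [zpow_neg]
  refine eq_inv_of_mul_eq_one_right ?_
  refine eq_one_of_smul_eq (isBasis_base i) ?_ ?_
  · change (mcg (twistAut i) ^ k * g) • baseSlope i = baseSlope i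
    rw [mul_smul, h, twist_zpow_smul_base]
  · rw [mul_smul, hk]; simp

/-- Euclidean algorithm with even quotients: a twist lowers |a| + |b| unless a = 0, b = 0 or |a| =
|b|. -/
theorem exists_smul_eq_baseSlope (X : Region) : ∃ g : MCG, g • X = baseSlope (color X) := by
  suffices h : ∀ (n : ℕ) (a b : ℤ), IsCoprime a b → a.natAbs + b.natAbs = n →
      ∃ g : MCG, ∃ i, g • reg (a, b) = baseSlope i by
    obtain ⟨g, i, hg⟩ := h _ _ _ (isCoprime_num_den X) rfl
    rw [reg_num_den] at hg
    have : color X = i := by rw [← color_smul g, hg, color_baseSlope]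
    exact ⟨g, this ▸ hg⟩
  intro n
  induction n using Nat.strong_induction_on with
  | _ n ih =>
    intro a b hab hn
    have step : ∀ (t : MCG) (a' b' : ℤ), t • reg (a, b) = reg (a', b') → IsCoprime a' b' →
        a'.natAbs + b'.natAbs < n → ∃ g : MCG, ∃ i, g • reg (a, b) = baseSlope i := by
      intro t a' b' ht hc hlt
      obtain ⟨g, i, hg⟩ := ih _ hlt a' b' hc rfl
      exact ⟨g * t, i, by rw [mul_smul, ht, hg]⟩
    by_cases ha : a = 0
    · subst ha
      refine ⟨1, 0, ?_⟩
      rw [one_smul, baseSlope]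
      rcases Int.isUnit_iff.1 (isCoprime_zero_left.1 hab) with rfl | rfl
      · rw [← reg_neg]; simp [baseVec]
      · simp [baseVec]
    by_cases hb : b = 0
    · subst hb
      refine ⟨1, 1, ?_⟩
      rw [one_smul, baseSlope]
      rcases Int.isUnit_iff.1 (isCoprime_zero_right.1 hab) with rfl | rfl
      · simp [baseVec]
      · rw [← reg_neg]; simp [baseVec]
    have c1 : IsCoprime (a + 2 * b) b := by
      simpa [mul_comm] using hab.add_mul_left_left 2
    have c2 : IsCoprime (a - 2 * b) b := by
      have := hab.add_mul_left_left (-2)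
      rwa [show a + b * (-2) = a - 2 * b by ring] at this
    have c3 : IsCoprime a (b + 2 * a) := by
      simpa [mul_comm] using hab.add_mul_left_right 2
    have c4 : IsCoprime a (b - 2 * a) := by
      have := hab.add_mul_left_right (-2)
      rwa [show b + a * (-2) = b - 2 * a by ring] at this
    rcases lt_trichotomy a.natAbs b.natAbs with h | h | h
    · by_cases hs : (b + 2 * a).natAbs < b.natAbs
      · exact step _ _ _ (tAB_inv_smul_reg hab) c3 (by omega)
      · exact step _ _ _ (tAB_smul_reg hab) c4 (by omega)
    · rcases Int.natAbs_eq_natAbs_iff.1 h with rfl | rfl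
      · refine ⟨tBC⁻¹, 2, ?_⟩
        rw [tBC_inv_smul_reg hab, baseSlope]
        rcases Int.isUnit_iff.1 (isCoprime_self.1 hab) with rfl | rfl
        · rw [← reg_neg]; simp [baseVec]
        · simp [baseVec]
      · refine ⟨1, 2, ?_⟩
        rw [one_smul, baseSlope]
        rcases Int.isUnit_iff.1 (isCoprime_self.1 ((IsCoprime.neg_left_iff _ _).1 hab))
          with rfl | rfl
        · rw [← reg_neg]; simp [baseVec]
        · simp [baseVec]
    · by_cases hs : (a + 2 * b).natAbs < a.natAbs
      · exact step _ _ _ (tBC_smul_reg hab) c1 (by omega)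
      · exact step _ _ _ (tBC_inv_smul_reg hab) c2 (by omega)

theorem exists_smul_pair_eq {X Y : Region} (h : Adj X Y) :
    ∃ g : MCG, g • X = baseSlope (color X) ∧ g • Y = baseSlope (color Y) := by
  obtain ⟨g, hg⟩ := exists_smul_eq_baseSlope X
  obtain ⟨n, hn⟩ := baseSlope_eq _ _ (color_ne_of_adj h)
  have hadj : Adj (baseSlope (color X)) (g • Y) := by rw [← hg, adj_smul]; exact h
  obtain ⟨k, hk⟩ := exists_zpow_smul_eq _ n hadj (by rw [color_smul, ← hn, color_baseSlope])
  refine ⟨mcg (twistAut (color X)) ^ k * g, ?_, ?_⟩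
  · rw [mul_smul, hg, twist_zpow_smul_base]
  · rw [mul_smul, hk, hn]

/-! ## Simple closed curves and their slopes -/

/-- The curves `αβ`, `βγ`, `αγ`. -/
def baseCurve : Fin 3 → SurfaceGroup := ![gA * gB, gB * gC, gA * gC]

theorem curveSetoid_map (f : MulAut SurfaceGroup) {g h : SurfaceGroup} (H : curveSetoid.r g h) :
    curveSetoid.r (f g) (f h) := by
  rcases H with H | H
  · exact .inl ((f : SurfaceGroup →* SurfaceGroup).map_isConj H)
  · right
    have := (f : SurfaceGroup →* SurfaceGroup).map_isConj H
    rwa [map_inv] at this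

/-- The automorphisms that preserve the free homotopy class of an unoriented curve. -/
def curveStab (c : SurfaceGroup) : Subgroup (MulAut SurfaceGroup) where
  carrier := {f | curveSetoid.r (f c) c}
  one_mem' := curveSetoid.refl c
  mul_mem' := fun {f g} hf hg => curveSetoid.trans (curveSetoid_map f hg) hf
  inv_mem' := fun {f} hf => by
    have := curveSetoid_map f⁻¹ hf
    rw [MulAut.inv_apply_self] at this
    exact curveSetoid.symm this

theorem conj_mem_curveStab (x c : SurfaceGroup) : MulAut.conj x ∈ curveStab c :=
  .inl (isConj_iff.2 ⟨x⁻¹, by simp [mul_assoc]⟩)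

theorem twistAut_mem_curveStab (i : Fin 3) : (twistAut i).1 ∈ curveStab (baseCurve i) := by
  obtain ⟨a1, a2, a3⟩ := twistAB_gens
  obtain ⟨b1, b2, b3⟩ := twistBC_gens
  obtain ⟨c1, c2, c3⟩ := twistCA_gens
  left
  fin_cases i
  · change IsConj (twistAB (gA * gB)) (gA * gB)
    rw [map_mul, a1, a2]
  · change IsConj (twistBC (gB * gC)) (gB * gC)
    rw [map_mul, b2, b3]
  · change IsConj (twistCA (gA * gC)) (gA * gC)
    rw [map_mul, c1, c3]

/-- The simple closed curve `g` has slope `X`. -/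
def HasSlope (g : SurfaceGroup) (X : Region) : Prop :=
  ∃ (f : modAut) (i : Fin 3), curveSetoid.r g (f.1 (baseCurve i)) ∧ mcg f • baseSlope i = X

theorem isSimple_iff {g : SurfaceGroup} : IsSimple g ↔ ∃ X, HasSlope g X := by
  constructor
  · rintro ⟨f, hf, g₀, rfl | rfl | rfl, h⟩
    · exact ⟨_, ⟨f, hf⟩, 0, h, rfl⟩
    · exact ⟨_, ⟨f, hf⟩, 1, h, rfl⟩
    · exact ⟨_, ⟨f, hf⟩, 2, h, rfl⟩
  · rintro ⟨_, ⟨f, hf⟩, i, h, rfl⟩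
    refine ⟨f, hf, baseCurve i, ?_, h⟩
    fin_cases i <;> simp [baseCurve]

theorem hasSlope_base (i : Fin 3) : HasSlope (baseCurve i) (baseSlope i) :=
  ⟨1, i, curveSetoid.refl _, one_smul MCG _⟩

theorem HasSlope.map {g : SurfaceGroup} {X : Region} (h : HasSlope g X) (f : modAut) :
    HasSlope (f.1 g) (mcg f • X) := by
  obtain ⟨f', i, hg, rfl⟩ := h
  exact ⟨f * f', i, curveSetoid_map f.1 hg, by rw [mcg_mul, mul_smul]⟩

theorem exists_hasSlope (X : Region) : ∃ g, HasSlope g X := by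
  obtain ⟨m, hm⟩ := exists_smul_eq_baseSlope X
  obtain ⟨f, hf⟩ := mcg_surjective m⁻¹
  refine ⟨_, f, color X, curveSetoid.refl _, ?_⟩
  rw [hf, inv_smul_eq_iff, hm]

/-- Two mapping classes carrying the base slope to X differ by a power of the twist about the base
curve, which fixes that curve. -/
theorem HasSlope.rel {g g' : SurfaceGroup} {X : Region} (h : HasSlope g X)
    (h' : HasSlope g' X) : curveSetoid.r g g' := by
  obtain ⟨f, i, hg, rfl⟩ := h
  obtain ⟨f', i', hg', he⟩ := h'
  have hi : i' = i := by
    have := congrArg color he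
    rwa [color_smul, color_smul, color_baseSlope, color_baseSlope] at this
  subst hi
  have hfix : mcg (f⁻¹ * f') • baseSlope i' = baseSlope i' := by
    rw [mcg_mul, mcg_inv, mul_smul, he, inv_smul_smul]
  obtain ⟨k, hk⟩ := exists_zpow_of_smul_eq hfix
  have hk' : mcg (twistAut i' ^ k) = mcg (f⁻¹ * f') :=
    (map_zpow (QuotientGroup.mk' (innerAut.subgroupOf modAut)) (twistAut i') k).trans hk.symm
  obtain ⟨x, hx⟩ := mcg_eq_iff.1 hk'
  have hmem : (f⁻¹ * f').1 ∈ curveStab (baseCurve i') := by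
    rw [hx]
    refine mul_mem ?_ (conj_mem_curveStab _ _)
    rw [SubgroupClass.coe_zpow]
    exact zpow_mem (twistAut_mem_curveStab i') k
  have := curveSetoid_map f.1 (hmem : curveSetoid.r _ _)
  rw [← MulAut.mul_apply, ← Subgroup.coe_mul, mul_inv_cancel_left] at this
  exact curveSetoid.trans hg (curveSetoid.trans (curveSetoid.symm this) (curveSetoid.symm hg'))

/-! ### Recovering the slope from the curve. -/

/-- The curve `g` acts on the plane as a translation in the direction of slope `X`. -/
def HasTranslation (g : SurfaceGroup) (X : Region) : Prop :=
  ∃ u : Fin 2 → ℤ, (∀ v, pillow g v = v + u) ∧ IsCoprime (u 0) (u 1) ∧ reg (u 0, u 1) = X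

theorem HasTranslation.unique {g : SurfaceGroup} {X Y : Region} (h : HasTranslation g X)
    (h' : HasTranslation g Y) : X = Y := by
  obtain ⟨u, hu, -, rfl⟩ := h
  obtain ⟨u', hu', -, rfl⟩ := h'
  have : u = u' := by simpa using (hu 0).symm.trans (hu' 0)
  rw [this]

theorem HasTranslation.map {g : SurfaceGroup} {X : Region} (h : HasTranslation g X)
    {f : MulAut SurfaceGroup} {A : SL(2, ℤ)} (hf : HasLinearPart f A) :
    HasTranslation (f g) (moebius A X) := by
  obtain ⟨u, hu, hc, rfl⟩ := h
  obtain ⟨-, -, t, ht⟩ := hf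
  have hdet : A.1 0 0 * A.1 1 1 - A.1 0 1 * A.1 1 0 = 1 := by
    rw [← Matrix.det_fin_two]; exact A.2
  refine ⟨A.1.mulVec u, fun x => ?_, ?_, ?_⟩
  · have := ht g ((A⁻¹).1.mulVec (x - t))
    rw [hu, Matrix.mulVec_add, Matrix.mulVec_mulVec, ← Matrix.SpecialLinearGroup.coe_mul,
      mul_inv_cancel] at this
    simp only [Matrix.SpecialLinearGroup.coe_one, Matrix.one_mulVec, sub_add_cancel] at this
    rw [this]; abel
  · obtain ⟨x, y, h⟩ := hc
    refine ⟨x * A.1 1 1 - y * A.1 1 0, y * A.1 0 0 - x * A.1 0 1, ?_⟩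
    simp only [Matrix.mulVec, dotProduct, Fin.sum_univ_two]
    linear_combination (x * u 0 + y * u 1) * hdet + h
  · rw [moebius_reg A hc]
    simp only [Matrix.mulVec, dotProduct, Fin.sum_univ_two]

theorem HasTranslation.inv {g : SurfaceGroup} {X : Region} (h : HasTranslation g X) :
    HasTranslation g⁻¹ X := by
  obtain ⟨u, hu, hc, rfl⟩ := h
  refine ⟨-u, fun v => ?_, hc.neg_neg, reg_neg (u 0, u 1)⟩
  rw [map_inv, Equiv.Perm.inv_eq_iff_eq, hu]
  abel

theorem HasTranslation.of_rel {g g' : SurfaceGroup} {X : Region} (h : HasTranslation g X)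
    (hr : curveSetoid.r g g') : HasTranslation g' X := by
  have key : ∀ {g' : SurfaceGroup}, IsConj g g' → HasTranslation g' X := by
    intro g' hg
    obtain ⟨c, rfl⟩ := isConj_iff.1 hg
    rw [← MulAut.conj_apply]
    rcases hasLinearPart_conj c with hc | hc
    · simpa using h.map hc
    · simpa [moebius_neg_one] using h.map hc
  rcases hr with hr | hr
  · exact key hr
  · simpa using (key hr).inv

theorem hasTranslation_base (i : Fin 3) : HasTranslation (baseCurve i) (baseSlope i) := by
  fin_cases i
  · refine ⟨![0, 1], fun v => ?_, ⟨0, 1, by simp⟩, ?_⟩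
    · funext j
      fin_cases j <;> simp [baseCurve, gA, gB, pillow, latticeCenter, Matrix.vecHead,
        Matrix.vecTail]
      ring
    · rw [← reg_neg]; simp [baseSlope, baseVec]
  · refine ⟨![-1, 0], fun v => ?_, ⟨-1, 0, by simp⟩, ?_⟩
    · funext j
      fin_cases j <;> simp [baseCurve, gC, gB, pillow, latticeCenter, Matrix.vecHead,
        Matrix.vecTail]
      ring
    · rw [← reg_neg]; simp [baseSlope, baseVec]
  · refine ⟨![-1, 1], fun v => ?_, ⟨0, 1, by simp⟩, ?_⟩
    · funext j
      fin_cases j <;> simp [baseCurve, gA, gC, pillow, latticeCenter, Matrix.vecHead,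
        Matrix.vecTail]
      all_goals ring
    · rw [← reg_neg]; simp [baseSlope, baseVec]

theorem HasSlope.hasTranslation {g : SurfaceGroup} {X : Region} (h : HasSlope g X) :
    HasTranslation g X := by
  obtain ⟨f, i, hg, rfl⟩ := h
  exact ((hasTranslation_base i).map (linearPart_spec f)).of_rel (curveSetoid.symm hg)

theorem HasSlope.eq_of_rel {g g' : SurfaceGroup} {X Y : Region} (h : HasSlope g X)
    (h' : HasSlope g' Y) (hr : curveSetoid.r g g') : X = Y :=
  (h.hasTranslation.of_rel hr).unique h'.hasTranslation

section

/-! ## Trace identities -/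

section Trace

variable (M N P : Matrix (Fin 2) (Fin 2) ℂ)

/-- Homogenised with determinants, so that it is a polynomial identity in the matrix entries;
likewise the adjugate replaces the inverse in the three identities below. -/
theorem trace_fricke :
    (M * N).trace ^ 2 * P.det + (N * P).trace ^ 2 * M.det + (M * P).trace ^ 2 * N.det
      + (M * N).trace * (N * P).trace * (M * P).trace
    = (M.trace * N.trace * P.det + P.trace * (M * N * P).trace) * (M * N).trace
      + (M.trace * (M * N * P).trace + N.trace * P.trace * M.det) * (N * P).trace
      + (M.trace * P.trace * N.det + N.trace * (M * N * P).trace) * (M * P).trace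
      + 4 * M.det * N.det * P.det - M.trace ^ 2 * N.det * P.det - N.trace ^ 2 * M.det * P.det
      - P.trace ^ 2 * M.det * N.det - (M * N * P).trace ^ 2
      - M.trace * N.trace * P.trace * (M * N * P).trace := by
  simp only [Matrix.trace_fin_two, Matrix.mul_apply, Fin.sum_univ_two, Matrix.det_fin_two]
  ring

theorem adjugate_entries : M.adjugate 0 0 = M 1 1 ∧ M.adjugate 0 1 = -M 0 1 ∧
    M.adjugate 1 0 = -M 1 0 ∧ M.adjugate 1 1 = M 0 0 := by
  simp [Matrix.adjugate_fin_two]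

theorem trace_adjugate_mul_AC :
    (N.adjugate * M * N * P).trace + N.det * (M * P).trace
      = N.det * M.trace * P.trace + N.trace * (M * N * P).trace
        - (M * N).trace * (N * P).trace := by
  obtain ⟨h1, h2, h3, h4⟩ := adjugate_entries N
  simp only [Matrix.trace_fin_two, Matrix.mul_apply, Fin.sum_univ_two, Matrix.det_fin_two, h1, h2,
    h3, h4]
  ring

theorem trace_adjugate_mul_AB :
    (N * P * M * P.adjugate).trace + P.det * (M * N).trace
      = P.det * M.trace * N.trace + P.trace * (M * N * P).trace
        - (N * P).trace * (M * P).trace := by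
  obtain ⟨h1, h2, h3, h4⟩ := adjugate_entries P
  simp only [Matrix.trace_fin_two, Matrix.mul_apply, Fin.sum_univ_two, Matrix.det_fin_two, h1, h2,
    h3, h4]
  ring

theorem trace_adjugate_mul_BC :
    (M.adjugate * P * M * N).trace + M.det * (N * P).trace
      = M.det * N.trace * P.trace + M.trace * (M * N * P).trace
        - (M * N).trace * (M * P).trace := by
  obtain ⟨h1, h2, h3, h4⟩ := adjugate_entries M
  simp only [Matrix.trace_fin_two, Matrix.mul_apply, Fin.sum_univ_two, Matrix.det_fin_two, h1, h2,
    h3, h4]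
  ring

end Trace

theorem trace_inv (M : SL(2, ℂ)) : (M⁻¹).1.trace = M.1.trace := by
  rw [Matrix.SpecialLinearGroup.coe_inv, Matrix.adjugate_fin_two, Matrix.trace_fin_two,
    Matrix.trace_fin_two]
  simp [add_comm]

variable {τ : BoundaryTraces}

theorem RelCharacter.apply_eq_of_rel (χ : RelCharacter τ) {g h : SurfaceGroup}
    (H : curveSetoid.r g h) : χ g = χ h := by
  rcases H with H | H
  · exact χ.apply_conj H
  · rw [χ.apply_conj H]
    obtain ⟨ρ, hρ⟩ := χ.exists_rep
    rw [hρ, hρ, map_inv, trace_inv]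

theorem RelCharacter.trace_relations (χ : RelCharacter τ) :
    (χ (gA * gB) ^ 2 + χ (gB * gC) ^ 2 + χ (gA * gC) ^ 2
      + χ (gA * gB) * χ (gB * gC) * χ (gA * gC)
      = (GT τ).p * χ (gA * gB) + (GT τ).q * χ (gB * gC) + (GT τ).r * χ (gA * gC) + (GT τ).s) ∧
    (χ (gB⁻¹ * gA * gB * gC) + χ (gA * gC) = (GT τ).r - χ (gA * gB) * χ (gB * gC)) ∧
    (χ (gB * gC * gA * gC⁻¹) + χ (gA * gB) = (GT τ).p - χ (gB * gC) * χ (gA * gC)) ∧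
    (χ (gA⁻¹ * gC * gA * gB) + χ (gB * gC) = (GT τ).q - χ (gA * gB) * χ (gA * gC)) := by
  obtain ⟨ρ, hρ⟩ := χ.exists_rep
  have ha : (ρ gA).1.trace = τ.a := by rw [← hρ, χ.trace_a]
  have hb : (ρ gB).1.trace = τ.b := by rw [← hρ, χ.trace_b]
  have hc : (ρ gC).1.trace = τ.c := by rw [← hρ, χ.trace_c]
  have hd : ((ρ gA).1 * (ρ gB).1 * (ρ gC).1).trace = τ.d := by
    rw [← χ.trace_d, hρ, gD, map_inv, trace_inv, map_mul, map_mul,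
      Matrix.SpecialLinearGroup.coe_mul, Matrix.SpecialLinearGroup.coe_mul]
  have dA := (ρ gA).2
  have dB := (ρ gB).2
  have dC := (ρ gC).2
  simp only [hρ, map_mul, map_inv, Matrix.SpecialLinearGroup.coe_mul,
    Matrix.SpecialLinearGroup.coe_inv, GT]
  have f1 := trace_fricke (ρ gA).1 (ρ gB).1 (ρ gC).1
  have f2 := trace_adjugate_mul_AC (ρ gA).1 (ρ gB).1 (ρ gC).1
  have f3 := trace_adjugate_mul_AB (ρ gA).1 (ρ gB).1 (ρ gC).1
  have f4 := trace_adjugate_mul_BC (ρ gA).1 (ρ gB).1 (ρ gC).1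
  rw [ha, hb, hc, hd, dA, dB, dC] at f1
  rw [ha, hb, hc, hd, dB] at f2
  rw [ha, hb, hc, hd, dC] at f3
  rw [ha, hb, hc, hd, dA] at f4
  exact ⟨by linear_combination f1, by linear_combination f2, by linear_combination f3,
    by linear_combination f4⟩

/-! ## The Markoff map of a character -/

/-- A curve of a given slope. -/
def curve (X : Region) : SurfaceGroup := (exists_hasSlope X).choose

theorem curve_spec (X : Region) : HasSlope (curve X) X := (exists_hasSlope X).choose_spec

/-- The trace of a character along the curve of a given slope. -/
def RelCharacter.slopeTrace (χ : RelCharacter τ) (X : Region) : ℂ := χ (curve X)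

theorem RelCharacter.slopeTrace_eq (χ : RelCharacter τ) {g : SurfaceGroup} {X : Region}
    (h : HasSlope g X) : χ.slopeTrace X = χ g :=
  χ.apply_eq_of_rel ((curve_spec X).rel h)

theorem RelCharacter.slopeTrace_smul (χ : RelCharacter τ) (m : MCG) (X : Region) :
    (m • χ).slopeTrace X = χ.slopeTrace (m⁻¹ • X) := by
  obtain ⟨f, rfl⟩ := mcg_surjective m
  have := χ.slopeTrace_eq ((curve_spec X).map f⁻¹)
  rw [mcg_inv] at this
  rw [this]
  rfl

theorem RelCharacter.slopeTrace_eq_smul (χ : RelCharacter τ) (m : MCG) (X : Region) :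
    χ.slopeTrace X = (m • χ).slopeTrace (m • X) := by
  rw [slopeTrace_smul, inv_smul_smul]

theorem hasSlope_twistBC : HasSlope (gB⁻¹ * gA * gB * gC) (reg (1, 1)) := by
  obtain ⟨b1, b2, b3⟩ := twistBC_gens
  refine ⟨twistAut 1, 2, .inl (isConj_iff.2 ⟨gC⁻¹, ?_⟩), ?_⟩
  · change _ = twistBC (gA * gC)
    rw [map_mul, b1, b3]
    group
  · refine (tBC_smul_reg (isBasis_base 2).coprime).trans ?_
    rw [← reg_neg]; simp [baseVec]

theorem hasSlope_twistBC_inv : HasSlope (gB * gC * gA * gC⁻¹) (reg (2, -1)) := by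
  obtain ⟨b1, b2, b3⟩ := twistBC_gens
  refine ⟨(twistAut 1)⁻¹, 0, .inl ?_, ?_⟩
  · have : (twistAut 1)⁻¹.1 (baseCurve 0) = gB * gC * gA * gC⁻¹ := by
      change twistBC.symm (gA * gB) = _
      rw [MulEquiv.symm_apply_eq]
      simp only [map_mul, map_inv, b1, b2, b3]
      group
    rw [this]
  · refine (tBC_inv_smul_reg (isBasis_base 0).coprime).trans ?_
    simp [baseVec]

theorem hasSlope_twistAB : HasSlope (gA⁻¹ * gC * gA * gB) (reg (1, -2)) := by
  obtain ⟨a1, a2, a3⟩ := twistAB_gens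
  refine ⟨twistAut 0, 1, .inl ?_, ?_⟩
  · have : (twistAut 0).1 (baseCurve 1) = gA⁻¹ * gC * gA * gB := by
      change twistAB (gB * gC) = _
      rw [map_mul, a2, a3]
      group
    rw [this]
  · refine (tAB_smul_reg (isBasis_base 1).coprime).trans ?_
    simp [baseVec]

theorem color_reg_sub {u v : ℤ × ℤ} (h : IsBasis u v) :
    color (reg (u - v)) = color (reg (u + v)) := by
  have hb : IsBasis v (u - v) := by
    have := h.symm.sub
    rw [← neg_sub]; exact this.neg_right
  rw [← color_reg_add_two hb, sub_add_cancel]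

theorem isBasis_baseVec {i j : Fin 3} (h : i ≠ j) : IsBasis (baseVec i) (baseVec j) := by
  fin_cases i <;> fin_cases j <;> simp [IsBasis, baseVec] at h ⊢

/-- These are the three edges at the base vertex; their far ends carry slopes 1, −2 and −1/2,
realised by the explicit twisted curves above. -/
theorem RelCharacter.slopeTrace_base_edge (χ : RelCharacter τ) {i j : Fin 3} (h : i < j) :
    χ.slopeTrace (reg (baseVec i + baseVec j)) + χ.slopeTrace (reg (baseVec i - baseVec j))
      = (GT τ).coef (color (reg (baseVec i + baseVec j)))
        - χ.slopeTrace (baseSlope i) * χ.slopeTrace (baseSlope j) := by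
  obtain ⟨-, h2, h3, h4⟩ := χ.trace_relations
  rw [← χ.slopeTrace_eq hasSlope_twistBC] at h2
  rw [← χ.slopeTrace_eq hasSlope_twistBC_inv] at h3
  rw [← χ.slopeTrace_eq hasSlope_twistAB] at h4
  have k0 : χ.slopeTrace (baseSlope 0) = χ (gA * gB) := χ.slopeTrace_eq (hasSlope_base 0)
  have k1 : χ.slopeTrace (baseSlope 1) = χ (gB * gC) := χ.slopeTrace_eq (hasSlope_base 1)
  have k2 : χ.slopeTrace (baseSlope 2) = χ (gA * gC) := χ.slopeTrace_eq (hasSlope_base 2)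
  rw [← k0, ← k1, ← k2] at h2 h3 h4
  have hc := color_reg_sub (isBasis_baseVec h.ne)
  fin_cases i <;> fin_cases j <;> simp at h
  · have e1 : reg (baseVec 0 + baseVec 1) = baseSlope 2 := rfl
    have e2 : reg (baseVec 0 - baseVec 1) = reg (1, 1) := by rw [← reg_neg]; rfl
    simp only [Fin.zero_eta, Fin.mk_one, e1, e2, color_baseSlope]
    exact (add_comm _ _).trans h2
  · have e1 : reg (baseVec 0 + baseVec 2) = reg (1, -2) := rfl
    have e2 : reg (baseVec 0 - baseVec 2) = baseSlope 1 := by rw [← reg_neg]; rfl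
    simp only [Fin.zero_eta, Fin.reduceFinMk, e2, color_baseSlope] at hc ⊢
    rw [← hc, e1]
    exact h4
  · have e1 : reg (baseVec 1 + baseVec 2) = reg (2, -1) := rfl
    have e2 : reg (baseVec 1 - baseVec 2) = baseSlope 0 := by rw [← reg_neg]; rfl
    simp only [Fin.mk_one, Fin.reduceFinMk, e2, color_baseSlope] at hc ⊢
    rw [← hc, e1]
    exact h3

/-- Every edge is a translate of a base edge with the same colours, and the base relation holds for
all characters, in particular for g • χ. -/
theorem RelCharacter.slopeTrace_edge (χ : RelCharacter τ) {X Y Z W : Region}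
    (h : IsEdge X Y Z W) : χ.slopeTrace Z + χ.slopeTrace W
      = (GT τ).coef (color Z) - χ.slopeTrace X * χ.slopeTrace Y := by
  have main : ∀ {X Y Z W : Region}, color X < color Y → IsEdge X Y Z W →
      χ.slopeTrace Z + χ.slopeTrace W
        = (GT τ).coef (color Z) - χ.slopeTrace X * χ.slopeTrace Y := by
    intro X Y Z W hlt h
    obtain ⟨g, hX, hY⟩ := exists_smul_pair_eq h.1
    have hg := isEdge_smul g h
    rw [χ.slopeTrace_eq_smul g X, χ.slopeTrace_eq_smul g Y, χ.slopeTrace_eq_smul g Z,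
      χ.slopeTrace_eq_smul g W, ← color_smul g Z]
    rw [hX, hY] at hg ⊢
    obtain ⟨-, hne, hXZ, hYZ, hXW, hYW⟩ := hg
    have hb := isBasis_baseVec hlt.ne
    have hbase := (g • χ).slopeTrace_base_edge hlt
    rcases eq_reg_add_or_eq_reg_sub hb rfl rfl hXZ hYZ with hZ | hZ <;>
      rcases eq_reg_add_or_eq_reg_sub hb rfl rfl hXW hYW with hW | hW
    · exact absurd (hZ.trans hW.symm) hne
    · rw [hZ, hW]; exact hbase
    · rw [hZ, hW, color_reg_sub hb, add_comm]; exact hbase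
    · exact absurd (hZ.trans hW.symm) hne
  rcases lt_or_gt_of_ne (color_ne_of_adj h.1) with hlt | hlt
  · exact main hlt h
  · rw [main hlt (isEdge_swap h), mul_comm]

theorem RelCharacter.slopeTrace_vertex (χ : RelCharacter τ) {X Y Z : Region}
    (h : IsVertex X Y Z) :
    IsMarkoffTriple (GT τ) (χ.slopeTrace X) (χ.slopeTrace Y) (χ.slopeTrace Z) := by
  obtain ⟨cX, cY, cZ, hXY, hYZ, hXZ⟩ := h
  obtain ⟨g, hX, hY⟩ := exists_smul_pair_eq hXY
  rw [cX] at hX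
  rw [cY] at hY
  rw [χ.slopeTrace_eq_smul g X, χ.slopeTrace_eq_smul g Y, χ.slopeTrace_eq_smul g Z, hX, hY]
  rw [← adj_smul g, hX] at hXZ
  rw [← adj_smul g, hY] at hYZ
  generalize g • χ = χ at *
  have h01 : (0 : Fin 3) < 1 := by decide
  have e1 : reg (baseVec 0 + baseVec 1) = baseSlope 2 := rfl
  have k0 : χ.slopeTrace (baseSlope 0) = χ (gA * gB) := χ.slopeTrace_eq (hasSlope_base 0)
  have k1 : χ.slopeTrace (baseSlope 1) = χ (gB * gC) := χ.slopeTrace_eq (hasSlope_base 1)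
  have k2 : χ.slopeTrace (baseSlope 2) = χ (gA * gC) := χ.slopeTrace_eq (hasSlope_base 2)
  have hv := χ.trace_relations.1
  rw [← k0, ← k1, ← k2] at hv
  have he := χ.slopeTrace_base_edge h01
  rw [e1, color_baseSlope] at he
  replace he : χ.slopeTrace (baseSlope 2) + χ.slopeTrace (reg (baseVec 0 - baseVec 1))
    = (GT τ).r - χ.slopeTrace (baseSlope 0) * χ.slopeTrace (baseSlope 1) := he
  rcases eq_reg_add_or_eq_reg_sub (isBasis_baseVec h01.ne) rfl rfl hXZ hYZ with hZ | hZ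
  · rw [hZ, e1]
    exact hv
  · rw [hZ, IsMarkoffTriple]
    -- The third region may be the other end of the base edge; its value is the other Vieta root of
    -- the same quadratic.
    linear_combination hv + (χ.slopeTrace (reg (baseVec 0 - baseVec 1))
      - χ.slopeTrace (baseSlope 2)) * he

/-- The Markoff map of a character. -/
def RelCharacter.toMarkoffMap (χ : RelCharacter τ) : MarkoffMap (GT τ) where
  toFun := χ.slopeTrace
  vertex _ _ _ h := χ.slopeTrace_vertex h
  edge _ _ _ _ h := χ.slopeTrace_edge h

theorem RelCharacter.toMarkoffMap_smul (χ : RelCharacter τ) (m : MCG) :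
    (m • χ).toMarkoffMap = m • χ.toMarkoffMap := by
  ext X
  exact χ.slopeTrace_smul m X

theorem RelCharacter.continuous_toMarkoffMap :
    Continuous (RelCharacter.toMarkoffMap : RelCharacter τ → MarkoffMap (GT τ)) := by
  rw [continuous_induced_rng]
  have e0 : baseSlope 0 = ((0 : ℚ) : Region) := by simp [baseSlope, baseVec, reg]
  have e1 : baseSlope 1 = OnePoint.infty := by simp [baseSlope, baseVec, reg]
  have e2 : baseSlope 2 = ((-1 : ℚ) : Region) := by simp [baseSlope, baseVec, reg]
  have : (fun φ : MarkoffMap (GT τ) =>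
      (φ ((0 : ℚ) : Region), φ OnePoint.infty, φ ((-1 : ℚ) : Region))) ∘
      (RelCharacter.toMarkoffMap : RelCharacter τ → MarkoffMap (GT τ))
      = fun χ => (χ (gA * gB), χ (gB * gC), χ (gA * gC)) := by
    funext χ
    rw [← e0, ← e1, ← e2]
    exact Prod.ext (χ.slopeTrace_eq (hasSlope_base 0))
      (Prod.ext (χ.slopeTrace_eq (hasSlope_base 1)) (χ.slopeTrace_eq (hasSlope_base 2)))
  rw [this]
  exact continuous_induced_dom

theorem bowditchChars_eq_preimage (K : ℝ) :
    bowditchChars τ K = RelCharacter.toMarkoffMap ⁻¹' bowditchMaps (GT τ) K := by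
  ext χ
  refine and_congr ⟨fun h X => ?_, fun h g hg => ?_⟩ ?_
  · exact h _ (isSimple_iff.2 ⟨X, curve_spec X⟩)
  · obtain ⟨X, hX⟩ := isSimple_iff.1 hg
    rw [← χ.slopeTrace_eq hX]
    exact h X
  · have himage : {c : CurveClass | ∃ g, IsSimple g ∧ c = Quotient.mk curveSetoid g ∧ ‖χ g‖ ≤ K}
        = (fun X => Quotient.mk curveSetoid (curve X)) '' {X | ‖χ.toMarkoffMap X‖ ≤ K} := by
      ext c
      constructor
      · rintro ⟨g, hg, rfl, hK⟩
        obtain ⟨X, hX⟩ := isSimple_iff.1 hg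
        refine ⟨X, ?_, Quotient.sound ((curve_spec X).rel hX)⟩
        rw [← χ.slopeTrace_eq hX] at hK
        exact hK
      · rintro ⟨X, hX, rfl⟩
        exact ⟨_, isSimple_iff.2 ⟨X, curve_spec X⟩, rfl, hX⟩
    rw [himage]
    refine Set.finite_image_iff ?_
    intro X _ Y _ hXY
    exact (curve_spec X).eq_of_rel (curve_spec Y) (Quotient.exact hXY)

/-! ## Proper discontinuity -/

theorem smul_mem_bowditchMaps {μ : Param} {L : ℝ} (g : MCG) {φ : MarkoffMap μ}
    (hφ : φ ∈ bowditchMaps μ L) : g • φ ∈ bowditchMaps μ L := by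
  refine ⟨fun X => hφ.1 _, (hφ.2.image (g • ·)).subset fun X hX => ⟨g⁻¹ • X, hX, ?_⟩⟩
  simp

/-- If g⁻¹ and h⁻¹ agree on two adjacent slopes, then hg⁻¹ fixes both, so g = h. -/
theorem finite_setOf_smul_base_mem {S : Set Region} (hS : S.Finite) :
    {g : MCG | g⁻¹ • baseSlope 0 ∈ S ∧ g⁻¹ • baseSlope 1 ∈ S}.Finite := by
  refine Set.Finite.of_finite_image (f := fun g : MCG => (g⁻¹ • baseSlope 0, g⁻¹ • baseSlope 1))
    ((hS.prod hS).subset ?_) ?_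
  · rintro _ ⟨g, hg, rfl⟩
    exact hg
  · intro g _ h _ e
    obtain ⟨e0, e1⟩ := Prod.ext_iff.1 e
    simp only at e0 e1
    refine (mul_inv_eq_one.1 (eq_one_of_smul_eq (isBasis_baseVec (i := 0) (j := 1) (by decide))
      ?_ ?_)).symm
    · rw [mul_smul]
      exact (congrArg (h • ·) e0).trans (smul_inv_smul _ _)
    · rw [mul_smul]
      exact (congrArg (h • ·) e1).trans (smul_inv_smul _ _)

theorem actsProperlyDiscontinuouslyOn_bowditchMaps {μ : Param} {L : ℝ} (hα : 2 + alpha μ ≤ L)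
    (hL : 2 < L) (hM : centerBound μ + 1 ≤ L) :
    ActsProperlyDiscontinuouslyOn MCG (bowditchMaps μ L) := by
  refine ⟨fun g φ hφ => smul_mem_bowditchMaps g hφ, fun K hKL hK => ?_⟩
  have bdd : ∀ X : Region, ∃ N, ∀ φ ∈ K, ‖φ X‖ ≤ N := fun X =>
    hK.exists_bound_of_continuousOn (continuous_apply X).continuousOn
  obtain ⟨N₀, h0⟩ := bdd (baseSlope 0)
  obtain ⟨N₁, h1⟩ := bdd (baseSlope 1)
  -- The value of gφ at a base slope is that of φ at its image under g⁻¹, and compactness bounds it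
  -- on K.
  refine (finite_setOf_smul_base_mem
    (finite_small_of_isCompact hα hL hM hK hKL (max N₀ N₁))).subset ?_
  rintro g ⟨_, ⟨φ, hφ, rfl⟩, hgφ⟩
  exact ⟨⟨φ, hφ, (h0 _ hgφ).trans (le_max_left _ _)⟩, ⟨φ, hφ, (h1 _ hgφ).trans (le_max_right _ _)⟩⟩

theorem actsProperlyDiscontinuouslyOn_bowditchChars {τ : BoundaryTraces} {L : ℝ}
    (h : ActsProperlyDiscontinuouslyOn MCG (bowditchMaps (GT τ) L)) :
    ActsProperlyDiscontinuouslyOn MCG (bowditchChars τ L) := by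
  rw [bowditchChars_eq_preimage]
  refine ⟨fun g χ hχ => ?_, fun K hKL hK => ?_⟩
  · rw [Set.mem_preimage, χ.toMarkoffMap_smul]
    exact h.1 g _ hχ
  · refine (h.2 (RelCharacter.toMarkoffMap '' K) (Set.image_subset_iff.2 hKL)
      (hK.image RelCharacter.continuous_toMarkoffMap)).subset ?_
    rintro g ⟨_, ⟨χ, hχ, rfl⟩, hgχ⟩
    exact ⟨_, ⟨_, ⟨χ, hχ, rfl⟩, (χ.toMarkoffMap_smul g).symm⟩, ⟨_, hgχ, rfl⟩⟩

end

end FourHoledSphere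

end


/-! ### The theorem for the constant L(μ). -/

theorem theorem4 (μ : FourHoledSphere.Param) :
    (∃ m, FourHoledSphere.IsSinkBound μ m) ∧
    ∀ m, FourHoledSphere.IsSinkBound μ m →
      FourHoledSphere.ActsProperlyDiscontinuouslyOn FourHoledSphere.MCG (FourHoledSphere.bowditchMaps μ (FourHoledSphere.bqConst μ m)) ∧
      IsOpen (FourHoledSphere.bowditchMaps μ (FourHoledSphere.bqConst μ m)) ∧
      ∀ τ : FourHoledSphere.BoundaryTraces, FourHoledSphere.GT τ = μ →
        FourHoledSphere.ActsProperlyDiscontinuouslyOn FourHoledSphere.MCG (FourHoledSphere.bowditchChars τ (FourHoledSphere.bqConst μ m)) ∧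
        IsOpen (FourHoledSphere.bowditchChars τ (FourHoledSphere.bqConst μ m)) := by
  refine ⟨FourHoledSphere.exists_isSinkBound μ, fun m hm => ?_⟩
  have hα : 2 + FourHoledSphere.alpha μ ≤ FourHoledSphere.bqConst μ m := le_max_left _ _
  have hL : 2 < FourHoledSphere.bqConst μ m :=
    hm.1.trans_le ((le_max_left _ _).trans (le_max_right _ _))
  have hM : FourHoledSphere.centerBound μ + 1 ≤ FourHoledSphere.bqConst μ m :=
    (le_max_right _ _).trans (le_max_right _ _)
  have hP := FourHoledSphere.actsProperlyDiscontinuouslyOn_bowditchMaps hα hL hM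
  have hO := FourHoledSphere.isOpen_bowditchMaps hα hL hM
  refine ⟨hP, hO, ?_⟩
  rintro τ rfl
  refine ⟨FourHoledSphere.actsProperlyDiscontinuouslyOn_bowditchChars hP, ?_⟩
  rw [FourHoledSphere.bowditchChars_eq_preimage]
  exact hO.preimage FourHoledSphere.RelCharacter.continuous_toMarkoffMap
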